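/- **Theorem 4.4.** Let $d\in\mathbb N$, $\alpha\in(-1/2,\infty)^d$ and let $\mu_\alpha$ be the Laguerre measure $d\mu_\alpha(x)=\prod_{i=1}^d \frac{x_i^{\alpha_i}e^{-x_i}}{\Gamma(\alpha_i+1)}\,dx$ on $(0,\infty)^d$. Let $L_k^\alpha$ $(k\in\mathbb N^d)$ be the Laguerre polynomials of type $\alpha$, which form an orthogonal basis of $L^2(\mu_\alpha)$, $|k|=k_1+\dots+k_d$, and let $\mathcal L_\alpha$ be the Laguerre operator, so that $\mathcal L_\alpha L_k^\alpha=|k|L_k^\alpha$. Let $T_t^\alpha=e^{-t\mathcal L_\alpha}$ be the Laguerre semigroup, $$T_t^\alpha f(x)=\int G_t^\alpha(x,y)f(y)\,d\mu_\alpha(y),\qquad G_t^\alpha(x,y)=\prod_{j=1}^d\frac{\Gamma(\alpha_j+1)}{1-e^{-t}}\,e^{-\frac{e^{-t}}{1-e^{-t}}(x_j+y_j)}\big(\sqrt{e^{-t}x_jy_j}\big)^{-\alpha_j}I_{\alpha_j}\!\Big(\frac{2\sqrt{e^{-t}x_jy_j}}{1-e^{-t}}\Big)$$ ($t>0$; $I_\nu$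 is the modified Bessel function of the first kind), and let $P_t^\alpha f(x)=\frac1{\sqrt\pi}\int_0^\infty \frac{e^{-u}}{\sqrt u}\,T^\alpha_{t^2/(4u)}f(x)\,du$ be the Poisson–Laguerre semigroup. For $\beta>0$, with $n$ the smallest integer greater than $\beta$, the space $Lip_\beta(\mu_\alpha)$ consists of the (real) functions $f\in L^\infty(\mu_\alpha)$ for which there is a constant $A$ with $\|\partial_t^nP_t^\alpha f\|_\infty\le A\,t^{-n+\beta}$ for all $t>0$; its norm is $\|f\|_\infty+A_\beta(f)$, where $A_\beta(f)\ge 0$ is the smallest such $A$. For $\lambda>0$ let $D_\lambda^\alpha=\mathcal L_\alpha^{\lambda/2}$ and $(I+\sqrt{\mathcal L_\alpha})^\lambda$ be the operators in $L^2(\mu_\alpha)$ that act on $L_k^\alpha$ as multiplication by $|k|^{\lambda/2}$ and by $(1+\sqrt{|k|})^\lambda$ (on their maximal domains). Let $1\le\lambda<\beta$, let $k$ be the smallest integer greater than $\lambda$, and let $c=\int_0^\infty u^{-\lambda-1}(e^{-u}-1)^k\,du$. Then: (i) Every $f\in Lip_\beta(\mu_\alpha)$ lies in the domain of $D_\lambda^\alpha$,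 and $D_\lambda^\alpha$ is bounded from $Lip_\beta(\mu_\alpha)$ to $Lip_{\beta-\lambda}(\mu_\alpha)$: there is a constant $C$, independent of $f$, with $\|D_\lambda^\alpha f\|_{Lip_{\beta-\lambda}(\mu_\alpha)}\le C\|f\|_{Lip_\beta(\mu_\alpha)}$. Moreover, for almost every $x$, with an absolutely convergent integral, $$D_\lambda^\alpha f(x)=\frac1c\int_0^\infty s^{-\lambda-1}\,(P_s^\alpha-I)^kf(x)\,ds .$$ (ii) Every $f\in Lip_\beta(\mu_\alpha)$ lies in the domain of $(I+\sqrt{\mathcal L_\alpha})^\lambda$, and $(I+\sqrt{\mathcal L_\alpha})^\lambda$ is bounded from $Lip_\beta(\mu_\alpha)$ to $Lip_{\beta-\lambda}(\mu_\alpha)$ in the same sense. Moreover, for almost every $x$, with an absolutely convergent integral, $$(I+\sqrt{\mathcal L_\alpha})^\lambda f(x)=\frac1c\int_0^\infty s^{-\lambda-1}\,(e^{-s}P_s^\alpha-I)^kf(x)\,ds .$$ -/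

import Mathlib

open MeasureTheory Set Filter

noncomputable section

/-- The Laguerre measure `μ_α` on `(0,∞)^d`, of density `∏ x_i ^ α_i * exp (-x_i) / Γ(α_i + 1)` with
respect to Lebesgue measure, as a measure on `ℝ^d` (it gives no mass to the complement of `(0,∞)^d`).
`gammaMeasure (a + 1) 1` has the density `x ^ a * exp (-x) / Γ(a + 1)` on the half-line. -/
def laguerreMeasure {d : ℕ} (α : Fin d → ℝ) : Measure (Fin d → ℝ) :=
  Measure.pi fun i => ProbabilityTheory.gammaMeasure (α i + 1) 1

/-- One-dimensional Laguerre polynomial of type `a` and degree `k`, at `x > 0` (Rodrigues). -/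
def laguerrePoly1 (a : ℝ) (k : ℕ) (x : ℝ) : ℝ :=
  1 / (k.factorial : ℝ) * Real.exp x * x ^ (-a) *
    iteratedDeriv k (fun y : ℝ => Real.exp (-y) * y ^ ((k : ℝ) + a)) x

/-- `d`-dimensional Laguerre polynomial of type `α` and multi-degree `k`, on `(0,∞)^d`. -/
def laguerrePoly {d : ℕ} (α : Fin d → ℝ) (k : Fin d → ℕ) (x : Fin d → ℝ) : ℝ :=
  ∏ i, laguerrePoly1 (α i) (k i) (x i)

/-- Modified Bessel function of the first kind `I_ν(z)`, for `z > 0`. -/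
def besselI (ν z : ℝ) : ℝ :=
  ∑' m : ℕ, (z / 2) ^ (2 * (m : ℝ) + ν) / ((m.factorial : ℝ) * Real.Gamma ((m : ℝ) + ν + 1))

/-- The Laguerre heat kernel `G_t(x,y)`, `t > 0`, with respect to the Laguerre measure. -/
def laguerreHeatKernel {d : ℕ} (α : Fin d → ℝ) (t : ℝ) (x y : Fin d → ℝ) : ℝ :=
  ∏ j, Real.Gamma (α j + 1) / (1 - Real.exp (-t)) *
    Real.exp (-(Real.exp (-t) / (1 - Real.exp (-t))) * (x j + y j)) *
    Real.sqrt (Real.exp (-t) * x j * y j) ^ (-α j) *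
    besselI (α j) (2 * Real.sqrt (Real.exp (-t) * x j * y j) / (1 - Real.exp (-t)))

/-- The Laguerre (heat) semigroup `T_t`, with `T_0` the identity (negative times are irrelevant). -/
def laguerreHeat {d : ℕ} (α : Fin d → ℝ) (t : ℝ) (f : (Fin d → ℝ) → ℝ) (x : Fin d → ℝ) : ℝ :=
  if 0 < t then ∫ y, laguerreHeatKernel α t x y * f y ∂(laguerreMeasure α) else f x

/-- The Poisson–Laguerre semigroup `P_t`, by subordination. -/
def laguerrePoisson {d : ℕ} (α : Fin d → ℝ) (t : ℝ) (f : (Fin d → ℝ) → ℝ) (x : Fin d → ℝ) : ℝ :=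
  1 / Real.sqrt Real.pi *
    ∫ u in Ioi (0 : ℝ), Real.exp (-u) / Real.sqrt u * laguerreHeat α (t ^ 2 / (4 * u)) f x

/-- For `b ≥ 0`, the smallest integer (strictly) greater than `b`. -/
def nextInt (b : ℝ) : ℕ := ⌊b⌋₊ + 1

/-- The real number `A` satisfies `‖∂ⁿ P_t f / ∂tⁿ‖_∞ ≤ A t ^ (-n + β)` for all `t > 0`,
where `n` is the smallest integer greater than `β`. -/
def LaguerreLipBound {d : ℕ} (α : Fin d → ℝ) (β : ℝ) (f : (Fin d → ℝ) → ℝ) (A : ℝ) : Prop :=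
  0 ≤ A ∧ ∀ t : ℝ, 0 < t →
    eLpNorm (fun x => iteratedDeriv (nextInt β) (fun s => laguerrePoisson α s f x) t) ⊤
        (laguerreMeasure α)
      ≤ ENNReal.ofReal (A * t ^ (-(nextInt β : ℝ) + β))

/-- `f` belongs to the Laguerre Lipschitz space `Lip_β(μ_α)`. -/
def MemLaguerreLip {d : ℕ} (α : Fin d → ℝ) (β : ℝ) (f : (Fin d → ℝ) → ℝ) : Prop :=
  MemLp f ⊤ (laguerreMeasure α) ∧ ∃ A : ℝ, LaguerreLipBound α β f A

/-- The norm `‖f‖_∞ + A_β(f)` of `Lip_β(μ_α)`, where `A_β(f)` is the smallest admissible constant. -/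
def laguerreLipNorm {d : ℕ} (α : Fin d → ℝ) (β : ℝ) (f : (Fin d → ℝ) → ℝ) : ℝ :=
  (eLpNorm f ⊤ (laguerreMeasure α)).toReal + sInf {A : ℝ | LaguerreLipBound α β f A}

/-- `f` lies in the domain of the operator `m(L_α)` in `L²(μ_α)`, and `g = m(L_α) f`. The Laguerre
polynomials are an orthogonal basis of `L²(μ_α)` and `L_α` acts on the one of multi-degree `k` as
multiplication by `|k| = k_1 + ⋯ + k_d`, so that this says that `g ∈ L²` has the coefficients
`m(|k|) ⟨f, L_k⟩`. -/
def IsLaguerreMultiplier {d : ℕ} (α : Fin d → ℝ) (m : ℕ → ℝ) (f g : (Fin d → ℝ) → ℝ) : Prop :=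
  MemLp f 2 (laguerreMeasure α) ∧ MemLp g 2 (laguerreMeasure α) ∧
    ∀ k : Fin d → ℕ,
      ∫ x, g x * laguerrePoly α k x ∂(laguerreMeasure α)
        = m (∑ i, k i) * ∫ x, f x * laguerrePoly α k x ∂(laguerreMeasure α)

/-- `g = D_λ f`, the Laguerre fractional derivative `D_λ = L_α ^ (λ/2)`. -/
def IsLaguerreFracDeriv {d : ℕ} (α : Fin d → ℝ) (lam : ℝ) (f g : (Fin d → ℝ) → ℝ) : Prop :=
  IsLaguerreMultiplier α (fun n => (n : ℝ) ^ (lam / 2)) f g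

/-- `g = (I + √L_α) ^ λ f`, the Bessel–Laguerre fractional derivative. -/
def IsBesselLaguerreFracDeriv {d : ℕ} (α : Fin d → ℝ) (lam : ℝ) (f g : (Fin d → ℝ) → ℝ) : Prop :=
  IsLaguerreMultiplier α (fun n => (1 + Real.sqrt (n : ℝ)) ^ lam) f g

/-- The operator `P_s - I`. -/
def poissonDiff {d : ℕ} (α : Fin d → ℝ) (s : ℝ) (h : (Fin d → ℝ) → ℝ) (x : Fin d → ℝ) : ℝ :=
  laguerrePoisson α s h x - h x

/-- The operator `e^{-s} P_s - I`. -/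
def besselPoissonDiff {d : ℕ} (α : Fin d → ℝ) (s : ℝ) (h : (Fin d → ℝ) → ℝ) (x : Fin d → ℝ) : ℝ :=
  Real.exp (-s) * laguerrePoisson α s h x - h x

/-- The constant `c = ∫_0^∞ u ^ (-λ-1) (e^{-u} - 1) ^ k du`, `k` the smallest integer `> λ`. -/
def fracConst (lam : ℝ) : ℝ :=
  ∫ u in Ioi (0 : ℝ), u ^ (-lam - 1) * (Real.exp (-u) - 1) ^ nextInt lam

end

/-!
# Fractional derivatives on Laguerre Lipschitz spaces

Both parts of the theorem concern the multiplier `(ε + √|k|)^λ`, with `ε = 0` for `L^{λ/2}` and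
`ε = 1` for `(I + √L)^λ`, and both follow from the damped Poisson semigroup `Q_t = e^{-εt} P_t`,
which multiplies the coefficient of multi-degree `k` by `e^{-tρ}`, `ρ = ε + √|k|`.

A square-integrable function is determined by its Laguerre coefficients (`laguerre_complete`): the
measures `h⁺ dμ_α` and `h⁻ dμ_α` have the same moments if all coefficients of `h` vanish, and their
moment generating functions are analytic in a strip. Identities between bounded functions, such as
the semigroup law, the integral formula of the differences `(Q_s - I)^k f`, and the formula below
for `∂^m Q_t g`, are therefore proved by comparing coefficients, which reduces each of them to
Fubini's theorem (`mixture_properties`) and an integral in one variable. The action of the heat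
semigroup on coefficients comes from `T_t L_k = e^{-t|k|} L_k`; this holds because the kernel is a
Poisson mixture of gamma densities, so that its moments are explicit
(`lintegral_heatKernelE_mul_pow`).

By subordination, `t ↦ Q_t f (x)` extends holomorphically to the sector `Re z² > 0`, and Cauchy's
estimate bounds its `j`-th derivative by a constant times `‖f‖_∞ t^{-j}`
(`abs_iteratedDeriv_dampedSubordination_le`). Hence only `t ≤ 1` matters in Lipschitz bounds. The
Lipschitz condition passes to `Q_t` (`exists_bound_damped`, Leibniz' rule), to derivatives of higher
order (`exists_bound_higher`, the semigroup law) and to smaller orders (`exists_bound_lower`,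
integration in `t`).

Let now `k` be the smallest integer above `λ`. The bound of `∂^k Q_t f` for an order in `(λ, k)`
makes `(Q_s - I)^k f` small of an order above `λ` as `s → 0` (`abs_iterate_dampedDiff_le`), so that
`g = (1/c) ∫ s^{-λ-1} (Q_s - I)^k f ds` converges, is bounded, and has the coefficients of `f` times
`ρ^λ`. Moreover `∂^m Q_t g = (-1)^k / Γ(k - λ) ∫ s^{k-λ-1} ∂^{m+k} Q_{t+s} f ds`, which the bound
for `∂^{m+k} Q_t f` turns into the Lipschitz bound of order `β - λ` (`exists_fracDeriv`).
-/

/-! ### Subordination in the time variable -/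

theorem integrableOn_rpow_mul_exp_neg {s b : ℝ} (hs : -1 < s) (hb : 0 < b) :
    IntegrableOn (fun q : ℝ => q ^ s * Real.exp (-(b * q))) (Ioi 0) := by
  have h := integrableOn_rpow_mul_exp_neg_mul_rpow (p := 1) hs one_pos hb
  refine h.congr_fun (fun q _ => ?_) measurableSet_Ioi
  simp [neg_mul]

/-- Laplace transforms of functions of size `O(q ^ (-1/2))` are holomorphic on the right half-plane.
In the subordination integral the substitution `q = 1 / v` turns `T_v f (x)` into such a weight. -/
theorem hasDerivAt_laplace {w : ℝ → ℝ} {M : ℝ}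
    (hw : AEStronglyMeasurable w (volume.restrict (Ioi 0)))
    (hM : ∀ q, 0 < q → |w q| ≤ M * q ^ (-(1 / 2) : ℝ)) {y₀ : ℂ} (hy : 0 < y₀.re) :
    HasDerivAt (fun y : ℂ => ∫ q in Ioi (0 : ℝ), Complex.exp (-(y * q)) * (w q : ℂ))
      (∫ q in Ioi (0 : ℝ), -(q : ℂ) * Complex.exp (-(y₀ * q)) * (w q : ℂ)) y₀ := by
  have hwc : AEStronglyMeasurable (fun q => (w q : ℂ)) (volume.restrict (Ioi 0)) :=
    Complex.continuous_ofReal.comp_aestronglyMeasurable hw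
  have hpos : ∀ᵐ q ∂(volume.restrict (Ioi (0 : ℝ))), 0 < q :=
    ae_restrict_mem measurableSet_Ioi
  refine (hasDerivAt_integral_of_dominated_loc_of_deriv_le
    (F := fun (y : ℂ) (q : ℝ) => Complex.exp (-(y * q)) * (w q : ℂ))
    (F' := fun (y : ℂ) (q : ℝ) => -(q : ℂ) * Complex.exp (-(y * q)) * (w q : ℂ))
    (s := {y : ℂ | y₀.re / 2 < y.re})
    (bound := fun q => M * (q ^ (1 / 2 : ℝ) * Real.exp (-(y₀.re / 2 * q)))) ?_ ?_ ?_ ?_ ?_ ?_ ?_).2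
  · exact (isOpen_lt continuous_const Complex.continuous_re).mem_nhds (by simp; linarith)
  · refine Eventually.of_forall fun y => ?_
    exact AEStronglyMeasurable.mul (by fun_prop) hwc
  · refine Integrable.mono'
      ((integrableOn_rpow_mul_exp_neg (s := -(1 / 2)) (by norm_num) hy).const_mul M)
      (AEStronglyMeasurable.mul (by fun_prop) hwc) ?_
    filter_upwards [hpos] with q hq
    rw [norm_mul, Complex.norm_exp, Complex.norm_real, Real.norm_eq_abs]
    have h1 : (-(y₀ * (q : ℂ))).re = -(y₀.re * q) := by simp
    rw [h1, mul_comm, ← mul_assoc]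
    exact mul_le_mul_of_nonneg_right (hM q hq) (Real.exp_pos _).le
  · exact AEStronglyMeasurable.mul (by fun_prop) hwc
  · filter_upwards [hpos] with q hq y hyy
    rw [norm_mul, norm_mul, Complex.norm_exp, Complex.norm_real, Real.norm_eq_abs, norm_neg,
      Complex.norm_real, Real.norm_eq_abs, abs_of_pos hq]
    have h1 : (-(y * (q : ℂ))).re = -(y.re * q) := by simp
    have hyy' : y₀.re / 2 < y.re := hyy
    rw [h1]
    have h2 : Real.exp (-(y.re * q)) ≤ Real.exp (-(y₀.re / 2 * q)) :=
      Real.exp_le_exp.2 (by nlinarith)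
    have h3 : q * q ^ (-(1 / 2) : ℝ) = q ^ (1 / 2 : ℝ) := by
      rw [← Real.rpow_one_add' hq.le (by norm_num)]; norm_num
    have hMq := hM q hq
    calc q * Real.exp (-(y.re * q)) * |w q|
        ≤ q * Real.exp (-(y₀.re / 2 * q)) * (M * q ^ (-(1 / 2) : ℝ)) := by
          gcongr
      _ = M * (q * q ^ (-(1 / 2) : ℝ) * Real.exp (-(y₀.re / 2 * q))) := by ring
      _ = _ := by rw [h3]
  · exact (integrableOn_rpow_mul_exp_neg (by norm_num) (by linarith)).const_mul M
  · refine Eventually.of_forall fun q y _ => ?_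
    have h1 : HasDerivAt (fun y : ℂ => -(y * (q : ℂ))) (-(q : ℂ)) y := by
      simpa using ((hasDerivAt_id y).mul_const (q : ℂ)).fun_neg
    simpa [mul_comm] using h1.cexp.mul_const (w q : ℂ)

theorem norm_laplace_le {w : ℝ → ℝ} {M : ℝ} (hM0 : 0 ≤ M)
    (hM : ∀ q, 0 < q → |w q| ≤ M * q ^ (-(1 / 2) : ℝ)) {y : ℂ} {b : ℝ} (hb : 0 < b)
    (hy : b ≤ y.re) :
    ‖∫ q in Ioi (0 : ℝ), Complex.exp (-(y * q)) * (w q : ℂ)‖ ≤ M * Real.sqrt (Real.pi / b) := by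
  have hI := Real.integral_rpow_mul_exp_neg_mul_Ioi (a := 1 / 2) (by norm_num) hb
  have hE : Real.sqrt (Real.pi / b) = (1 / b) ^ (1 / 2 : ℝ) * Real.Gamma (1 / 2) := by
    rw [Real.Gamma_one_half_eq, ← Real.sqrt_eq_rpow, ← Real.sqrt_mul (by positivity)]
    congr 1; ring
  have he : ((1 / 2 : ℝ) - 1) = -(1 / 2) := by norm_num
  rw [hE, ← hI, he, ← integral_const_mul]
  refine norm_integral_le_of_norm_le
    ((integrableOn_rpow_mul_exp_neg (by norm_num) hb).const_mul M) ?_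
  filter_upwards [ae_restrict_mem measurableSet_Ioi] with q (hq : 0 < q)
  rw [norm_mul, Complex.norm_exp, Complex.norm_real, Real.norm_eq_abs]
  have h1 : (-(y * (q : ℂ))).re = -(y.re * q) := by simp
  rw [h1, mul_comm, ← mul_assoc]
  have := hM q hq
  gcongr

/-- If `Φ` is holomorphic near the positive half-line, the real derivatives of `t ↦ Re Φ(t)` are
the real parts of the complex derivatives of `Φ`. -/
theorem iteratedDeriv_re_ofReal {Φ : ℂ → ℂ} {U : Set ℂ} (hU : IsOpen U)
    (hΦ : DifferentiableOn ℂ Φ U) (hpos : ∀ t : ℝ, 0 < t → (t : ℂ) ∈ U) (j : ℕ) :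
    ∀ t : ℝ, 0 < t →
      iteratedDeriv j (fun s : ℝ => (Φ s).re) t = (iteratedDeriv j Φ t).re := by
  induction j with
  | zero => intro t _; simp
  | succ j ih =>
    intro t ht
    have hA : AnalyticOnNhd ℂ (iteratedDeriv j Φ) U := by
      rw [iteratedDeriv_eq_iterate]; exact (hΦ.analyticOnNhd hU).iterated_deriv j
    have hd := ((hA t (hpos t ht)).differentiableAt.hasDerivAt).real_of_complex
    rw [iteratedDeriv_succ, iteratedDeriv_succ, ← hd.deriv]
    refine EventuallyEq.deriv_eq ?_
    filter_upwards [Ioi_mem_nhds ht] with s hs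
    exact ih s hs

/-- Subordination in one time variable, with damping: the value at time `t` of
`e^{-εt} P_t f (x)` when `τ v = T_v f (x)`. -/
noncomputable def dampedSubordination (ε : ℝ) (τ : ℝ → ℝ) (t : ℝ) : ℝ :=
  Real.exp (-(ε * t)) * (1 / Real.sqrt Real.pi *
    ∫ u in Ioi (0 : ℝ), Real.exp (-u) / Real.sqrt u * τ (t ^ 2 / (4 * u)))

/-- The holomorphic extension of `dampedSubordination` to the sector `Re z² > 0`. -/
noncomputable def dampedSubordinationC (ε : ℝ) (τ : ℝ → ℝ) (z : ℂ) : ℂ :=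
  Complex.exp (-(ε * z)) * (z / (2 * Real.sqrt Real.pi : ℝ) *
    ∫ q in Ioi (0 : ℝ), Complex.exp (-(z ^ 2 / 4 * q)) *
      ((q ^ (-(1 / 2) : ℝ) * τ (1 / q) : ℝ) : ℂ))

theorem dampedSubordinationC_ofReal (ε : ℝ) (τ : ℝ → ℝ) {t : ℝ} (ht : 0 < t) :
    dampedSubordinationC ε τ t = (dampedSubordination ε τ t : ℂ) := by
  have h1 : ∫ q in Ioi (0 : ℝ), Complex.exp (-((t : ℂ) ^ 2 / 4 * q)) *
      ((q ^ (-(1 / 2) : ℝ) * τ (1 / q) : ℝ) : ℂ)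
      = ((∫ q in Ioi (0 : ℝ), Real.exp (-(t ^ 2 / 4 * q)) * (q ^ (-(1 / 2) : ℝ) * τ (1 / q)) : ℝ)
        : ℂ) := by
    rw [← integral_complex_ofReal]
    congr 1; ext q; push_cast; ring
  have hb : 0 < t ^ 2 / 4 := by positivity
  have h2 := integral_comp_mul_left_Ioi'
    (fun u : ℝ => Real.exp (-u) / Real.sqrt u * τ (t ^ 2 / (4 * u))) 0 hb
  have h3 : ∫ q in Ioi (0 : ℝ), Real.exp (-(t ^ 2 / 4 * q)) / Real.sqrt (t ^ 2 / 4 * q) *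
        τ (t ^ 2 / (4 * (t ^ 2 / 4 * q)))
      = (2 / t) * ∫ q in Ioi (0 : ℝ),
          Real.exp (-(t ^ 2 / 4 * q)) * (q ^ (-(1 / 2) : ℝ) * τ (1 / q)) := by
    rw [← integral_const_mul]
    refine setIntegral_congr_fun measurableSet_Ioi fun q (hq : 0 < q) => ?_
    have e1 : t ^ 2 / (4 * (t ^ 2 / 4 * q)) = 1 / q := by field_simp
    have e2 : Real.sqrt (t ^ 2 / 4 * q) = t / 2 * Real.sqrt q := by
      rw [Real.sqrt_mul (by positivity), show t ^ 2 / 4 = (t / 2) ^ 2 by ring,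
        Real.sqrt_sq (by positivity)]
    have e3 : q ^ (-(1 / 2) : ℝ) = (Real.sqrt q)⁻¹ := by
      rw [Real.rpow_neg hq.le, Real.sqrt_eq_rpow]
    simp only [e1, e2, e3]
    have := Real.sqrt_pos.2 hq
    field_simp
  simp only [mul_zero, smul_eq_mul] at h2
  rw [dampedSubordinationC, h1, dampedSubordination, ← h2, h3]
  have := Real.sqrt_pos.2 Real.pi_pos
  push_cast
  have hs : ((Real.sqrt Real.pi : ℝ) : ℂ) ≠ 0 := by exact_mod_cast this.ne'
  have ht' : (t : ℂ) ≠ 0 := by exact_mod_cast ht.ne'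
  field_simp
  ring

section

variable {τ : ℝ → ℝ} {M : ℝ}

theorem subordination_weight (hM : ∀ v, 0 < v → |τ v| ≤ M) (q : ℝ) (hq : 0 < q) :
    |q ^ (-(1 / 2) : ℝ) * τ (1 / q)| ≤ M * q ^ (-(1 / 2) : ℝ) := by
  rw [abs_mul, abs_of_pos (Real.rpow_pos_of_pos hq _), mul_comm]
  exact mul_le_mul_of_nonneg_right (hM _ (by positivity)) (Real.rpow_pos_of_pos hq _).le

theorem isOpen_sector : IsOpen {z : ℂ | 0 < (z ^ 2 / 4).re} :=
  isOpen_lt continuous_const (Complex.continuous_re.comp (by fun_prop))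

theorem ofReal_mem_sector {t : ℝ} (ht : 0 < t) : (t : ℂ) ∈ {z : ℂ | 0 < (z ^ 2 / 4).re} := by
  have : ((t : ℂ) ^ 2 / 4).re = t ^ 2 / 4 := by
    have : ((t : ℂ) ^ 2 / 4) = ((t ^ 2 / 4 : ℝ) : ℂ) := by push_cast; ring
    rw [this, Complex.ofReal_re]
  simp only [mem_ofPred_eq, this]; positivity

theorem differentiableOn_dampedSubordinationC (ε : ℝ) (hτ : Measurable τ)
    (hM : ∀ v, 0 < v → |τ v| ≤ M) :
    DifferentiableOn ℂ (dampedSubordinationC ε τ) {z : ℂ | 0 < (z ^ 2 / 4).re} := by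
  intro z hz
  have hw : AEStronglyMeasurable (fun q : ℝ => q ^ (-(1 / 2) : ℝ) * τ (1 / q))
      (volume.restrict (Ioi 0)) := by
    have : Measurable (fun q : ℝ => q ^ (-(1 / 2) : ℝ) * τ (1 / q)) := by fun_prop
    exact this.aestronglyMeasurable
  have h1 := hasDerivAt_laplace hw (subordination_weight hM) (y₀ := z ^ 2 / 4) hz
  have h2 : DifferentiableAt ℂ (fun z : ℂ => ∫ q in Ioi (0 : ℝ), Complex.exp (-(z ^ 2 / 4 * q)) *
      ((q ^ (-(1 / 2) : ℝ) * τ (1 / q) : ℝ) : ℂ)) z :=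
    DifferentiableAt.comp (g := fun y : ℂ => ∫ q in Ioi (0 : ℝ), Complex.exp (-(y * q)) *
      ((q ^ (-(1 / 2) : ℝ) * τ (1 / q) : ℝ) : ℂ)) (f := fun z : ℂ => z ^ 2 / 4) z
      h1.differentiableAt (by fun_prop)
  refine DifferentiableAt.differentiableWithinAt ?_
  unfold dampedSubordinationC
  exact DifferentiableAt.mul (by fun_prop) (DifferentiableAt.mul (by fun_prop) h2)

/-- The disc of radius `t / 4` around `t > 0` lies in the sector `Re z² > 0`, and the holomorphic
extension is bounded there independently of `t`. -/
theorem norm_dampedSubordinationC_le {ε : ℝ} (hε : 0 ≤ ε) (hM0 : 0 ≤ M)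
    (hM : ∀ v, 0 < v → |τ v| ≤ M) {t : ℝ} (ht : 0 < t) {z : ℂ} (hz : ‖z - t‖ ≤ t / 4) :
    0 < (z ^ 2 / 4).re ∧ ‖dampedSubordinationC ε τ z‖ ≤ 2 * M := by
  have hre : |z.re - t| ≤ t / 4 := by
    have := Complex.abs_re_le_norm (z - t); simp at this; linarith
  have him : |z.im| ≤ t / 4 := by
    have := Complex.abs_im_le_norm (z - t); simp at this; linarith
  have hn : ‖z‖ ≤ 5 * t / 4 := by
    calc ‖z‖ = ‖(z - t) + t‖ := by ring_nf
      _ ≤ ‖z - t‖ + ‖(t : ℂ)‖ := norm_add_le _ _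
      _ ≤ _ := by rw [Complex.norm_real, Real.norm_eq_abs, abs_of_pos ht]; linarith
  have hsq : (z ^ 2 / 4).re = (z.re ^ 2 - z.im ^ 2) / 4 := by
    have : (z ^ 2 / 4) = z ^ 2 * ((1 / 4 : ℝ) : ℂ) := by push_cast; ring
    rw [this, Complex.re_mul_ofReal, pow_two, Complex.mul_re]; ring
  rw [abs_le] at hre him
  have hlow : t ^ 2 / 8 ≤ (z ^ 2 / 4).re := by
    rw [hsq]
    have h1 : z.im ^ 2 ≤ (t / 4) ^ 2 := sq_le_sq' (by linarith [him.1]) him.2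
    have h2 : (3 * t / 4) ^ 2 ≤ z.re ^ 2 := by
      apply pow_le_pow_left₀ (by positivity); linarith [hre.1]
    nlinarith
  have hb : 0 < t ^ 2 / 8 := by positivity
  refine ⟨hb.trans_le hlow, ?_⟩
  have hL := norm_laplace_le hM0 (subordination_weight hM) hb hlow
  have hpi := Real.sqrt_pos.2 Real.pi_pos
  unfold dampedSubordinationC
  rw [norm_mul, norm_mul, norm_div, Complex.norm_exp, Complex.norm_real, Real.norm_eq_abs,
    abs_of_pos (by positivity : 0 < 2 * Real.sqrt Real.pi)]
  have he : Real.exp (-(ε * z)).re ≤ 1 := by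
    rw [Real.exp_le_one_iff]; simp; exact mul_nonneg hε (by linarith [hre.1])
  have h8 : Real.sqrt (Real.pi / (t ^ 2 / 8)) = Real.sqrt Real.pi * (Real.sqrt 8 / t) := by
    rw [show Real.pi / (t ^ 2 / 8) = Real.pi * (8 / t ^ 2) by field_simp,
      Real.sqrt_mul Real.pi_pos.le, Real.sqrt_div (by norm_num), Real.sqrt_sq ht.le]
  have h9 : Real.sqrt 8 ≤ 3 := by
    rw [Real.sqrt_le_left (by norm_num)]; norm_num
  calc _ ≤ 1 * ((5 * t / 4) / (2 * Real.sqrt Real.pi) *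
        (M * (Real.sqrt Real.pi * (Real.sqrt 8 / t)))) := by
        rw [← h8]; gcongr
    _ = M * (5 / 8 * Real.sqrt 8) := by field_simp; ring
    _ ≤ M * 2 := by gcongr; linarith
    _ = _ := by ring

theorem dampedSubordination_eq_re (ε : ℝ) {t : ℝ} (ht : 0 < t) :
    dampedSubordination ε τ t = (dampedSubordinationC ε τ t).re := by
  rw [dampedSubordinationC_ofReal ε τ ht, Complex.ofReal_re]

theorem analyticAt_dampedSubordination (ε : ℝ) (hτ : Measurable τ)
    (hM : ∀ v, 0 < v → |τ v| ≤ M) {t : ℝ} (ht : 0 < t) :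
    AnalyticAt ℝ (dampedSubordination ε τ) t := by
  have h := ((differentiableOn_dampedSubordinationC ε hτ hM).analyticAt
    (isOpen_sector.mem_nhds (ofReal_mem_sector ht))).re_ofReal
  refine h.congr ?_
  filter_upwards [Ioi_mem_nhds ht] with s hs
  exact (dampedSubordination_eq_re ε hs).symm

/-- Cauchy's estimate on the disc of radius `t / 4` around `t`: the derivatives of a subordinated
function decay like `t ^ (-j)`, with a constant that does not depend on the damping. -/
theorem abs_iteratedDeriv_dampedSubordination_le {ε : ℝ} (hε : 0 ≤ ε) (hτ : Measurable τ)
    (hM0 : 0 ≤ M) (hM : ∀ v, 0 < v → |τ v| ≤ M) (j : ℕ) {t : ℝ} (ht : 0 < t) :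
    |iteratedDeriv j (dampedSubordination ε τ) t| ≤ j.factorial * (2 * M) / (t / 4) ^ j := by
  have h1 : iteratedDeriv j (dampedSubordination ε τ) t
      = (iteratedDeriv j (dampedSubordinationC ε τ) t).re := by
    rw [← iteratedDeriv_re_ofReal isOpen_sector (differentiableOn_dampedSubordinationC ε hτ hM)
      (fun s hs => ofReal_mem_sector hs) j t ht]
    refine Filter.EventuallyEq.iteratedDeriv_eq j ?_
    filter_upwards [Ioi_mem_nhds ht] with s hs
    exact dampedSubordination_eq_re ε hs
  rw [h1]
  refine (Complex.abs_re_le_norm _).trans ?_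
  refine Complex.norm_iteratedDeriv_le_of_forall_mem_sphere_norm_le j (by positivity) ?_ ?_
  · refine DifferentiableOn.diffContOnCl ?_
    refine (differentiableOn_dampedSubordinationC ε hτ hM).mono fun z hz => ?_
    have hz' := Metric.closure_ball_subset_closedBall hz
    rw [mem_closedBall_iff_norm] at hz'
    exact (norm_dampedSubordinationC_le hε hM0 hM ht hz').1
  · intro z hz
    rw [mem_sphere_iff_norm] at hz
    exact (norm_dampedSubordinationC_le hε hM0 hM ht hz.le).2

end

theorem integrable_subordination_density :
    IntegrableOn (fun u : ℝ => Real.exp (-u) / Real.sqrt u) (Ioi 0) := by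
  refine (integrableOn_rpow_mul_exp_neg (s := -(1 / 2)) (b := 1) (by norm_num) one_pos).congr_fun
    (fun u (hu : 0 < u) => ?_) measurableSet_Ioi
  simp only [one_mul]
  rw [Real.rpow_neg hu.le, ← Real.sqrt_eq_rpow]; field_simp

/-- The primitive of `e^{-s²}` that vanishes at `-∞`. -/
noncomputable def gaussPrimitive (y : ℝ) : ℝ := ∫ s in Iic y, Real.exp (-s ^ 2)

theorem integrable_gauss : Integrable (fun s : ℝ => Real.exp (-s ^ 2)) := by
  simpa using integrable_exp_neg_mul_sq (b := 1) one_pos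

theorem hasDerivAt_gaussPrimitive (y : ℝ) :
    HasDerivAt gaussPrimitive (Real.exp (-y ^ 2)) y := by
  have h : gaussPrimitive = fun y => gaussPrimitive 0 + ∫ s in (0 : ℝ)..y, Real.exp (-s ^ 2) := by
    ext y
    rw [gaussPrimitive, gaussPrimitive,
      ← intervalIntegral.integral_Iic_sub_Iic integrable_gauss.integrableOn
        integrable_gauss.integrableOn]
    ring
  rw [h]
  exact ((by fun_prop : Continuous fun s : ℝ => Real.exp (-s ^ 2)).integral_hasStrictDerivAt
    0 y).hasDerivAt.const_add _

theorem tendsto_gaussPrimitive_atTop :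
    Tendsto gaussPrimitive atTop (nhds (Real.sqrt Real.pi)) := by
  have h := (aecover_Iic (μ := volume)
    (tendsto_id (α := ℝ) (x := atTop))).integral_tendsto_of_countably_generated integrable_gauss
  have h2 : ∫ s : ℝ, Real.exp (-s ^ 2) = Real.sqrt Real.pi := by
    simpa using integral_gaussian 1
  rw [h2] at h
  exact h

theorem tendsto_gaussPrimitive_atBot : Tendsto gaussPrimitive atBot (nhds 0) := by
  have h := tendsto_gaussPrimitive_atTop.comp tendsto_neg_atBot_atTop
  have h2 : gaussPrimitive = fun y => Real.sqrt Real.pi - gaussPrimitive (-y) := by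
    ext y
    have e1 : gaussPrimitive (-y) = ∫ s in Ioi y, Real.exp (-s ^ 2) := by
      rw [gaussPrimitive, ← integral_comp_neg_Ioi]; simp
    have e2 := intervalIntegral.integral_Iic_add_Ioi (b := y) integrable_gauss.integrableOn
      integrable_gauss.integrableOn
    have h2 : ∫ s : ℝ, Real.exp (-s ^ 2) = Real.sqrt Real.pi := by
      simpa using integral_gaussian 1
    rw [h2] at e2
    rw [e1, ← e2, gaussPrimitive]; ring
  rw [h2]
  simpa using h.const_sub (Real.sqrt Real.pi)

/-- Glasser's integral, from the explicit antiderivative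
`e^{-2c} E(√u - c/√u) + e^{2c} E(√u + c/√u)`, where `E` is a primitive of `e^{-s²}`. -/
theorem integral_subordination_exp_of_pos {c : ℝ} (hc : 0 < c) :
    ∫ u in Ioi (0 : ℝ), Real.exp (-u) / Real.sqrt u * Real.exp (-(c ^ 2 / u))
      = Real.sqrt Real.pi * Real.exp (-(2 * c)) := by
  set A : ℝ → ℝ := fun u => Real.exp (-(2 * c)) * gaussPrimitive (Real.sqrt u - c / Real.sqrt u) +
    Real.exp (2 * c) * gaussPrimitive (Real.sqrt u + c / Real.sqrt u) with hA
  have hsq0 : Tendsto Real.sqrt (nhdsWithin 0 (Ioi 0)) (nhdsWithin 0 (Ioi 0)) := by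
    refine tendsto_nhdsWithin_iff.2 ⟨?_, ?_⟩
    · have := Real.continuous_sqrt.tendsto 0
      rw [Real.sqrt_zero] at this
      exact this.mono_left nhdsWithin_le_nhds
    · filter_upwards [self_mem_nhdsWithin] with u hu using Real.sqrt_pos.2 hu
  have hdiv : Tendsto (fun u : ℝ => c / Real.sqrt u) (nhdsWithin 0 (Ioi 0)) atTop := by
    simp_rw [div_eq_mul_inv]
    exact (tendsto_inv_nhdsGT_zero.comp hsq0).const_mul_atTop hc
  have hsq0' : Tendsto Real.sqrt (nhdsWithin 0 (Ioi 0)) (nhds 0) :=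
    hsq0.mono_right nhdsWithin_le_nhds
  have hlim0 : Tendsto A (nhdsWithin 0 (Ioi 0))
      (nhds (Real.exp (2 * c) * Real.sqrt Real.pi)) := by
    have h1 : Tendsto (fun u : ℝ => Real.sqrt u - c / Real.sqrt u) (nhdsWithin 0 (Ioi 0))
        atBot := by
      simp_rw [sub_eq_add_neg]
      exact hsq0'.add_atBot (tendsto_neg_atTop_atBot.comp hdiv)
    have h2 : Tendsto (fun u : ℝ => Real.sqrt u + c / Real.sqrt u) (nhdsWithin 0 (Ioi 0)) atTop :=
      hsq0'.add_atTop hdiv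
    have := ((tendsto_gaussPrimitive_atBot.comp h1).const_mul (Real.exp (-(2 * c)))).add
      ((tendsto_gaussPrimitive_atTop.comp h2).const_mul (Real.exp (2 * c)))
    simpa using this
  have hlimT : Tendsto A atTop
      (nhds ((Real.exp (-(2 * c)) + Real.exp (2 * c)) * Real.sqrt Real.pi)) := by
    have hd : Tendsto (fun u : ℝ => c / Real.sqrt u) atTop (nhds 0) :=
      Real.tendsto_sqrt_atTop.const_div_atTop c
    have h1 : Tendsto (fun u : ℝ => Real.sqrt u - c / Real.sqrt u) atTop atTop := by
      simp_rw [sub_eq_add_neg]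
      exact Real.tendsto_sqrt_atTop.atTop_add hd.neg
    have h2 : Tendsto (fun u : ℝ => Real.sqrt u + c / Real.sqrt u) atTop atTop :=
      Real.tendsto_sqrt_atTop.atTop_add hd
    have := ((tendsto_gaussPrimitive_atTop.comp h1).const_mul (Real.exp (-(2 * c)))).add
      ((tendsto_gaussPrimitive_atTop.comp h2).const_mul (Real.exp (2 * c)))
    rw [add_mul]
    exact this
  have hder : ∀ u ∈ Ioi (0 : ℝ), HasDerivAt A
      (Real.exp (-u) / Real.sqrt u * Real.exp (-(c ^ 2 / u))) u := by
    intro u (hu : 0 < u)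
    have hs := Real.sqrt_pos.2 hu
    have hss := Real.sq_sqrt hu.le
    have d0 := Real.hasDerivAt_sqrt hu.ne'
    have d1 : HasDerivAt (fun u : ℝ => c / Real.sqrt u)
        (-(c * (1 / (2 * Real.sqrt u))) / Real.sqrt u ^ 2) u := by
      simpa using (hasDerivAt_const u c).fun_div d0 hs.ne'
    have d2 := ((hasDerivAt_gaussPrimitive (Real.sqrt u - c / Real.sqrt u)).comp u
      (d0.sub d1)).const_mul (Real.exp (-(2 * c)))
    have d3 := ((hasDerivAt_gaussPrimitive (Real.sqrt u + c / Real.sqrt u)).comp u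
      (d0.add d1)).const_mul (Real.exp (2 * c))
    refine (d2.add d3).congr_deriv ?_
    have e1 : Real.exp (-(2 * c)) * Real.exp (-(Real.sqrt u - c / Real.sqrt u) ^ 2)
        = Real.exp (-u) * Real.exp (-(c ^ 2 / u)) := by
      rw [← Real.exp_add, ← Real.exp_add]; congr 1
      rw [sub_sq, div_pow, hss]; field_simp; ring
    have e2 : Real.exp (2 * c) * Real.exp (-(Real.sqrt u + c / Real.sqrt u) ^ 2)
        = Real.exp (-u) * Real.exp (-(c ^ 2 / u)) := by
      rw [← Real.exp_add, ← Real.exp_add]; congr 1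
      rw [add_sq, div_pow, hss]; field_simp; ring
    rw [← mul_assoc, ← mul_assoc, e1, e2]
    field_simp
    ring
  have hint : IntegrableOn (fun u : ℝ => Real.exp (-u) / Real.sqrt u * Real.exp (-(c ^ 2 / u)))
      (Ioi 0) := by
    refine Integrable.mono' integrable_subordination_density
      (Measurable.aestronglyMeasurable (by fun_prop)) ?_
    filter_upwards [ae_restrict_mem measurableSet_Ioi] with u (hu : 0 < u)
    rw [Real.norm_eq_abs, abs_of_nonneg (by positivity)]
    refine mul_le_of_le_one_right (by positivity) (Real.exp_le_one_iff.2 ?_)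
    have : 0 ≤ c ^ 2 / u := by positivity
    linarith
  -- the antiderivative has to be given its limit as value at `0`, where `c / √u` is a junk value
  have hT : Tendsto (Function.update A 0 (Real.exp (2 * c) * Real.sqrt Real.pi)) atTop
      (nhds ((Real.exp (-(2 * c)) + Real.exp (2 * c)) * Real.sqrt Real.pi)) := by
    refine hlimT.congr' ?_
    filter_upwards [Ioi_mem_atTop (0 : ℝ)] with u hu
    rw [Function.update_of_ne (ne_of_gt hu)]
  rw [integral_Ioi_of_hasDerivAt_of_tendsto (a := 0)
    (f := Function.update A 0 (Real.exp (2 * c) * Real.sqrt Real.pi)) ?_ ?_ hint hT]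
  · rw [Function.update_self]; ring
  · rw [continuousWithinAt_update_same]
    refine hlim0.mono_left (nhdsWithin_mono _ fun u hu => ?_)
    exact lt_of_le_of_ne hu.1 (Ne.symm hu.2)
  · intro u hu
    refine (hder u hu).congr_of_eventuallyEq ?_
    filter_upwards [Ioi_mem_nhds (show (0 : ℝ) < u from hu)] with v hv
    rw [Function.update_of_ne (ne_of_gt hv)]

/-- Subordination turns `e^{-nv}` into `e^{-t√n}`. -/
theorem integral_subordination_exp {b : ℝ} (hb : 0 ≤ b) {t : ℝ} (ht : 0 < t) :
    1 / Real.sqrt Real.pi * ∫ u in Ioi (0 : ℝ),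
      Real.exp (-u) / Real.sqrt u * Real.exp (-(t ^ 2 / (4 * u) * b))
      = Real.exp (-(t * Real.sqrt b)) := by
  have hpi := Real.sqrt_pos.2 Real.pi_pos
  rcases hb.eq_or_lt with rfl | hb
  · have h1 : ∫ u in Ioi (0 : ℝ), Real.exp (-u) / Real.sqrt u = Real.sqrt Real.pi := by
      rw [← Real.Gamma_one_half_eq, Real.Gamma_eq_integral (by norm_num)]
      refine setIntegral_congr_fun measurableSet_Ioi fun u (hu : 0 < u) => ?_
      rw [show (1 / 2 - 1 : ℝ) = -(1 / 2) by norm_num]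
      rw [Real.rpow_neg hu.le, ← Real.sqrt_eq_rpow]
      field_simp
    simp [h1, hpi.ne']
  · have hc : 0 < t * Real.sqrt b / 2 := by have := Real.sqrt_pos.2 hb; positivity
    have h := integral_subordination_exp_of_pos hc
    have h2 : ∫ u in Ioi (0 : ℝ), Real.exp (-u) / Real.sqrt u * Real.exp (-(t ^ 2 / (4 * u) * b))
        = Real.sqrt Real.pi * Real.exp (-(t * Real.sqrt b)) := by
      rw [show t * Real.sqrt b = 2 * (t * Real.sqrt b / 2) by ring, ← h]
      refine setIntegral_congr_fun measurableSet_Ioi fun u (hu : 0 < u) => ?_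
      congr 3
      rw [div_pow, mul_pow, Real.sq_sqrt hb.le]
      field_simp
      norm_num
    rw [h2]; field_simp

/-! ### Laguerre polynomials and the heat kernel in one variable -/

/-- The rising factorial `b (b + 1) ⋯ (b + n - 1)`. -/
def risingFactorial (b : ℝ) (n : ℕ) : ℝ := ∏ i ∈ Finset.range n, (b + i)

theorem risingFactorial_zero (b : ℝ) : risingFactorial b 0 = 1 := by simp [risingFactorial]

theorem risingFactorial_succ_left (b : ℝ) (n : ℕ) :
    risingFactorial b (n + 1) = b * risingFactorial (b + 1) n := by
  rw [risingFactorial, Finset.prod_range_succ', mul_comm, risingFactorial]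
  congr 1
  · simp
  · refine Finset.prod_congr rfl fun i _ => ?_
    push_cast; ring

theorem risingFactorial_add (b : ℝ) (m n : ℕ) :
    risingFactorial b (m + n) = risingFactorial b m * risingFactorial (b + m) n := by
  rw [risingFactorial, Finset.prod_range_add, risingFactorial, risingFactorial]
  congr 1
  refine Finset.prod_congr rfl fun i _ => ?_
  push_cast; ring

theorem risingFactorial_pos {b : ℝ} (hb : 0 < b) (n : ℕ) : 0 < risingFactorial b n :=
  Finset.prod_pos fun i _ => by positivity

theorem Gamma_add_nat {b : ℝ} (hb : 0 < b) (n : ℕ) :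
    Real.Gamma (b + n) = risingFactorial b n * Real.Gamma b := by
  induction n with
  | zero => simp [risingFactorial]
  | succ n ih =>
    have h : b + (n + 1 : ℕ) = (b + n) + 1 := by push_cast; ring
    rw [h, Real.Gamma_add_one (by positivity), ih, risingFactorial, risingFactorial,
      Finset.prod_range_succ]
    ring

/-- A Vandermonde identity: rising factorials of `m + b` in terms of falling factorials of `m`. -/
theorem risingFactorial_natCast_add (m n : ℕ) : ∀ b : ℝ,
    risingFactorial (m + b) n = ∑ j ∈ Finset.range (n + 1),
      (n.choose j : ℝ) * (m.descFactorial j : ℝ) * risingFactorial (b + j) (n - j) := by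
  induction n with
  | zero => intro b; simp [risingFactorial]
  | succ n ih =>
    intro b
    rw [risingFactorial_succ_left, add_assoc, ih (b + 1), Finset.mul_sum]
    have hsplit : ∀ j ∈ Finset.range (n + 1),
        (m + b) * ((n.choose j : ℝ) * (m.descFactorial j : ℝ) * risingFactorial (b + 1 + j) (n - j))
        = (n.choose j : ℝ) * (m.descFactorial (j + 1) : ℝ) *
            risingFactorial (b + (j + 1 : ℕ)) (n + 1 - (j + 1)) +
          (n.choose j : ℝ) * (m.descFactorial j : ℝ) * risingFactorial (b + j) (n + 1 - j) := by
      intro j hj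
      have hj' : j ≤ n := Nat.lt_succ_iff.1 (Finset.mem_range.1 hj)
      have e1 : n + 1 - j = (n - j) + 1 := by omega
      have e2 : n + 1 - (j + 1) = n - j := by omega
      rw [e1, e2, risingFactorial_succ_left]
      have e3 : ((m.descFactorial (j + 1) : ℕ) : ℝ) = ((m : ℝ) - j) * m.descFactorial j := by
        rw [Nat.descFactorial_succ]
        rcases le_or_gt j m with h | h
        · push_cast [Nat.cast_sub h]; ring
        · rw [Nat.descFactorial_eq_zero_iff_lt.2 h]; simp
      rw [e3]
      have e4 : b + 1 + (j : ℝ) = b + (j + 1 : ℕ) := by push_cast; ring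
      have e5 : b + (j : ℝ) + 1 = b + (j + 1 : ℕ) := by push_cast; ring
      rw [e4, e5]
      ring
    rw [Finset.sum_congr rfl hsplit, Finset.sum_add_distrib]
    rw [Finset.sum_range_succ' _ (n + 1)]
    rw [Finset.sum_range_succ' (fun j => (n.choose j : ℝ) * (m.descFactorial j : ℝ) *
      risingFactorial (b + j) (n + 1 - j)) n]
    have e6 : ∑ j ∈ Finset.range (n + 1), ((n + 1).choose (j + 1) : ℝ) *
          (m.descFactorial (j + 1) : ℝ) * risingFactorial (b + (j + 1 : ℕ)) (n + 1 - (j + 1))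
        = ∑ j ∈ Finset.range (n + 1), (n.choose j : ℝ) *
          (m.descFactorial (j + 1) : ℝ) * risingFactorial (b + (j + 1 : ℕ)) (n + 1 - (j + 1)) +
        ∑ j ∈ Finset.range (n + 1), (n.choose (j + 1) : ℝ) *
          (m.descFactorial (j + 1) : ℝ) * risingFactorial (b + (j + 1 : ℕ)) (n + 1 - (j + 1)) := by
      rw [← Finset.sum_add_distrib]
      refine Finset.sum_congr rfl fun j _ => ?_
      rw [Nat.choose_succ_succ]; push_cast; ring
    rw [e6, Finset.sum_range_succ (fun j => (n.choose (j + 1) : ℝ) *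
          (m.descFactorial (j + 1) : ℝ) * risingFactorial (b + (j + 1 : ℕ)) (n + 1 - (j + 1))) n]
    simp
    ring

/-- The factorial moments of the Poisson distribution, before normalization. -/
theorem hasSum_pow_div_factorial_mul_descFactorial (z : ℝ) (j : ℕ) :
    HasSum (fun m : ℕ => z ^ m / (m.factorial : ℝ) * (m.descFactorial j : ℝ))
      (z ^ j * Real.exp z) := by
  rw [← hasSum_nat_add_iff' j]
  have h0 : ∑ i ∈ Finset.range j, z ^ i / (i.factorial : ℝ) * (i.descFactorial j : ℝ) = 0 := by
    refine Finset.sum_eq_zero fun i hi => ?_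
    rw [Nat.descFactorial_eq_zero_iff_lt.2 (Finset.mem_range.1 hi)]; simp
  rw [h0, sub_zero]
  have h := (NormedSpace.expSeries_div_hasSum_exp (𝔸 := ℝ) z).mul_left (z ^ j)
  rw [← Real.exp_eq_exp_ℝ] at h
  refine h.congr_fun fun m => ?_
  have h1 : ((m.factorial : ℕ) : ℝ) * ((m + j).descFactorial j : ℝ) = ((m + j).factorial : ℝ) := by
    have := Nat.factorial_mul_descFactorial (n := m + j) (k := j) (by omega)
    rw [Nat.add_sub_cancel] at this
    exact_mod_cast this
  have h2 : (m.factorial : ℝ) ≠ 0 := by positivity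
  have h3 : ((m + j).factorial : ℝ) ≠ 0 := by positivity
  rw [← h1] at h3 ⊢
  have h4 : (((m + j).descFactorial j : ℕ) : ℝ) ≠ 0 := right_ne_zero_of_mul h3
  field_simp
  ring

/-- The explicit Laguerre polynomial; it agrees with the Rodrigues formula on the half-line. -/
noncomputable def laguerreSum (a : ℝ) (k : ℕ) (x : ℝ) : ℝ :=
  ∑ n ∈ Finset.range (k + 1),
    (-1) ^ n * risingFactorial (a + 1 + n) (k - n) / ((k - n).factorial * n.factorial) * x ^ n

theorem descPochhammer_eval_eq_risingFactorial (p : ℝ) (n : ℕ) :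
    (descPochhammer ℝ n).eval p = risingFactorial (p - n + 1) n := by
  rw [descPochhammer_eval_eq_prod_range, risingFactorial, ← Finset.prod_range_reflect]
  refine Finset.prod_congr rfl fun i hi => ?_
  have hi' := Finset.mem_range.1 hi
  rw [Nat.sub_sub, Nat.cast_sub (by omega)]
  push_cast; ring

theorem iteratedDeriv_exp_neg (n : ℕ) (x : ℝ) :
    iteratedDeriv n (fun y : ℝ => Real.exp (-y)) x = (-1) ^ n * Real.exp (-x) := by
  have := iteratedDeriv_comp_neg n Real.exp x
  rw [this, iteratedDeriv_eq_iterate, Real.iter_deriv_exp]; simp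

theorem laguerrePoly1_eq_laguerreSum (a : ℝ) (k : ℕ) {x : ℝ} (hx : 0 < x) :
    laguerrePoly1 a k x = laguerreSum a k x := by
  rw [laguerrePoly1, iteratedDeriv_fun_mul (by fun_prop)
    (contDiffAt_fun_id.rpow_const_of_ne hx.ne'), laguerreSum, Finset.mul_sum]
  refine Finset.sum_congr rfl fun n hn => ?_
  have hn' : n ≤ k := Nat.lt_succ_iff.1 (Finset.mem_range.1 hn)
  rw [iteratedDeriv_exp_neg, iteratedDeriv_eq_iterate]
  -- Leibniz' rule; `e^x x^{-a}` cancels against the exponential and the non-integral power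
  have h1 := Real.iter_deriv_rpow_const (k + a) x (k - n)
  rw [h1, descPochhammer_eval_eq_risingFactorial, Nat.cast_sub hn']
  have e1 : (k : ℝ) + a - (k - n) + 1 = a + 1 + n := by ring
  have e2 : (k : ℝ) + a - (k - n) = a + n := by ring
  have e3 : x ^ (-a) * x ^ (a + n) = x ^ n := by
    rw [← Real.rpow_add hx, ← Real.rpow_natCast]; congr 1; ring
  have e4 : Real.exp x * Real.exp (-x) = 1 := by rw [← Real.exp_add]; simp
  rw [e1, e2, Nat.cast_choose ℝ hn', ← e3]
  have h3 : (k.factorial : ℝ) ≠ 0 := by positivity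
  calc _ = ((k.factorial : ℝ)⁻¹ * k.factorial) * (Real.exp x * Real.exp (-x)) * ((-1) ^ n *
        risingFactorial (a + 1 + n) (k - n) / ((k - n).factorial * n.factorial) *
          (x ^ (-a) * x ^ (a + n))) := by
        field_simp
    _ = _ := by rw [e4, inv_mul_cancel₀ h3]; ring

theorem measurable_laguerreSum (a : ℝ) (k : ℕ) : Measurable (laguerreSum a k) := by
  unfold laguerreSum; fun_prop

/-- Integration against the one-dimensional Laguerre measure, as an integral on the half-line. -/
theorem lintegral_gammaMeasure {a : ℝ} {f : ℝ → ENNReal} (hf : Measurable f) :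
    ∫⁻ y, f y ∂(ProbabilityTheory.gammaMeasure (a + 1) 1)
      = ∫⁻ y in Ioi (0 : ℝ),
          ENNReal.ofReal (y ^ a * Real.exp (-y) / Real.Gamma (a + 1)) * f y := by
  have hm : Measurable (ProbabilityTheory.gammaPDF (a + 1) 1) :=
    (ProbabilityTheory.measurable_gammaPDFReal _ _).ennreal_ofReal
  rw [ProbabilityTheory.gammaMeasure, lintegral_withDensity_eq_lintegral_mul _ hm hf,
    ← lintegral_indicator measurableSet_Ioi]
  refine lintegral_congr_ae ?_
  have h0 : ∀ᵐ y : ℝ, y ≠ 0 := by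
    rw [ae_iff]; simp
  filter_upwards [h0] with y hy
  rcases lt_or_gt_of_ne hy with h | h
  · rw [indicator_of_notMem (by simp [h.le]), Pi.mul_apply,
      ProbabilityTheory.gammaPDF_of_neg h, zero_mul]
  · rw [indicator_of_mem (by exact h), Pi.mul_apply,
      ProbabilityTheory.gammaPDF_of_nonneg h.le]
    congr 2
    simp
    ring

theorem ae_pos_gammaMeasure (a : ℝ) :
    ∀ᵐ y ∂(ProbabilityTheory.gammaMeasure (a + 1) 1), 0 < y := by
  have hs : MeasurableSet {y : ℝ | ¬ 0 < y} := (measurableSet_Ioi (a := (0 : ℝ))).compl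
  rw [ae_iff, ← lintegral_indicator_one hs,
    lintegral_gammaMeasure (measurable_one.indicator hs)]
  rw [setLIntegral_congr_fun (g := fun _ => 0) measurableSet_Ioi, lintegral_zero]
  intro y hy
  simp only [mem_Ioi] at hy
  simp [hy]

theorem integrable_exp_gammaMeasure {a c : ℝ} (ha : -1 < a) (hc : c < 1) :
    Integrable (fun y => Real.exp (c * y)) (ProbabilityTheory.gammaMeasure (a + 1) 1) := by
  refine ⟨by fun_prop, ?_⟩
  rw [hasFiniteIntegral_iff_enorm, lintegral_gammaMeasure (by fun_prop)]
  have hint := integrableOn_rpow_mul_exp_neg (s := a) (b := 1 - c) ha (by linarith)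
  have hG := Real.Gamma_pos_of_pos (s := a + 1) (by linarith)
  have h2 := (hint.div_const (Real.Gamma (a + 1))).2
  rw [hasFiniteIntegral_iff_enorm] at h2
  refine lt_of_eq_of_lt (setLIntegral_congr_fun measurableSet_Ioi fun y (hy : 0 < y) => ?_) h2
  rw [Real.enorm_of_nonneg (by positivity), Real.enorm_of_nonneg (by positivity),
    ← ENNReal.ofReal_mul (by positivity)]
  congr 1
  have : Real.exp (-((1 - c) * y)) = Real.exp (-y) * Real.exp (c * y) := by
    rw [← Real.exp_add]; congr 1; ring
  rw [this]; ring

theorem memLp_pow_gammaMeasure {a : ℝ} (ha : -1 < a) (n : ℕ) :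
    MemLp (fun y : ℝ => y ^ n) 2 (ProbabilityTheory.gammaMeasure (a + 1) 1) := by
  rw [memLp_two_iff_integrable_sq (by fun_prop)]
  refine Integrable.mono' ((integrable_exp_gammaMeasure ha (c := 1 / 2) (by norm_num)).const_mul
    ((4 ^ n * n.factorial : ℝ) ^ 2)) (by fun_prop) ?_
  filter_upwards [ae_pos_gammaMeasure a] with y hy
  have h1 := Real.pow_div_factorial_le_exp (y / 4) (by positivity) n
  have h2 : y ^ n ≤ 4 ^ n * n.factorial * Real.exp (y / 4) := by
    rw [div_pow, div_div, div_le_iff₀ (by positivity)] at h1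
    linarith
  rw [Real.norm_of_nonneg (by positivity)]
  calc (y ^ n) ^ 2 ≤ (4 ^ n * n.factorial * Real.exp (y / 4)) ^ 2 := by gcongr
    _ = (4 ^ n * n.factorial : ℝ) ^ 2 * (Real.exp (y / 4) * Real.exp (y / 4)) := by ring
    _ = _ := by rw [← Real.exp_add]; ring_nf

theorem memLp_laguerreSum {a : ℝ} (ha : -1 < a) (k : ℕ) :
    MemLp (laguerreSum a k) 2 (ProbabilityTheory.gammaMeasure (a + 1) 1) := by
  unfold laguerreSum
  exact memLp_finsetSum _ fun n _ => (memLp_pow_gammaMeasure ha n).const_mul _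

/-- A term of the power series in `xy` of the one-dimensional Laguerre heat kernel. -/
noncomputable def heatTerm (a t x y : ℝ) (m : ℕ) : ℝ :=
  Real.Gamma (a + 1) * (1 - Real.exp (-t)) ^ (-(a + 1)) *
    Real.exp (-(Real.exp (-t) / (1 - Real.exp (-t))) * (x + y)) *
    (Real.exp (-t) * x * y / (1 - Real.exp (-t)) ^ 2) ^ m /
      ((m.factorial : ℝ) * Real.Gamma ((m : ℝ) + a + 1))

/-- The one-dimensional Laguerre heat kernel as a sum of nonnegative terms. In this form its
measurability in all variables is immediate. -/
noncomputable def heatKernelE (a t x y : ℝ) : ENNReal :=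
  ∑' m : ℕ, ENNReal.ofReal (heatTerm a t x y m)

theorem measurable_heatKernelE {S : Type*} [MeasurableSpace S] (a : ℝ) {t x y : S → ℝ}
    (ht : Measurable t) (hx : Measurable x) (hy : Measurable y) :
    Measurable (fun s => heatKernelE a (t s) (x s) (y s)) := by
  unfold heatKernelE heatTerm
  refine Measurable.tsum fun m => ?_
  fun_prop

theorem one_sub_exp_neg_pos {t : ℝ} (ht : 0 < t) : 0 < 1 - Real.exp (-t) := by
  have : Real.exp (-t) < 1 := by rw [Real.exp_lt_one_iff]; linarith
  linarith

theorem heatTerm_nonneg {a t x y : ℝ} (ha : -1 < a) (ht : 0 < t) (hx : 0 < x) (hy : 0 < y)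
    (m : ℕ) : 0 ≤ heatTerm a t x y m := by
  have h1 := one_sub_exp_neg_pos ht
  have h2 := Real.Gamma_pos_of_pos (s := a + 1) (by linarith)
  have h3 := Real.Gamma_pos_of_pos (s := (m : ℝ) + a + 1)
    (by have : (0 : ℝ) ≤ m := by positivity
        linarith)
  unfold heatTerm
  positivity

theorem heatKernelE_comm (a t x y : ℝ) : heatKernelE a t x y = heatKernelE a t y x := by
  unfold heatKernelE heatTerm
  congr 1; ext m
  rw [add_comm x y, mul_right_comm (Real.exp (-t)) x y]

/-- One factor of `laguerreHeatKernel` is the real value of `heatKernelE`. -/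
theorem heatKernel_factor_eq {a t x y : ℝ} (ha : -1 < a) (ht : 0 < t) (hx : 0 < x) (hy : 0 < y) :
    Real.Gamma (a + 1) / (1 - Real.exp (-t)) *
      Real.exp (-(Real.exp (-t) / (1 - Real.exp (-t))) * (x + y)) *
      Real.sqrt (Real.exp (-t) * x * y) ^ (-a) *
      besselI a (2 * Real.sqrt (Real.exp (-t) * x * y) / (1 - Real.exp (-t)))
    = (heatKernelE a t x y).toReal := by
  have h1 := one_sub_exp_neg_pos ht
  rw [heatKernelE, ENNReal.tsum_toReal_eq (fun _ => ENNReal.ofReal_ne_top), besselI,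
    ← tsum_mul_left]
  congr 1; ext m
  rw [ENNReal.toReal_ofReal (heatTerm_nonneg ha ht hx hy m), heatTerm]
  have hp : 0 < Real.exp (-t) * x * y := by positivity
  set p := Real.exp (-t) * x * y
  set q := 1 - Real.exp (-t)
  have hs := Real.sqrt_pos.2 hp
  have e1 : 2 * Real.sqrt p / q / 2 = Real.sqrt p / q := by ring
  have e2 : (Real.sqrt p / q) ^ (2 * (m : ℝ) + a)
      = (p / q ^ 2) ^ m * (Real.sqrt p ^ a * q ^ (-a)) := by
    rw [Real.rpow_add (by positivity), Real.div_rpow hs.le h1.le a, Real.rpow_neg h1.le,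
      ← div_eq_mul_inv]
    congr 1
    rw [show 2 * (m : ℝ) = ((2 * m : ℕ) : ℝ) by push_cast; ring, Real.rpow_natCast, pow_mul,
      div_pow, Real.sq_sqrt hp.le]
  have e3 : Real.sqrt p ^ (-a) * Real.sqrt p ^ a = 1 := by
    rw [← Real.rpow_add hs]; simp
  have e4 : q ^ (-(a + 1)) = q⁻¹ * q ^ (-a) := by
    rw [neg_add, add_comm, Real.rpow_add h1, Real.rpow_neg_one]
  rw [e1, e2, e4]
  calc _ = (Real.sqrt p ^ (-a) * Real.sqrt p ^ a) * (Real.Gamma (a + 1) * (q⁻¹ * q ^ (-a)) *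
        Real.exp (-(Real.exp (-t) / q) * (x + y)) * (p / q ^ 2) ^ m /
          ((m.factorial : ℝ) * Real.Gamma ((m : ℝ) + a + 1))) := by ring
    _ = _ := by rw [e3, one_mul]

/-- As a function of `y`, the kernel times the gamma density is a Poisson mixture of gamma densities
of scale `1 - e^{-t}`, with Poisson parameter `e^{-t} x / (1 - e^{-t})`; this is the `n`-th moment
of one term. -/
theorem lintegral_heatTerm_mul_pow {a t x : ℝ} (ha : -1 < a) (ht : 0 < t) (hx : 0 < x)
    (m n : ℕ) :
    ∫⁻ y, ENNReal.ofReal (heatTerm a t x y m) * ENNReal.ofReal (y ^ n)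
        ∂(ProbabilityTheory.gammaMeasure (a + 1) 1)
      = ENNReal.ofReal ((1 - Real.exp (-t)) ^ n *
          Real.exp (-(Real.exp (-t) * x / (1 - Real.exp (-t)))) *
          ((Real.exp (-t) * x / (1 - Real.exp (-t))) ^ m / (m.factorial : ℝ) *
            risingFactorial (m + (a + 1)) n)) := by
  have h1 := one_sub_exp_neg_pos ht
  have hm0 : (0 : ℝ) ≤ m := by positivity
  have hG := Real.Gamma_pos_of_pos (s := a + 1) (by linarith)
  have hGm := Real.Gamma_pos_of_pos (s := (m : ℝ) + a + 1) (by linarith)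
  rw [lintegral_gammaMeasure (by unfold heatTerm; fun_prop)]
  have hs : 0 < (m : ℝ) + a + 1 + n := by
    have : (0 : ℝ) ≤ n := by positivity
    linarith
  have hr : 0 < 1 / (1 - Real.exp (-t)) := by positivity
  have hI := Real.integral_rpow_mul_exp_neg_mul_Ioi hs hr
  have hint := integrableOn_rpow_mul_exp_neg (s := (m : ℝ) + a + 1 + n - 1) (by linarith) hr
  set q := 1 - Real.exp (-t) with hq
  set C : ℝ := q ^ (-(a + 1)) * (Real.exp (-t) * x / q ^ 2) ^ m *
    Real.exp (-(Real.exp (-t) * x / q)) / ((m.factorial : ℝ) * Real.Gamma ((m : ℝ) + a + 1))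
    with hC
  have hC0 : 0 ≤ C := by positivity
  have hcong : ∀ y ∈ Ioi (0 : ℝ),
      ENNReal.ofReal (y ^ a * Real.exp (-y) / Real.Gamma (a + 1)) *
        (ENNReal.ofReal (heatTerm a t x y m) * ENNReal.ofReal (y ^ n))
      = ENNReal.ofReal (C * (y ^ ((m : ℝ) + a + 1 + n - 1) * Real.exp (-(1 / q * y)))) := by
    intro y (hy : 0 < y)
    rw [← ENNReal.ofReal_mul (heatTerm_nonneg ha ht hx hy m),
      ← ENNReal.ofReal_mul (by positivity)]
    congr 1
    have e1 : y ^ ((m : ℝ) + a + 1 + n - 1) = y ^ a * y ^ m * y ^ n := by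
      rw [show (m : ℝ) + a + 1 + n - 1 = a + m + n by ring, Real.rpow_add hy, Real.rpow_add hy,
        Real.rpow_natCast, Real.rpow_natCast]
    have e2 : Real.exp (-(1 / q * y)) * Real.exp (-(Real.exp (-t) * x / q))
        = Real.exp (-y) * Real.exp (-(Real.exp (-t) / q) * (x + y)) := by
      rw [← Real.exp_add, ← Real.exp_add]
      congr 1
      field_simp
      rw [hq]; ring
    rw [e1, heatTerm, ← hq, hC]
    have e3 : (Real.exp (-t) * x * y / q ^ 2) ^ m = (Real.exp (-t) * x / q ^ 2) ^ m * y ^ m := by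
      rw [← mul_pow]; congr 1; ring
    rw [e3]
    calc _ = q ^ (-(a + 1)) * (Real.exp (-t) * x / q ^ 2) ^ m /
            ((m.factorial : ℝ) * Real.Gamma ((m : ℝ) + a + 1)) * (y ^ a * y ^ m * y ^ n) *
          (Real.exp (-y) * Real.exp (-(Real.exp (-t) / q) * (x + y))) := by
          field_simp
      _ = _ := by rw [← e2]; ring
  rw [setLIntegral_congr_fun measurableSet_Ioi hcong,
    ← ofReal_integral_eq_lintegral_ofReal (hint.const_mul C), integral_const_mul, hI]
  · congr 1
    rw [add_assoc (m : ℝ) a 1] at hGm ⊢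
    rw [Gamma_add_nat (by linarith), hC, add_assoc (m : ℝ) a 1, one_div_one_div]
    have e1 : q ^ ((m : ℝ) + (a + 1) + n) = q ^ m * q ^ (a + 1) * q ^ n := by
      rw [Real.rpow_add h1, Real.rpow_add h1, Real.rpow_natCast, Real.rpow_natCast]
    have e2 : q ^ (-(a + 1)) = (q ^ (a + 1))⁻¹ := Real.rpow_neg h1.le _
    have e3 : (Real.exp (-t) * x / q ^ 2) ^ m = (Real.exp (-t) * x / q) ^ m * (q ^ m)⁻¹ := by
      rw [← inv_pow, ← mul_pow]; congr 1; field_simp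
    rw [e1, e2, e3]
    have h4 : q ^ (a + 1) ≠ 0 := (Real.rpow_pos_of_pos h1 _).ne'
    field_simp
  · filter_upwards [ae_restrict_mem measurableSet_Ioi] with y (hy : 0 < y)
    simp only [Pi.zero_apply]
    positivity

/-- The polynomial in `x` that `lintegral_heatKernelE_mul_pow` identifies with
`∫ G_t(x,y) y^n dμ(y)`. -/
noncomputable def heatMoment (a t : ℝ) (n : ℕ) (x : ℝ) : ℝ :=
  ∑ j ∈ Finset.range (n + 1), (n.choose j : ℝ) * (1 - Real.exp (-t)) ^ (n - j) *
    risingFactorial (a + 1 + j) (n - j) * (Real.exp (-t) * x) ^ j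

/-- Summed over `m`, `risingFactorial_natCast_add` leaves factorial moments of a Poisson law. -/
theorem lintegral_heatKernelE_mul_pow {a t x : ℝ} (ha : -1 < a) (ht : 0 < t) (hx : 0 < x)
    (n : ℕ) :
    ∫⁻ y, heatKernelE a t x y * ENNReal.ofReal (y ^ n)
        ∂(ProbabilityTheory.gammaMeasure (a + 1) 1) = ENNReal.ofReal (heatMoment a t n x) := by
  have h1 := one_sub_exp_neg_pos ht
  simp_rw [heatKernelE, ← ENNReal.tsum_mul_right]
  rw [lintegral_tsum fun m => by unfold heatTerm; fun_prop]
  simp_rw [lintegral_heatTerm_mul_pow ha ht hx]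
  set q := 1 - Real.exp (-t) with hq
  set z := Real.exp (-t) * x / q with hz
  have hz0 : 0 < z := by positivity
  have hsum : HasSum (fun m : ℕ => q ^ n * Real.exp (-z) *
      (z ^ m / (m.factorial : ℝ) * risingFactorial (m + (a + 1)) n)) (heatMoment a t n x) := by
    have h2 : HasSum (fun m : ℕ => ∑ j ∈ Finset.range (n + 1),
        (n.choose j : ℝ) * risingFactorial (a + 1 + j) (n - j) *
          (z ^ m / (m.factorial : ℝ) * (m.descFactorial j : ℝ)))
        (∑ j ∈ Finset.range (n + 1), (n.choose j : ℝ) * risingFactorial (a + 1 + j) (n - j) *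
          (z ^ j * Real.exp z)) :=
      hasSum_sum fun j _ => (hasSum_pow_div_factorial_mul_descFactorial z j).mul_left _
    have h3 := h2.mul_left (q ^ n * Real.exp (-z))
    have e1 : q ^ n * Real.exp (-z) * (∑ j ∈ Finset.range (n + 1), (n.choose j : ℝ) *
        risingFactorial (a + 1 + j) (n - j) * (z ^ j * Real.exp z)) = heatMoment a t n x := by
      rw [heatMoment, Finset.mul_sum]
      refine Finset.sum_congr rfl fun j hj => ?_
      have hj' : j ≤ n := Nat.lt_succ_iff.1 (Finset.mem_range.1 hj)
      have e2 : q ^ n * z ^ j = q ^ (n - j) * (Real.exp (-t) * x) ^ j := by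
        rw [hz, div_pow, ← Nat.sub_add_cancel hj', pow_add, Nat.sub_add_cancel hj']
        field_simp
      have e3 : Real.exp (-z) * Real.exp z = 1 := by rw [← Real.exp_add]; simp
      calc _ = (n.choose j : ℝ) * risingFactorial (a + 1 + j) (n - j) * (q ^ n * z ^ j) *
            (Real.exp (-z) * Real.exp z) := by ring
        _ = _ := by rw [e2, e3, ← hq]; ring
    rw [e1] at h3
    refine h3.congr_fun fun m => ?_
    rw [risingFactorial_natCast_add, Finset.mul_sum]
    congr 1
    refine Finset.sum_congr rfl fun j _ => ?_
    ring
  rw [← ENNReal.ofReal_tsum_of_nonneg _ hsum.summable, hsum.tsum_eq]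
  intro m
  have : (0 : ℝ) ≤ m := by positivity
  have := risingFactorial_pos (b := m + (a + 1)) (by linarith) n
  positivity

theorem ae_heatKernelE_lt_top {a t x : ℝ} (ha : -1 < a) (ht : 0 < t) (hx : 0 < x) :
    ∀ᵐ y ∂(ProbabilityTheory.gammaMeasure (a + 1) 1), heatKernelE a t x y < ⊤ := by
  have h := lintegral_heatKernelE_mul_pow ha ht hx 0
  simp only [pow_zero, ENNReal.ofReal_one, mul_one] at h
  refine ae_lt_top ?_ (by rw [h]; exact ENNReal.ofReal_ne_top)
  exact measurable_heatKernelE a measurable_const measurable_const measurable_id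

/-- The real-valued one-dimensional Laguerre heat kernel (zero where the series diverges). -/
noncomputable def heatKernel1 (a t x y : ℝ) : ℝ := (heatKernelE a t x y).toReal

theorem heatKernel1_nonneg (a t x y : ℝ) : 0 ≤ heatKernel1 a t x y := ENNReal.toReal_nonneg

theorem heatKernel1_comm (a t x y : ℝ) : heatKernel1 a t x y = heatKernel1 a t y x := by
  rw [heatKernel1, heatKernelE_comm, heatKernel1]

theorem measurable_heatKernel1 {S : Type*} [MeasurableSpace S] (a : ℝ) {t x y : S → ℝ}
    (ht : Measurable t) (hx : Measurable x) (hy : Measurable y) :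
    Measurable (fun s => heatKernel1 a (t s) (x s) (y s)) :=
  (measurable_heatKernelE a ht hx hy).ennreal_toReal

theorem heatMoment_nonneg {a t x : ℝ} (ha : -1 < a) (ht : 0 < t) (hx : 0 < x) (n : ℕ) :
    0 ≤ heatMoment a t n x := by
  have h1 := one_sub_exp_neg_pos ht
  refine Finset.sum_nonneg fun j _ => ?_
  have : (0 : ℝ) ≤ j := by positivity
  have := risingFactorial_pos (b := a + 1 + j) (by linarith) (n - j)
  positivity

theorem integrable_heatKernel1_mul_pow {a t x : ℝ} (ha : -1 < a) (ht : 0 < t) (hx : 0 < x)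
    (n : ℕ) :
    Integrable (fun y => heatKernel1 a t x y * y ^ n)
      (ProbabilityTheory.gammaMeasure (a + 1) 1) ∧
    ∫ y, heatKernel1 a t x y * y ^ n ∂(ProbabilityTheory.gammaMeasure (a + 1) 1)
      = heatMoment a t n x := by
  have hm : AEStronglyMeasurable (fun y => heatKernel1 a t x y * y ^ n)
      (ProbabilityTheory.gammaMeasure (a + 1) 1) :=
    ((measurable_heatKernel1 a measurable_const measurable_const measurable_id).mul
      (by fun_prop)).aestronglyMeasurable
  have h0 : ∀ᵐ y ∂(ProbabilityTheory.gammaMeasure (a + 1) 1), 0 ≤ heatKernel1 a t x y * y ^ n := by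
    filter_upwards [ae_pos_gammaMeasure a] with y hy
    exact mul_nonneg (heatKernel1_nonneg _ _ _ _) (by positivity)
  have h : ∫⁻ y, ENNReal.ofReal (heatKernel1 a t x y * y ^ n)
      ∂(ProbabilityTheory.gammaMeasure (a + 1) 1) = ENNReal.ofReal (heatMoment a t n x) := by
    rw [← lintegral_heatKernelE_mul_pow ha ht hx n]
    refine lintegral_congr_ae ?_
    filter_upwards [ae_heatKernelE_lt_top ha ht hx] with y hy
    rw [ENNReal.ofReal_mul (heatKernel1_nonneg _ _ _ _), heatKernel1, ENNReal.ofReal_toReal hy.ne]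
  refine ⟨⟨hm, ?_⟩, ?_⟩
  · rw [hasFiniteIntegral_iff_ofReal h0, h]; exact ENNReal.ofReal_lt_top
  · rw [integral_eq_lintegral_of_nonneg_ae h0 hm, h,
      ENNReal.toReal_ofReal (heatMoment_nonneg ha ht hx n)]

/-- The algebraic form of the eigenvalue relation `T_t L_k = e^{-tk} L_k`. -/
theorem sum_heatMoment_eq (a t x : ℝ) (k : ℕ) :
    ∑ n ∈ Finset.range (k + 1), (-1) ^ n * risingFactorial (a + 1 + n) (k - n) /
        ((k - n).factorial * n.factorial) * heatMoment a t n x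
      = Real.exp (-t) ^ k * laguerreSum a k x := by
  set r := Real.exp (-t)
  have hx : ∀ n ∈ Finset.range (k + 1), heatMoment a t n x
      = ∑ j ∈ Finset.range (k + 1), (n.choose j : ℝ) * (1 - r) ^ (n - j) *
          risingFactorial (a + 1 + j) (n - j) * (r * x) ^ j := by
    intro n hn
    rw [heatMoment]
    refine Finset.sum_subset (Finset.range_subset_range.2 (Finset.mem_range.1 hn)) fun j _ hj => ?_
    rw [Nat.choose_eq_zero_of_lt (by simpa using hj)]; simp
  rw [Finset.sum_congr rfl fun n hn => by rw [hx n hn, Finset.mul_sum], Finset.sum_comm,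
    laguerreSum, Finset.mul_sum]
  refine Finset.sum_congr rfl fun j hj => ?_
  have hj' : j ≤ k := Nat.lt_succ_iff.1 (Finset.mem_range.1 hj)
  obtain ⟨l, rfl⟩ := Nat.exists_eq_add_of_le hj'
  rw [show j + l + 1 = j + (l + 1) by ring, Finset.sum_range_add]
  have hz : ∑ n ∈ Finset.range j, (-1) ^ n * risingFactorial (a + 1 + n) (j + l - n) /
      ((j + l - n).factorial * n.factorial) * ((n.choose j : ℝ) * (1 - r) ^ (n - j) *
          risingFactorial (a + 1 + j) (n - j) * (r * x) ^ j) = 0 :=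
    Finset.sum_eq_zero fun n hn => by
      rw [Nat.choose_eq_zero_of_lt (Finset.mem_range.1 hn)]; simp
  rw [hz, zero_add, Nat.add_sub_cancel_left]
  have hb : r ^ l = ∑ i ∈ Finset.range (l + 1), (l.choose i : ℝ) * (-1) ^ i * (1 - r) ^ i := by
    have := add_pow (-(1 - r)) 1 l
    rw [show -(1 - r) + 1 = r by ring] at this
    rw [this]
    refine Finset.sum_congr rfl fun i _ => ?_
    rw [neg_pow (1 - r)]; ring
  rw [mul_pow, pow_add, hb]
  simp_rw [Finset.mul_sum, Finset.sum_mul]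
  refine Finset.sum_congr rfl fun i hi => ?_
  have hi' : i ≤ l := Nat.lt_succ_iff.1 (Finset.mem_range.1 hi)
  have e1 : j + l - (j + i) = l - i := by omega
  rw [e1, Nat.add_sub_cancel_left, Nat.cast_choose ℝ hi', Nat.cast_add_choose]
  have e2 : risingFactorial (a + 1 + j) l
      = risingFactorial (a + 1 + j) i * risingFactorial (a + 1 + (j + i : ℕ)) (l - i) := by
    conv_lhs => rw [← Nat.add_sub_cancel' hi']
    rw [risingFactorial_add]; push_cast; ring_nf
  rw [e2, pow_add]
  field_simp

theorem integral_heatKernel1_mul_laguerreSum {a t x : ℝ} (ha : -1 < a) (ht : 0 < t) (hx : 0 < x)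
    (k : ℕ) :
    Integrable (fun y => heatKernel1 a t x y * laguerreSum a k y)
      (ProbabilityTheory.gammaMeasure (a + 1) 1) ∧
    ∫ y, heatKernel1 a t x y * laguerreSum a k y ∂(ProbabilityTheory.gammaMeasure (a + 1) 1)
      = Real.exp (-t) ^ k * laguerreSum a k x := by
  have he : ∀ y, heatKernel1 a t x y * laguerreSum a k y = ∑ n ∈ Finset.range (k + 1),
      (-1) ^ n * risingFactorial (a + 1 + n) (k - n) / ((k - n).factorial * n.factorial) *
        (heatKernel1 a t x y * y ^ n) := by
    intro y; rw [laguerreSum, Finset.mul_sum]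
    refine Finset.sum_congr rfl fun n _ => ?_
    ring
  have hi : ∀ n ∈ Finset.range (k + 1), Integrable (fun y => (-1) ^ n *
      risingFactorial (a + 1 + n) (k - n) / ((k - n).factorial * n.factorial) *
        (heatKernel1 a t x y * y ^ n)) (ProbabilityTheory.gammaMeasure (a + 1) 1) :=
    fun n _ => (integrable_heatKernel1_mul_pow ha ht hx n).1.const_mul _
  simp_rw [he]
  refine ⟨integrable_finsetSum _ hi, ?_⟩
  rw [integral_finsetSum _ hi, ← sum_heatMoment_eq]
  refine Finset.sum_congr rfl fun n _ => ?_
  rw [integral_const_mul, (integrable_heatKernel1_mul_pow ha ht hx n).2]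

theorem integral_heatKernel1 {a t x : ℝ} (ha : -1 < a) (ht : 0 < t) (hx : 0 < x) :
    Integrable (heatKernel1 a t x) (ProbabilityTheory.gammaMeasure (a + 1) 1) ∧
    ∫ y, heatKernel1 a t x y ∂(ProbabilityTheory.gammaMeasure (a + 1) 1) = 1 := by
  have h := integrable_heatKernel1_mul_pow ha ht hx 0
  simpa [heatMoment, risingFactorial] using h

/-! ### The heat semigroup in several variables -/

/-- The open positive orthant, which carries the Laguerre measure. -/
def orthant (d : ℕ) : Set (Fin d → ℝ) := {x | ∀ i, 0 < x i}

/-- The `d`-dimensional Laguerre polynomial in explicit form. -/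
noncomputable def laguerreSumPi {d : ℕ} (α : Fin d → ℝ) (k : Fin d → ℕ) (x : Fin d → ℝ) : ℝ :=
  ∏ i, laguerreSum (α i) (k i) (x i)

/-- The `d`-dimensional heat kernel as a product of the measurable one-dimensional kernels. -/
noncomputable def heatKernel {d : ℕ} (α : Fin d → ℝ) (t : ℝ) (x y : Fin d → ℝ) : ℝ :=
  ∏ j, heatKernel1 (α j) t (x j) (y j)

/-- The heat operator `T_t f (x)`, given by the measurable kernel. -/
noncomputable def heatOp {d : ℕ} (α : Fin d → ℝ) (t : ℝ) (f : (Fin d → ℝ) → ℝ)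
    (x : Fin d → ℝ) : ℝ :=
  ∫ y, heatKernel α t x y * f y ∂(laguerreMeasure α)

section

variable {d : ℕ} {α : Fin d → ℝ} [hα : Fact (∀ i, -1 < α i)]

instance isProbabilityMeasure_gamma_factor (i : Fin d) :
    IsProbabilityMeasure (ProbabilityTheory.gammaMeasure (α i + 1) 1) :=
  ProbabilityTheory.isProbabilityMeasure_gammaMeasure (by linarith [hα.out i]) one_pos

instance isProbabilityMeasure_laguerreMeasure : IsProbabilityMeasure (laguerreMeasure α) := by
  unfold laguerreMeasure; infer_instance

theorem ae_mem_orthant : ∀ᵐ x ∂(laguerreMeasure α), x ∈ orthant d := by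
  refine ae_all_iff.2 fun i => ?_
  exact (Measure.tendsto_eval_ae_ae (μ := fun i => ProbabilityTheory.gammaMeasure (α i + 1) 1)
    (i := i)).eventually (ae_pos_gammaMeasure (α i))

omit hα in
theorem laguerrePoly_eq_laguerreSumPi (k : Fin d → ℕ) {x : Fin d → ℝ} (hx : x ∈ orthant d) :
    laguerrePoly α k x = laguerreSumPi α k x :=
  Finset.prod_congr rfl fun i _ => laguerrePoly1_eq_laguerreSum _ _ (hx i)

omit hα in
theorem measurable_laguerreSumPi (k : Fin d → ℕ) : Measurable (laguerreSumPi α k) :=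
  Finset.measurable_fun_prod _ fun i _ =>
    (measurable_laguerreSum (α i) (k i)).comp (measurable_pi_apply i)

theorem memLp_laguerreSumPi (k : Fin d → ℕ) :
    MemLp (laguerreSumPi α k) 2 (laguerreMeasure α) := by
  rw [memLp_two_iff_integrable_sq (measurable_laguerreSumPi k).aestronglyMeasurable]
  simp_rw [laguerreSumPi, ← Finset.prod_pow]
  exact Integrable.fintype_prod (f := fun i y => laguerreSum (α i) (k i) y ^ 2)
    fun i => (memLp_laguerreSum (hα.out i) (k i)).integrable_sq

theorem integrable_laguerreSumPi (k : Fin d → ℕ) :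
    Integrable (laguerreSumPi α k) (laguerreMeasure α) :=
  (memLp_laguerreSumPi k).integrable (by norm_num)

omit hα in
theorem heatKernel_nonneg (t : ℝ) (x y : Fin d → ℝ) : 0 ≤ heatKernel α t x y :=
  Finset.prod_nonneg fun _ _ => heatKernel1_nonneg _ _ _ _

omit hα in
theorem heatKernel_comm (t : ℝ) (x y : Fin d → ℝ) : heatKernel α t x y = heatKernel α t y x :=
  Finset.prod_congr rfl fun _ _ => heatKernel1_comm _ _ _ _

omit hα in
theorem measurable_heatKernel {S : Type*} [MeasurableSpace S] {t : S → ℝ}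
    {x y : S → Fin d → ℝ} (ht : Measurable t) (hx : Measurable x) (hy : Measurable y) :
    Measurable (fun s => heatKernel α (t s) (x s) (y s)) :=
  Finset.measurable_fun_prod _ fun i _ => measurable_heatKernel1 (α i) ht
    ((measurable_pi_apply i).comp hx) ((measurable_pi_apply i).comp hy)

theorem integral_heatKernel {t : ℝ} (ht : 0 < t) {x : Fin d → ℝ} (hx : x ∈ orthant d) :
    Integrable (heatKernel α t x) (laguerreMeasure α) ∧
      ∫ y, heatKernel α t x y ∂(laguerreMeasure α) = 1 := by
  have h := fun i => integral_heatKernel1 (hα.out i) ht (hx i)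
  refine ⟨Integrable.fintype_prod (f := fun i => heatKernel1 (α i) t (x i)) fun i => (h i).1, ?_⟩
  simp only [heatKernel, laguerreMeasure]
  rw [integral_fintype_prod_eq_prod (fun i => heatKernel1 (α i) t (x i))]
  exact Finset.prod_eq_one fun i _ => (h i).2

/-- The eigenvalue relation `T_t L_k = e^{-t|k|} L_k`. -/
theorem integral_heatKernel_mul_laguerreSumPi {t : ℝ} (ht : 0 < t) {x : Fin d → ℝ}
    (hx : x ∈ orthant d) (k : Fin d → ℕ) :
    Integrable (fun y => heatKernel α t x y * laguerreSumPi α k y) (laguerreMeasure α) ∧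
      ∫ y, heatKernel α t x y * laguerreSumPi α k y ∂(laguerreMeasure α)
        = Real.exp (-(t * (∑ i, k i : ℕ))) * laguerreSumPi α k x := by
  have h := fun i => integral_heatKernel1_mul_laguerreSum (hα.out i) ht (hx i) (k i)
  simp_rw [heatKernel, laguerreSumPi, ← Finset.prod_mul_distrib]
  refine ⟨Integrable.fintype_prod
    (f := fun i y => heatKernel1 (α i) t (x i) y * laguerreSum (α i) (k i) y) fun i => (h i).1, ?_⟩
  rw [laguerreMeasure, integral_fintype_prod_eq_prod
    (fun i y => heatKernel1 (α i) t (x i) y * laguerreSum (α i) (k i) y),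
    Finset.prod_congr rfl fun i _ => (h i).2, Finset.prod_mul_distrib, Finset.prod_pow_eq_pow_sum,
    ← Real.exp_nat_mul]
  congr 2
  ring

/-- On the orthant `laguerreHeat` is given by the measurable kernel. -/
theorem laguerreHeat_eq_heatOp {t : ℝ} (ht : 0 < t) (f : (Fin d → ℝ) → ℝ) {x : Fin d → ℝ}
    (hx : x ∈ orthant d) : laguerreHeat α t f x = heatOp α t f x := by
  rw [laguerreHeat, if_pos ht, heatOp]
  refine integral_congr_ae ?_
  filter_upwards [ae_mem_orthant (α := α)] with y hy
  congr 1
  exact Finset.prod_congr rfl fun i _ => heatKernel_factor_eq (hα.out i) ht (hx i) (hy i)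

omit hα in
theorem heatOp_congr {f g : (Fin d → ℝ) → ℝ} (h : f =ᵐ[laguerreMeasure α] g) (t : ℝ)
    (x : Fin d → ℝ) : heatOp α t f x = heatOp α t g x := by
  refine integral_congr_ae ?_
  filter_upwards [h] with y hy
  rw [hy]

theorem measurable_heatOp_param {S T : Type*} [MeasurableSpace S] [MeasurableSpace T]
    {H : S → (Fin d → ℝ) → ℝ} (hH : Measurable (Function.uncurry H)) {s : T → S} {t : T → ℝ}
    {x : T → Fin d → ℝ} (hs : Measurable s) (ht : Measurable t) (hx : Measurable x) :
    Measurable (fun p => heatOp α (t p) (H (s p)) (x p)) := by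
  have h1 : Measurable (fun q : T × (Fin d → ℝ) =>
      heatKernel α (t q.1) (x q.1) q.2 * H (s q.1) q.2) := by
    have a2 : Measurable (fun q : T × (Fin d → ℝ) => (s q.1, q.2)) := by fun_prop
    exact (measurable_heatKernel (by fun_prop) (by fun_prop) (by fun_prop)).mul (hH.comp a2)
  exact (h1.stronglyMeasurable.integral_prod_right' (ν := laguerreMeasure α)).measurable

variable {f : (Fin d → ℝ) → ℝ} {M : ℝ}

theorem integrable_heatKernel_mul (hf : AEStronglyMeasurable f (laguerreMeasure α))
    (hM : ∀ᵐ x ∂(laguerreMeasure α), |f x| ≤ M) {t : ℝ} (ht : 0 < t) {x : Fin d → ℝ}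
    (hx : x ∈ orthant d) :
    Integrable (fun y => heatKernel α t x y * f y) (laguerreMeasure α) :=
  (integral_heatKernel ht hx).1.mul_bdd (c := M) hf hM

theorem abs_heatOp_le (hM : ∀ᵐ x ∂(laguerreMeasure α), |f x| ≤ M) {t : ℝ} (ht : 0 < t)
    {x : Fin d → ℝ} (hx : x ∈ orthant d) : |heatOp α t f x| ≤ M := by
  have h := integral_heatKernel (α := α) ht hx
  have h2 : M = ∫ y, heatKernel α t x y * M ∂(laguerreMeasure α) := by
    rw [integral_mul_const, h.2, one_mul]
  rw [h2, heatOp, ← Real.norm_eq_abs]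
  refine norm_integral_le_of_norm_le (h.1.mul_const M) ?_
  filter_upwards [hM] with y hy
  rw [norm_mul, Real.norm_of_nonneg (heatKernel_nonneg t x y)]
  exact mul_le_mul_of_nonneg_left hy (heatKernel_nonneg t x y)

/-- `T_t` multiplies the Laguerre coefficient of multi-degree `k` by `e^{-t|k|}`: Fubini's theorem
and the symmetry of the kernel move it to the polynomial. -/
theorem integral_heatOp_mul_laguerreSumPi (hf : Measurable f)
    (hM : ∀ᵐ x ∂(laguerreMeasure α), |f x| ≤ M) {t : ℝ} (ht : 0 < t) (k : Fin d → ℕ) :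
    ∫ x, heatOp α t f x * laguerreSumPi α k x ∂(laguerreMeasure α)
      = Real.exp (-(t * (∑ i, k i : ℕ))) *
        ∫ x, f x * laguerreSumPi α k x ∂(laguerreMeasure α) := by
  set μ := laguerreMeasure α
  have hmeas : Measurable (fun p : (Fin d → ℝ) × (Fin d → ℝ) =>
      heatKernel α t p.1 p.2 * f p.2 * laguerreSumPi α k p.1) := by
    exact ((measurable_heatKernel (by fun_prop) (by fun_prop) (by fun_prop)).mul
      (hf.comp measurable_snd)).mul ((measurable_laguerreSumPi k).comp measurable_fst)
  have hint : Integrable (fun p : (Fin d → ℝ) × (Fin d → ℝ) =>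
      heatKernel α t p.1 p.2 * f p.2 * laguerreSumPi α k p.1) (μ.prod μ) := by
    rw [integrable_prod_iff hmeas.aestronglyMeasurable]
    constructor
    · filter_upwards [ae_mem_orthant (α := α)] with x hx
      exact (integrable_heatKernel_mul hf.aestronglyMeasurable hM ht hx).mul_const _
    · refine Integrable.mono' ((integrable_laguerreSumPi (α := α) k).norm.const_mul M)
        hmeas.norm.stronglyMeasurable.integral_prod_right.aestronglyMeasurable ?_
      filter_upwards [ae_mem_orthant (α := α)] with x hx
      simp_rw [norm_mul, integral_mul_const]
      rw [norm_mul, norm_norm, Real.norm_of_nonneg (integral_nonneg fun y => by positivity)]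
      refine mul_le_mul_of_nonneg_right ?_ (norm_nonneg _)
      have hM' : ∀ᵐ x ∂(laguerreMeasure α), |(|f x|)| ≤ M := by simpa using hM
      refine (le_abs_self _).trans (le_of_eq_of_le ?_ (abs_heatOp_le hM' ht hx))
      simp only [heatOp, Real.norm_eq_abs, abs_of_nonneg (heatKernel_nonneg t _ _)]
      rfl
  calc ∫ x, heatOp α t f x * laguerreSumPi α k x ∂μ
      = ∫ x, ∫ y, heatKernel α t x y * f y * laguerreSumPi α k x ∂μ ∂μ := by
        simp_rw [integral_mul_const]; rfl
    _ = ∫ y, ∫ x, heatKernel α t x y * f y * laguerreSumPi α k x ∂μ ∂μ :=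
        integral_integral_swap hint
    _ = ∫ y, Real.exp (-(t * (∑ i, k i : ℕ))) * (f y * laguerreSumPi α k y) ∂μ := by
        refine integral_congr_ae ?_
        filter_upwards [ae_mem_orthant (α := α)] with y hy
        have := (integral_heatKernel_mul_laguerreSumPi (α := α) ht hy k).2
        calc ∫ x, heatKernel α t x y * f y * laguerreSumPi α k x ∂μ
            = ∫ x, f y * (heatKernel α t y x * laguerreSumPi α k x) ∂μ := by
              congr 1; ext x; rw [heatKernel_comm]; ring
          _ = _ := by rw [integral_const_mul, this]; ring
    _ = _ := integral_const_mul _ _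

end

/-! ### Completeness of the Laguerre polynomials -/

theorem pow_mem_span_laguerreSum (a : ℝ) (n : ℕ) :
    (fun x : ℝ => x ^ n) ∈ Submodule.span ℝ (range (laguerreSum a)) := by
  induction n using Nat.strong_induction_on with
  | _ n ih =>
    set b : ℕ → ℝ := fun m => (-1) ^ m * risingFactorial (a + 1 + m) (n - m) /
      ((n - m).factorial * m.factorial) with hb
    have hbn : b n ≠ 0 := by
      simp only [hb, Nat.sub_self, risingFactorial_zero, Nat.factorial_zero]
      have : (n.factorial : ℝ) ≠ 0 := by positivity
      simp [this]
    have h1 : (fun x : ℝ => x ^ n) = (b n)⁻¹ •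
        (laguerreSum a n - ∑ m ∈ Finset.range n, b m • (fun x : ℝ => x ^ m)) := by
      ext x
      simp only [Pi.smul_apply, Pi.sub_apply, Finset.sum_apply, smul_eq_mul]
      have hL : laguerreSum a n x = ∑ m ∈ Finset.range (n + 1), b m * x ^ m := rfl
      rw [hL, Finset.sum_range_succ, add_sub_cancel_left, inv_mul_cancel_left₀ hbn]
    rw [h1]
    refine Submodule.smul_mem _ _ (Submodule.sub_mem _
      (Submodule.subset_span (mem_range_self n)) (Submodule.sum_mem _ fun m hm => ?_))
    exact Submodule.smul_mem _ _ (ih m (Finset.mem_range.1 hm))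

/-- Two complex functions analytic on a preconnected open set, with the same derivatives at one of
its points, agree on that set. -/
theorem eqOn_of_iteratedDeriv_eq {f g : ℂ → ℂ} {U : Set ℂ} (hf : AnalyticOnNhd ℂ f U)
    (hg : AnalyticOnNhd ℂ g U) (hU : IsPreconnected U) {z : ℂ} (hz : z ∈ U)
    (h : ∀ n, iteratedDeriv n f z = iteratedDeriv n g z) : EqOn f g U := by
  refine hf.eqOn_of_preconnected_of_eventuallyEq hg hU hz ?_
  have h1 := (hf z hz).hasFPowerSeriesAt
  have h2 := (hg z hz).hasFPowerSeriesAt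
  simp_rw [h] at h1
  have h3 := h1.sub h2
  rw [sub_self] at h3
  filter_upwards [h3.eventually_eq_zero] with w hw
  exact sub_eq_zero.1 hw

section

open ProbabilityTheory

variable {d : ℕ} {α : Fin d → ℝ} [hα : Fact (∀ i, -1 < α i)] {h : (Fin d → ℝ) → ℝ}

theorem integrable_mul_laguerreSumPi (hh : MemLp h 2 (laguerreMeasure α)) (k : Fin d → ℕ) :
    Integrable (fun x => h x * laguerreSumPi α k x) (laguerreMeasure α) :=
  hh.integrable_mul (memLp_laguerreSumPi k)

theorem integral_mul_monomial_eq_zero (hh : MemLp h 2 (laguerreMeasure α))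
    (h0 : ∀ k, ∫ x, h x * laguerreSumPi α k x ∂(laguerreMeasure α) = 0) (n : Fin d → ℕ) :
    ∫ x, h x * ∏ i, x i ^ n i ∂(laguerreMeasure α) = 0 := by
  have hc : ∀ i, ∃ c : ℕ →₀ ℝ, ∀ y : ℝ, y ^ n i = ∑ j ∈ c.support, c j * laguerreSum (α i) j y := by
    intro i
    obtain ⟨c, hc⟩ := Finsupp.mem_span_range_iff_exists_finsupp.1
      (pow_mem_span_laguerreSum (α i) (n i))
    refine ⟨c, fun y => ?_⟩
    have := congrFun hc y
    simp only [Finsupp.sum, Finset.sum_apply, Pi.smul_apply, smul_eq_mul] at this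
    exact this.symm
  choose c hc using hc
  have he : ∀ x : Fin d → ℝ, h x * ∏ i, x i ^ n i
      = ∑ k ∈ Fintype.piFinset fun i => (c i).support,
          (∏ i, c i (k i)) * (h x * laguerreSumPi α k x) := by
    intro x
    rw [Finset.prod_congr rfl fun i _ => hc i (x i), Finset.prod_univ_sum, Finset.mul_sum]
    refine Finset.sum_congr rfl fun k _ => ?_
    rw [Finset.prod_mul_distrib, laguerreSumPi]; ring
  simp_rw [he]
  rw [integral_finsetSum]
  · refine Finset.sum_eq_zero fun k _ => ?_
    rw [integral_const_mul, h0 k, mul_zero]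
  · intro k _
    exact (hh.integrable_mul (memLp_laguerreSumPi k)).const_mul _

theorem memLp_monomial (n : Fin d → ℕ) :
    MemLp (fun x : Fin d → ℝ => ∏ i, x i ^ n i) 2 (laguerreMeasure α) := by
  have hm : Measurable (fun x : Fin d → ℝ => ∏ i, x i ^ n i) := by fun_prop
  rw [memLp_two_iff_integrable_sq hm.aestronglyMeasurable]
  simp_rw [← Finset.prod_pow]
  exact Integrable.fintype_prod (f := fun i y => (y ^ n i) ^ 2)
    fun i => (memLp_pow_gammaMeasure (hα.out i) (n i)).integrable_sq

theorem integral_mul_linear_pow_eq_zero (hh : MemLp h 2 (laguerreMeasure α))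
    (h0 : ∀ k, ∫ x, h x * laguerreSumPi α k x ∂(laguerreMeasure α) = 0) (ξ : Fin d → ℝ) (n : ℕ) :
    Integrable (fun x => h x * (∑ i, ξ i * x i) ^ n) (laguerreMeasure α) ∧
      ∫ x, h x * (∑ i, ξ i * x i) ^ n ∂(laguerreMeasure α) = 0 := by
  have he : ∀ x : Fin d → ℝ, h x * (∑ i, ξ i * x i) ^ n
      = ∑ k ∈ Finset.piAntidiag Finset.univ n, ((Nat.multinomial Finset.univ k : ℝ) *
          ∏ i, ξ i ^ k i) * (h x * ∏ i, x i ^ k i) := by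
    intro x
    rw [Finset.sum_pow_eq_sum_piAntidiag, Finset.mul_sum]
    refine Finset.sum_congr rfl fun k _ => ?_
    simp_rw [mul_pow, Finset.prod_mul_distrib]; ring
  have hi : ∀ k ∈ Finset.piAntidiag Finset.univ n, Integrable (fun x =>
      ((Nat.multinomial Finset.univ k : ℝ) * ∏ i, ξ i ^ k i) * (h x * ∏ i, x i ^ k i))
      (laguerreMeasure α) := fun k _ => (hh.integrable_mul (memLp_monomial k)).const_mul _
  simp_rw [he]
  refine ⟨integrable_finsetSum _ hi, ?_⟩
  rw [integral_finsetSum _ hi]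
  refine Finset.sum_eq_zero fun k _ => ?_
  rw [integral_const_mul, integral_mul_monomial_eq_zero hh h0 k, mul_zero]

theorem memLp_exp_linear {ξ : Fin d → ℝ} {t : ℝ} (ht : ∀ i, t * ξ i < 1 / 2) :
    MemLp (fun x : Fin d → ℝ => Real.exp (t * ∑ i, ξ i * x i)) 2 (laguerreMeasure α) := by
  have hm : Measurable (fun x : Fin d → ℝ => Real.exp (t * ∑ i, ξ i * x i)) := by fun_prop
  rw [memLp_two_iff_integrable_sq hm.aestronglyMeasurable]
  have he : ∀ x : Fin d → ℝ, Real.exp (t * ∑ i, ξ i * x i) ^ 2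
      = ∏ i, Real.exp (2 * (t * ξ i) * x i) := by
    intro x
    rw [← Real.exp_sum, ← Real.exp_nat_mul]
    congr 1
    rw [Finset.mul_sum, Finset.mul_sum]
    refine Finset.sum_congr rfl fun i _ => ?_
    push_cast; ring
  simp_rw [he]
  exact Integrable.fintype_prod (f := fun i y => Real.exp (2 * (t * ξ i) * y))
    fun i => integrable_exp_gammaMeasure (hα.out i) (by linarith [ht i])

omit hα in
/-- Integrals against the measure `h⁺ dμ`, encoded through `ENNReal.ofReal`, which truncates
negative values to zero. -/
theorem integral_withDensity_posPart {E : Type*} [NormedAddCommGroup E] [NormedSpace ℝ E]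
    (hm : Measurable h) (φ : (Fin d → ℝ) → E) :
    ∫ x, φ x ∂((laguerreMeasure α).withDensity fun x => ENNReal.ofReal (h x))
      = ∫ x, (max (h x) 0) • φ x ∂(laguerreMeasure α) := by
  rw [integral_withDensity_eq_integral_toReal_smul hm.ennreal_ofReal
    (ae_of_all _ fun _ => ENNReal.ofReal_lt_top)]
  simp [ENNReal.toReal_ofReal']

omit hα in
theorem integrable_withDensity_posPart (hm : Measurable h) {φ : (Fin d → ℝ) → ℝ}
    (hφ : Measurable φ) (hi : Integrable (fun x => h x * φ x) (laguerreMeasure α)) :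
    Integrable φ ((laguerreMeasure α).withDensity fun x => ENNReal.ofReal (h x)) := by
  rw [integrable_withDensity_iff_integrable_smul' hm.ennreal_ofReal
    (ae_of_all _ fun _ => ENNReal.ofReal_lt_top)]
  refine Integrable.mono hi (by fun_prop) (ae_of_all _ fun x => ?_)
  rw [ENNReal.toReal_ofReal', smul_eq_mul, norm_mul, norm_mul]
  refine mul_le_mul_of_nonneg_right ?_ (norm_nonneg _)
  rw [Real.norm_of_nonneg (le_max_right _ _), Real.norm_eq_abs]
  exact max_le (le_abs_self _) (abs_nonneg _)

/-- The moment generating functions of `h⁺ dμ_α` and `h⁻ dμ_α` along any linear functional have the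
same Taylor coefficients at `0`, hence agree on a strip that contains the imaginary axis; so the two
measures have the same characteristic function. -/
theorem laguerre_complete_of_measurable (hm : Measurable h) (hh : MemLp h 2 (laguerreMeasure α))
    (h0 : ∀ k, ∫ x, h x * laguerreSumPi α k x ∂(laguerreMeasure α) = 0) :
    h =ᵐ[laguerreMeasure α] 0 := by
  set μ := laguerreMeasure α with hμ
  have hint : Integrable h μ := hh.integrable (by norm_num)
  set ν₁ := μ.withDensity fun x => ENNReal.ofReal (h x) with hν₁
  set ν₂ := μ.withDensity fun x => ENNReal.ofReal (-h x) with hν₂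
  have : IsFiniteMeasure ν₁ := isFiniteMeasure_withDensity_ofReal hint.2
  have : IsFiniteMeasure ν₂ := isFiniteMeasure_withDensity_ofReal hint.neg.2
  have hdual : charFunDual ν₁ = charFunDual ν₂ := by
    ext L
    set ξ : Fin d → ℝ := fun i => L (Pi.single i 1) with hξ
    have hL : ∀ x, L x = ∑ i, ξ i * x i := by
      intro x
      have h1 : x = ∑ i, x i • (Pi.single i (1 : ℝ) : Fin d → ℝ) := by
        ext j; simp [Finset.sum_apply, Pi.single_apply]
      conv_lhs => rw [h1]
      simp [map_sum, hξ, mul_comm]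
    set Y : (Fin d → ℝ) → ℝ := fun x => ∑ i, ξ i * x i with hY
    have hYm : Measurable Y := by fun_prop
    -- the bound `1 / 2` makes `e^{tY}` square-integrable, so that it can be paired with `h`
    set S : Set ℝ := {t | ∀ i, t * ξ i < 1 / 2} with hS
    have hSo : IsOpen S := by
      have : S = ⋂ i, {t | t * ξ i < 1 / 2} := by ext; simp [hS]
      rw [this]
      exact isOpen_iInter_of_finite fun i => isOpen_lt (by fun_prop) continuous_const
    have hexp : ∀ t ∈ S, Integrable (fun x => h x * Real.exp (t * Y x)) μ := fun t ht =>
      hh.integrable_mul (memLp_exp_linear ht)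
    have hsub₁ : S ⊆ interior (integrableExpSet Y ν₁) :=
      interior_maximal (fun t ht => integrable_withDensity_posPart hm (by fun_prop) (hexp t ht)) hSo
    have hsub₂ : S ⊆ interior (integrableExpSet Y ν₂) := by
      refine interior_maximal (fun t ht => ?_) hSo
      refine integrable_withDensity_posPart hm.neg (by fun_prop) ?_
      simpa using (hexp t ht).neg
    set U : Set ℂ := {z | z.re ∈ S} with hU
    have hS0 : (0 : ℝ) ∈ S := fun i => by norm_num
    have hUconv : Convex ℝ U := by
      have hSc : Convex ℝ S := by
        have : S = ⋂ i, {t | t * ξ i < 1 / 2} := by ext; simp [hS]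
        rw [this]
        refine convex_iInter fun i => ?_
        exact convex_halfSpace_lt (f := fun t : ℝ => t * ξ i)
          (IsLinearMap.mk (fun x y => by ring) (fun c x => by simp [mul_assoc])) _
      exact hSc.linear_preimage Complex.reLm
    have hEq : EqOn (complexMGF Y ν₁) (complexMGF Y ν₂) U := by
      refine eqOn_of_iteratedDeriv_eq (z := 0)
        (analyticOnNhd_complexMGF.mono fun z hz => hsub₁ hz)
        (analyticOnNhd_complexMGF.mono fun z hz => hsub₂ hz) hUconv.isPreconnected
        (by simpa [hU] using hS0) fun n => ?_
      rw [iteratedDeriv_complexMGF (hsub₁ (by simpa using hS0)),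
        iteratedDeriv_complexMGF (hsub₂ (by simpa using hS0))]
      have hp := integral_mul_linear_pow_eq_zero hh h0 ξ n
      have hp1 : Integrable (fun x => max (h x) 0 * Y x ^ n) μ := by
        refine Integrable.mono hp.1 (by fun_prop) (ae_of_all _ fun x => ?_)
        rw [norm_mul, norm_mul]
        refine mul_le_mul_of_nonneg_right ?_ (norm_nonneg _)
        rw [Real.norm_of_nonneg (le_max_right _ _), Real.norm_eq_abs]
        exact max_le (le_abs_self _) (abs_nonneg _)
      have hp2 : Integrable (fun x => max (-h x) 0 * Y x ^ n) μ := by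
        refine Integrable.mono hp.1 (by fun_prop) (ae_of_all _ fun x => ?_)
        rw [norm_mul, norm_mul]
        refine mul_le_mul_of_nonneg_right ?_ (norm_nonneg _)
        rw [Real.norm_of_nonneg (le_max_right _ _), Real.norm_eq_abs]
        exact max_le (neg_le_abs _) (abs_nonneg _)
      have hreal : ∫ x, Y x ^ n ∂ν₁ = ∫ x, Y x ^ n ∂ν₂ := by
        rw [hν₁, hν₂, integral_withDensity_posPart hm,
          integral_withDensity_posPart (h := fun x => -h x) hm.neg]
        simp only [smul_eq_mul]
        rw [← sub_eq_zero, ← integral_sub hp1 hp2]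
        refine Eq.trans ?_ hp.2
        congr 1; ext x
        have hx : max (h x) 0 - max (-h x) 0 = h x := by
          rcases le_total 0 (h x) with hx | hx
          · rw [max_eq_left hx, max_eq_right (by linarith)]; ring
          · rw [max_eq_right hx, max_eq_left (by linarith)]; ring
        rw [← sub_mul, hx]
      simp only [zero_mul, Complex.exp_zero, mul_one]
      have hc : ∀ ν : Measure (Fin d → ℝ), ∫ x, (Y x : ℂ) ^ n ∂ν = ((∫ x, Y x ^ n ∂ν : ℝ) : ℂ) := by
        intro ν
        rw [← integral_complex_ofReal]; simp
      rw [hc, hc, hreal]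
    have hI := hEq (show Complex.I ∈ U by simpa [hU] using hS0)
    simp only [complexMGF] at hI
    simp only [charFunDual_apply, hL]
    simpa only [mul_comm Complex.I] using hI
  have hν : ν₁ = ν₂ := Measure.ext_of_charFunDual hdual
  rw [hν₁, hν₂, withDensity_eq_iff (by fun_prop) (by fun_prop)] at hν
  · filter_upwards [hν] with x hx
    simp only [Pi.zero_apply]
    rcases le_total 0 (h x) with h' | h'
    · rw [ENNReal.ofReal_of_nonpos (by linarith : -h x ≤ 0)] at hx
      exact le_antisymm (ENNReal.ofReal_eq_zero.1 hx) h'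
    · rw [ENNReal.ofReal_of_nonpos h'] at hx
      have := ENNReal.ofReal_eq_zero.1 hx.symm
      linarith
  · have := measure_lt_top ν₁ univ
    rw [hν₁, withDensity_apply _ MeasurableSet.univ, Measure.restrict_univ] at this
    exact this.ne

/-- **Completeness of the Laguerre polynomials** in `L²(μ_α)`. -/
theorem laguerre_complete (hh : MemLp h 2 (laguerreMeasure α))
    (h0 : ∀ k, ∫ x, h x * laguerreSumPi α k x ∂(laguerreMeasure α) = 0) :
    h =ᵐ[laguerreMeasure α] 0 := by
  have hae := hh.1.ae_eq_mk
  refine hae.trans (laguerre_complete_of_measurable hh.1.stronglyMeasurable_mk.measurable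
    (hh.ae_eq hae) fun k => ?_)
  rw [← h0 k]
  refine integral_congr_ae ?_
  filter_upwards [hae] with x hx
  rw [hx]

/-- A square-integrable function is determined by its Laguerre coefficients. -/
theorem ae_eq_of_laguerre_coeff_eq {g : (Fin d → ℝ) → ℝ} (hh : MemLp h 2 (laguerreMeasure α))
    (hg : MemLp g 2 (laguerreMeasure α))
    (h0 : ∀ k, ∫ x, h x * laguerreSumPi α k x ∂(laguerreMeasure α)
      = ∫ x, g x * laguerreSumPi α k x ∂(laguerreMeasure α)) :
    h =ᵐ[laguerreMeasure α] g := by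
  have := laguerre_complete (α := α) (hh.sub hg) fun k => by
    simp only [Pi.sub_apply, sub_mul]
    rw [integral_sub (integrable_mul_laguerreSumPi hh k) (integrable_mul_laguerreSumPi hg k),
      h0 k, sub_self]
  filter_upwards [this] with x hx
  simpa [sub_eq_zero] using hx

end

/-! ### The damped Poisson semigroup -/

/-- The Laguerre coefficient of multi-degree `k` (the polynomials are not normalized). -/
noncomputable def laguerreCoeff {d : ℕ} (α : Fin d → ℝ) (h : (Fin d → ℝ) → ℝ) (k : Fin d → ℕ) : ℝ :=
  ∫ x, h x * laguerreSumPi α k x ∂(laguerreMeasure α)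

/-- `f` is measurable up to null sets and bounded by `M` almost everywhere. -/
def EssBdd {d : ℕ} (α : Fin d → ℝ) (f : (Fin d → ℝ) → ℝ) (M : ℝ) : Prop :=
  AEStronglyMeasurable f (laguerreMeasure α) ∧ ∀ᵐ x ∂(laguerreMeasure α), |f x| ≤ M

/-- The damped Poisson semigroup `e^{-εt} P_t`. The rates `ε = 0` and `ε = 1` give the semigroups of
`√L` and of `I + √L`. -/
noncomputable def dampedPoisson {d : ℕ} (α : Fin d → ℝ) (ε t : ℝ) (f : (Fin d → ℝ) → ℝ)
    (x : Fin d → ℝ) : ℝ :=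
  dampedSubordination ε (fun v => heatOp α v f x) t

open Classical in
/-- The `j`-th time derivative of the damped Poisson semigroup, set to zero off the set of positive
times and of points of the orthant so that it is jointly measurable. -/
noncomputable def poissonDeriv {d : ℕ} (α : Fin d → ℝ) (ε : ℝ) (f : (Fin d → ℝ) → ℝ) (j : ℕ)
    (t : ℝ) (x : Fin d → ℝ) : ℝ :=
  if 0 < t ∧ x ∈ orthant d then iteratedDeriv j (fun s => dampedPoisson α ε s f x) t else 0

/-- The constant in Cauchy's estimate for the `j`-th derivative. -/
noncomputable def cauchyConst (j : ℕ) : ℝ := j.factorial * 2 * 4 ^ j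

theorem cauchyConst_pos (j : ℕ) : 0 < cauchyConst j := by unfold cauchyConst; positivity

theorem measurableSet_orthant (d : ℕ) : MeasurableSet (orthant d) := by
  have : orthant d = ⋂ i, {x : Fin d → ℝ | 0 < x i} := by ext; simp [orthant]
  rw [this]
  exact MeasurableSet.iInter fun i => measurableSet_lt measurable_const (measurable_pi_apply i)

section

variable {d : ℕ} {α : Fin d → ℝ} [hα : Fact (∀ i, -1 < α i)]
variable {f g : (Fin d → ℝ) → ℝ} {M : ℝ}

theorem EssBdd.nonneg (hf : EssBdd α f M) : 0 ≤ M := by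
  obtain ⟨x, hx⟩ := hf.2.exists
  exact (abs_nonneg _).trans hx

theorem EssBdd.memLp (hf : EssBdd α f M) (p : ENNReal) : MemLp f p (laguerreMeasure α) :=
  MemLp.of_bound hf.1 M hf.2

omit hα in
theorem EssBdd.congr (hf : EssBdd α f M) (h : f =ᵐ[laguerreMeasure α] g) : EssBdd α g M := by
  refine ⟨hf.1.congr h, ?_⟩
  filter_upwards [hf.2, h] with x hx hx'
  rwa [← hx']

omit hα in
theorem laguerreCoeff_congr (h : f =ᵐ[laguerreMeasure α] g) (k : Fin d → ℕ) :
    laguerreCoeff α f k = laguerreCoeff α g k := by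
  refine integral_congr_ae ?_
  filter_upwards [h] with x hx
  rw [hx]

theorem ae_eq_of_laguerreCoeff_eq {M' : ℝ} (hf : EssBdd α f M) (hg : EssBdd α g M')
    (h : ∀ k, laguerreCoeff α f k = laguerreCoeff α g k) : f =ᵐ[laguerreMeasure α] g :=
  ae_eq_of_laguerre_coeff_eq (hf.memLp 2) (hg.memLp 2) h

/-- Averages of a family of functions with an integrable bound: Fubini's theorem for Laguerre
coefficients. The exceptional null set of the bound may depend on the parameter. -/
theorem mixture_properties {Ω : Type*} [MeasurableSpace Ω] {ν : Measure Ω} [SFinite ν]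
    {W : Ω → (Fin d → ℝ) → ℝ} (hW : Measurable (Function.uncurry W)) {b : Ω → ℝ}
    (hb : Integrable b ν) (hbd : ∀ᵐ ω ∂ν, ∀ᵐ x ∂(laguerreMeasure α), |W ω x| ≤ b ω) :
    (∀ᵐ x ∂(laguerreMeasure α), Integrable (fun ω => W ω x) ν) ∧
    EssBdd α (fun x => ∫ ω, W ω x ∂ν) (∫ ω, b ω ∂ν) ∧
    ∀ k, laguerreCoeff α (fun x => ∫ ω, W ω x ∂ν) k = ∫ ω, laguerreCoeff α (W ω) k ∂ν := by
  set μ := laguerreMeasure α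
  obtain ⟨b', hb'm, hbb'⟩ := hb.1
  have hswap : ∀ᵐ x ∂μ, ∀ᵐ ω ∂ν, |W ω x| ≤ b' ω := by
    have hms : MeasurableSet {p : Ω × (Fin d → ℝ) | |W p.1 p.2| ≤ b' p.1} :=
      measurableSet_le hW.norm (hb'm.measurable.comp measurable_fst)
    rw [← Measure.ae_ae_comm hms]
    filter_upwards [hbd, hbb'] with ω h1 h2
    filter_upwards [h1] with x hx
    exact hx.trans_eq h2
  have hbx : ∀ᵐ x ∂μ, ∀ᵐ ω ∂ν, ‖W ω x‖ ≤ b ω := by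
    filter_upwards [hswap] with x hx
    filter_upwards [hx, hbb'] with ω h1 h2
    exact h1.trans_eq h2.symm
  have hsec : ∀ x, Measurable fun ω => W ω x := fun x =>
    hW.comp (measurable_id.prodMk measurable_const)
  have hI1 : ∀ᵐ x ∂μ, Integrable (fun ω => W ω x) ν := by
    filter_upwards [hbx] with x hx
    exact hb.mono' (hsec x).aestronglyMeasurable hx
  refine ⟨hI1, ⟨?_, ?_⟩, fun k => ?_⟩
  · have h := (hW.comp measurable_swap).stronglyMeasurable.integral_prod_right' (ν := ν)
    exact h.aestronglyMeasurable
  · filter_upwards [hbx] with x hx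
    exact norm_integral_le_of_norm_le hb hx
  · have hm : Measurable (fun p : (Fin d → ℝ) × Ω => W p.2 p.1 * laguerreSumPi α k p.1) :=
      (hW.comp measurable_swap).mul ((measurable_laguerreSumPi k).comp measurable_fst)
    have hint : Integrable (fun p : (Fin d → ℝ) × Ω => W p.2 p.1 * laguerreSumPi α k p.1)
        (μ.prod ν) := by
      rw [integrable_prod_iff hm.aestronglyMeasurable]
      constructor
      · filter_upwards [hI1] with x hx
        exact hx.mul_const _
      · refine Integrable.mono' ((integrable_laguerreSumPi (α := α) k).norm.const_mul (∫ ω, b ω ∂ν))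
          hm.norm.stronglyMeasurable.integral_prod_right.aestronglyMeasurable ?_
        filter_upwards [hI1, hbx] with x hx hbx
        simp_rw [norm_mul, integral_mul_const]
        rw [norm_mul, norm_norm, Real.norm_of_nonneg (integral_nonneg fun y => norm_nonneg _)]
        refine mul_le_mul_of_nonneg_right ?_ (norm_nonneg _)
        exact integral_mono_ae hx.norm hb hbx
    calc laguerreCoeff α (fun x => ∫ ω, W ω x ∂ν) k
        = ∫ x, ∫ ω, W ω x * laguerreSumPi α k x ∂ν ∂μ := by
          simp_rw [laguerreCoeff, integral_mul_const]; rfl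
      _ = ∫ ω, ∫ x, W ω x * laguerreSumPi α k x ∂μ ∂ν := integral_integral_swap hint
      _ = _ := rfl

theorem measurable_dampedPoisson_param {S T : Type*} [MeasurableSpace S] [MeasurableSpace T]
    {H : S → (Fin d → ℝ) → ℝ} (hH : Measurable (Function.uncurry H)) (ε : ℝ) {s : T → S}
    {t : T → ℝ} {x : T → Fin d → ℝ} (hs : Measurable s) (ht : Measurable t) (hx : Measurable x) :
    Measurable (fun p => dampedPoisson α ε (t p) (H (s p)) (x p)) := by
  have h1 : Measurable (fun q : T × ℝ => Real.exp (-q.2) / Real.sqrt q.2 *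
      heatOp α (t q.1 ^ 2 / (4 * q.2)) (H (s q.1)) (x q.1)) :=
    Measurable.mul (by fun_prop)
      (measurable_heatOp_param hH (by fun_prop) (by fun_prop) (by fun_prop))
  have h2 := (h1.stronglyMeasurable.integral_prod_right'
    (ν := volume.restrict (Ioi (0 : ℝ)))).measurable
  unfold dampedPoisson dampedSubordination
  exact Measurable.mul (by fun_prop) (h2.const_mul _)

theorem measurable_dampedPoisson (hf : Measurable f) (ε : ℝ) :
    Measurable (fun p : ℝ × (Fin d → ℝ) => dampedPoisson α ε p.1 f p.2) :=
  measurable_dampedPoisson_param (S := Unit) (H := fun _ => f) (s := fun _ => ())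
    (hf.comp measurable_snd) ε measurable_const measurable_fst measurable_snd

theorem measurable_heatOp_time (hf : Measurable f) (x : Fin d → ℝ) :
    Measurable (fun v => heatOp α v f x) :=
  measurable_heatOp_param (S := Unit) (H := fun _ => f) (s := fun _ => ()) (hf.comp measurable_snd)
    measurable_const measurable_id measurable_const

omit hα in
theorem dampedPoisson_congr (h : f =ᵐ[laguerreMeasure α] g) (ε t : ℝ) (x : Fin d → ℝ) :
    dampedPoisson α ε t f x = dampedPoisson α ε t g x := by
  unfold dampedPoisson
  simp_rw [heatOp_congr h]

omit hα in
theorem poissonDeriv_congr (h : f =ᵐ[laguerreMeasure α] g) (ε : ℝ) (j : ℕ) (t : ℝ)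
    (x : Fin d → ℝ) : poissonDeriv α ε f j t x = poissonDeriv α ε g j t x := by
  unfold poissonDeriv
  simp_rw [dampedPoisson_congr h]

theorem dampedPoisson_eq_laguerrePoisson {t : ℝ} (ht : 0 < t) (ε : ℝ) {x : Fin d → ℝ}
    (hx : x ∈ orthant d) :
    dampedPoisson α ε t f x = Real.exp (-(ε * t)) * laguerrePoisson α t f x := by
  rw [dampedPoisson, dampedSubordination, laguerrePoisson]
  congr 2
  refine setIntegral_congr_fun measurableSet_Ioi fun u (hu : 0 < u) => ?_
  rw [laguerreHeat_eq_heatOp (by positivity) f hx]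

omit hα in
theorem poissonDeriv_of_mem (ε : ℝ) (j : ℕ) {t : ℝ} (ht : 0 < t) {x : Fin d → ℝ}
    (hx : x ∈ orthant d) :
    poissonDeriv α ε f j t x = iteratedDeriv j (fun s => dampedPoisson α ε s f x) t :=
  if_pos ⟨ht, hx⟩

theorem analyticAt_dampedPoisson (hf : Measurable f)
    (hM : ∀ᵐ x ∂(laguerreMeasure α), |f x| ≤ M) (ε : ℝ) {t : ℝ} (ht : 0 < t) {x : Fin d → ℝ}
    (hx : x ∈ orthant d) : AnalyticAt ℝ (fun s => dampedPoisson α ε s f x) t :=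
  analyticAt_dampedSubordination ε (measurable_heatOp_time hf x)
    (fun _ hv => abs_heatOp_le hM hv hx) ht

theorem hasDerivAt_poissonDeriv (hf : Measurable f)
    (hM : ∀ᵐ x ∂(laguerreMeasure α), |f x| ≤ M) (ε : ℝ) (j : ℕ) {t : ℝ} (ht : 0 < t)
    {x : Fin d → ℝ} (hx : x ∈ orthant d) :
    HasDerivAt (fun s => poissonDeriv α ε f j s x) (poissonDeriv α ε f (j + 1) t x) t := by
  have h : HasDerivAt (iteratedDeriv j fun s => dampedPoisson α ε s f x)
      (iteratedDeriv (j + 1) (fun s => dampedPoisson α ε s f x) t) t := by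
    rw [iteratedDeriv_succ]
    refine DifferentiableAt.hasDerivAt ?_
    have := (analyticAt_dampedPoisson hf hM ε ht hx).iterated_deriv j
    rw [← iteratedDeriv_eq_iterate] at this
    exact this.differentiableAt
  rw [poissonDeriv_of_mem ε _ ht hx]
  refine h.congr_of_eventuallyEq ?_
  filter_upwards [Ioi_mem_nhds ht] with s hs
  exact poissonDeriv_of_mem ε _ hs hx

theorem abs_poissonDeriv_le (hf : Measurable f)
    (hM : ∀ᵐ x ∂(laguerreMeasure α), |f x| ≤ M) {ε : ℝ} (hε : 0 ≤ ε) (j : ℕ) {t : ℝ} (ht : 0 < t)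
    (x : Fin d → ℝ) : |poissonDeriv α ε f j t x| ≤ cauchyConst j * M / t ^ j := by
  have hM0 : 0 ≤ M := EssBdd.nonneg (α := α) ⟨hf.aestronglyMeasurable, hM⟩
  by_cases hx : x ∈ orthant d
  · rw [poissonDeriv_of_mem ε _ ht hx]
    refine (abs_iteratedDeriv_dampedSubordination_le hε (measurable_heatOp_time hf x) hM0
      (fun _ hv => abs_heatOp_le hM hv hx) j ht).trans_eq ?_
    rw [cauchyConst, div_pow]
    field_simp
  · rw [poissonDeriv, if_neg (by tauto), abs_zero]
    have := cauchyConst_pos j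
    positivity

/-- A derivative in `t` is a pointwise limit of difference quotients, which gives joint
measurability by induction. -/
theorem measurable_poissonDeriv (hf : Measurable f)
    (hM : ∀ᵐ x ∂(laguerreMeasure α), |f x| ≤ M) (ε : ℝ) (j : ℕ) :
    Measurable (fun p : ℝ × (Fin d → ℝ) => poissonDeriv α ε f j p.1 p.2) := by
  have hE : MeasurableSet {p : ℝ × (Fin d → ℝ) | 0 < p.1 ∧ p.2 ∈ orthant d} :=
    (measurableSet_lt measurable_const measurable_fst).inter
      (measurable_snd (measurableSet_orthant d))
  induction j with
  | zero =>
    unfold poissonDeriv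
    simp only [iteratedDeriv_zero]
    exact Measurable.ite hE (measurable_dampedPoisson hf ε) measurable_const
  | succ j ih =>
    have hshift : ∀ n : ℕ, Measurable (fun p : ℝ × (Fin d → ℝ) =>
        poissonDeriv α ε f j (p.1 + 1 / ((n : ℝ) + 1)) p.2) := fun n =>
      ih.comp (by fun_prop : Measurable fun p : ℝ × (Fin d → ℝ) =>
        (p.1 + 1 / ((n : ℝ) + 1), p.2))
    refine measurable_of_tendsto_metrizable (f := fun (n : ℕ) (p : ℝ × (Fin d → ℝ)) =>
      {p : ℝ × (Fin d → ℝ) | 0 < p.1 ∧ p.2 ∈ orthant d}.indicator (fun p => ((n : ℝ) + 1) *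
        (poissonDeriv α ε f j (p.1 + 1 / ((n : ℝ) + 1)) p.2 - poissonDeriv α ε f j p.1 p.2)) p)
      (fun n => (((hshift n).sub ih).const_mul _).indicator hE) ?_
    rw [tendsto_pi_nhds]
    rintro ⟨t, x⟩
    by_cases hp : 0 < t ∧ x ∈ orthant d
    · simp only [indicator_of_mem (show (t, x) ∈ {p : ℝ × (Fin d → ℝ) | 0 < p.1 ∧ p.2 ∈ orthant d}
        from hp)]
      have h1 := (hasDerivAt_poissonDeriv hf hM ε j hp.1 hp.2).tendsto_slope_zero
      have h2 : Tendsto (fun n : ℕ => 1 / ((n : ℝ) + 1)) atTop (nhdsWithin 0 {0}ᶜ) := by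
        refine tendsto_nhdsWithin_iff.2 ⟨tendsto_one_div_add_atTop_nhds_zero_nat, ?_⟩
        exact Eventually.of_forall fun n => by simp; positivity
      refine (h1.comp h2).congr fun n => ?_
      simp
    · simp only [indicator_of_notMem
        (show (t, x) ∉ {p : ℝ × (Fin d → ℝ) | 0 < p.1 ∧ p.2 ∈ orthant d} from hp)]
      rw [poissonDeriv, if_neg hp]
      exact tendsto_const_nhds

theorem measurable_poissonDeriv_section (hf : Measurable f)
    (hM : ∀ᵐ x ∂(laguerreMeasure α), |f x| ≤ M) (ε : ℝ) (j : ℕ) (t : ℝ) :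
    Measurable (poissonDeriv α ε f j t) :=
  (measurable_poissonDeriv hf hM ε j).comp (measurable_const.prodMk measurable_id)

/-- `e^{-εt} P_t` is a contraction of `L^∞`, and multiplies the coefficient of multi-degree `k` by
`e^{-t(ε + √|k|)}`. -/
theorem essBdd_dampedPoisson (hf : Measurable f)
    (hM : ∀ᵐ x ∂(laguerreMeasure α), |f x| ≤ M) {ε : ℝ} (hε : 0 ≤ ε) {t : ℝ} (ht : 0 < t) :
    EssBdd α (dampedPoisson α ε t f) M ∧
      ∀ k, laguerreCoeff α (dampedPoisson α ε t f) k
        = Real.exp (-(t * (ε + Real.sqrt (∑ i, k i : ℕ)))) * laguerreCoeff α f k := by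
  have hpi := Real.sqrt_pos.2 Real.pi_pos
  have hW : Measurable (Function.uncurry fun (u : ℝ) (x : Fin d → ℝ) =>
      Real.exp (-(ε * t)) * (1 / Real.sqrt Real.pi) * (Real.exp (-u) / Real.sqrt u *
        heatOp α (t ^ 2 / (4 * u)) f x)) := by
    have h : Measurable fun p : ℝ × (Fin d → ℝ) => heatOp α (t ^ 2 / (4 * p.1)) f p.2 :=
      measurable_heatOp_param (S := Unit) (H := fun _ => f) (s := fun _ => ())
        (hf.comp measurable_snd) measurable_const (by fun_prop) (by fun_prop)
    exact Measurable.const_mul (Measurable.mul (by fun_prop) h) _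
  have hM0 : 0 ≤ M := EssBdd.nonneg (α := α) ⟨hf.aestronglyMeasurable, hM⟩
  have hmix := mixture_properties (α := α) (ν := volume.restrict (Ioi (0 : ℝ))) hW
    (b := fun u => Real.exp (-(ε * t)) * (1 / Real.sqrt Real.pi) *
      (Real.exp (-u) / Real.sqrt u * M))
    ((integrable_subordination_density.mul_const M).const_mul _) (by
      filter_upwards [ae_restrict_mem measurableSet_Ioi] with u (hu : 0 < u)
      filter_upwards [ae_mem_orthant (α := α)] with x hx
      rw [abs_mul, abs_of_pos (by positivity), abs_mul,
        abs_of_nonneg (by positivity : 0 ≤ Real.exp (-u) / Real.sqrt u)]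
      have := abs_heatOp_le hM (t := t ^ 2 / (4 * u)) (by positivity) hx
      gcongr)
  have hG := integral_subordination_exp (b := 0) le_rfl ht
  have hfun : (fun x => ∫ u in Ioi (0 : ℝ), Real.exp (-(ε * t)) * (1 / Real.sqrt Real.pi) *
      (Real.exp (-u) / Real.sqrt u * heatOp α (t ^ 2 / (4 * u)) f x))
      = dampedPoisson α ε t f := by
    ext x
    rw [integral_const_mul, dampedPoisson, dampedSubordination, mul_assoc]
  simp only [mul_zero, neg_zero, Real.exp_zero, mul_one, Real.sqrt_zero] at hG
  rw [hfun] at hmix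
  refine ⟨⟨hmix.2.1.1, ?_⟩, fun k => ?_⟩
  · filter_upwards [hmix.2.1.2] with x hx
    refine hx.trans ?_
    rw [integral_const_mul, integral_mul_const, mul_assoc, ← mul_assoc (1 / _), hG, one_mul]
    refine mul_le_of_le_one_left hM0 (Real.exp_le_one_iff.2 ?_)
    have : 0 ≤ ε * t := by positivity
    linarith
  · rw [hmix.2.2 k]
    have h1 : ∀ u ∈ Ioi (0 : ℝ), laguerreCoeff α (fun x => Real.exp (-(ε * t)) *
        (1 / Real.sqrt Real.pi) * (Real.exp (-u) / Real.sqrt u *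
          heatOp α (t ^ 2 / (4 * u)) f x)) k
        = Real.exp (-(ε * t)) * laguerreCoeff α f k * (1 / Real.sqrt Real.pi) *
          (Real.exp (-u) / Real.sqrt u *
            Real.exp (-(t ^ 2 / (4 * u) * (∑ i, k i : ℕ)))) := by
      intro u (hu : 0 < u)
      simp_rw [laguerreCoeff, mul_assoc]
      rw [integral_const_mul, integral_const_mul, integral_const_mul,
        integral_heatOp_mul_laguerreSumPi hf hM (by positivity) k]
      ring
    rw [setIntegral_congr_fun measurableSet_Ioi h1, integral_const_mul, mul_assoc,
      integral_subordination_exp (by positivity) ht]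
    rw [mul_right_comm, ← Real.exp_add]
    congr 2; ring

/-- The `j`-th time derivative multiplies the coefficients by `(-ρ)^j e^{-tρ}`, where
`ρ = ε + √|k|`. -/
theorem laguerreCoeff_poissonDeriv (hf : Measurable f)
    (hM : ∀ᵐ x ∂(laguerreMeasure α), |f x| ≤ M) {ε : ℝ} (hε : 0 ≤ ε) (j : ℕ) (k : Fin d → ℕ) :
    ∀ t : ℝ, 0 < t → laguerreCoeff α (poissonDeriv α ε f j t) k
      = (-(ε + Real.sqrt (∑ i, k i : ℕ))) ^ j *
        Real.exp (-(t * (ε + Real.sqrt (∑ i, k i : ℕ)))) * laguerreCoeff α f k := by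
  have hM0 : 0 ≤ M := EssBdd.nonneg (α := α) ⟨hf.aestronglyMeasurable, hM⟩
  set ρ := ε + Real.sqrt (∑ i, k i : ℕ) with hρ
  induction j with
  | zero =>
    intro t ht
    rw [pow_zero, one_mul, ← (essBdd_dampedPoisson hf hM hε ht).2 k]
    refine laguerreCoeff_congr ?_ k
    filter_upwards [ae_mem_orthant (α := α)] with x hx
    rw [poissonDeriv_of_mem ε _ ht hx, iteratedDeriv_zero]
  | succ j ih =>
    intro t ht
    have hD : HasDerivAt (fun s => laguerreCoeff α (poissonDeriv α ε f j s) k)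
        (laguerreCoeff α (poissonDeriv α ε f (j + 1) t) k) t := by
      refine (hasDerivAt_integral_of_dominated_loc_of_deriv_le
        (F := fun s x => poissonDeriv α ε f j s x * laguerreSumPi α k x)
        (F' := fun s x => poissonDeriv α ε f (j + 1) s x * laguerreSumPi α k x)
        (s := Ioi (t / 2))
        (bound := fun x => cauchyConst (j + 1) * M / (t / 2) ^ (j + 1) * |laguerreSumPi α k x|)
        (Ioi_mem_nhds (by linarith)) ?_ ?_ ?_ ?_ ?_ ?_).2
      · exact Eventually.of_forall fun s => ((measurable_poissonDeriv_section hf hM ε j s).mul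
          (measurable_laguerreSumPi k)).aestronglyMeasurable
      · exact (integrable_laguerreSumPi k).bdd_mul (c := cauchyConst j * M / t ^ j)
          (measurable_poissonDeriv_section hf hM ε j t).aestronglyMeasurable
          (ae_of_all _ fun x => abs_poissonDeriv_le hf hM hε j ht x)
      · exact ((measurable_poissonDeriv_section hf hM ε (j + 1) t).mul
          (measurable_laguerreSumPi k)).aestronglyMeasurable
      · refine ae_of_all _ fun x s (hs : t / 2 < s) => ?_
        rw [norm_mul, Real.norm_eq_abs, Real.norm_eq_abs]
        refine mul_le_mul_of_nonneg_right ?_ (abs_nonneg _)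
        refine (abs_poissonDeriv_le hf hM hε (j + 1) (by linarith) x).trans ?_
        have := cauchyConst_pos (j + 1)
        gcongr
      · exact (integrable_laguerreSumPi k).abs.const_mul _
      · filter_upwards [ae_mem_orthant (α := α)] with x hx s (hs : t / 2 < s)
        exact (hasDerivAt_poissonDeriv hf hM ε j (by linarith) hx).mul_const _
    have hE : HasDerivAt (fun s : ℝ => (-ρ) ^ j * Real.exp (-(s * ρ)) * laguerreCoeff α f k)
        ((-ρ) ^ (j + 1) * Real.exp (-(t * ρ)) * laguerreCoeff α f k) t := by
      have h1 : HasDerivAt (fun s : ℝ => -(s * ρ)) (-ρ) t := by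
        simpa using ((hasDerivAt_id t).mul_const ρ).fun_neg
      refine ((h1.exp.const_mul ((-ρ) ^ j)).mul_const _).congr_deriv ?_
      ring
    refine hD.unique (hE.congr_of_eventuallyEq ?_)
    filter_upwards [Ioi_mem_nhds ht] with s hs
    exact ih s hs

/-- The semigroup law, for time derivatives, by comparison of Laguerre coefficients. -/
theorem poissonDeriv_add (hf : Measurable f) (hM : ∀ᵐ x ∂(laguerreMeasure α), |f x| ≤ M)
    {ε : ℝ} (hε : 0 ≤ ε) (i j : ℕ) {s t : ℝ} (hs : 0 < s) (ht : 0 < t) :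
    poissonDeriv α ε f (i + j) (s + t)
      =ᵐ[laguerreMeasure α] poissonDeriv α ε (poissonDeriv α ε f j t) i s := by
  have hm := measurable_poissonDeriv_section hf hM ε j t
  have hb : ∀ᵐ x ∂(laguerreMeasure α), |poissonDeriv α ε f j t x| ≤ cauchyConst j * M / t ^ j :=
    ae_of_all _ fun x => abs_poissonDeriv_le hf hM hε j ht x
  refine ae_eq_of_laguerreCoeff_eq
    ⟨(measurable_poissonDeriv_section hf hM ε (i + j) (s + t)).aestronglyMeasurable,
      ae_of_all _ fun x => abs_poissonDeriv_le hf hM hε (i + j) (by positivity) x⟩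
    ⟨(measurable_poissonDeriv_section hm hb ε i s).aestronglyMeasurable,
      ae_of_all _ fun x => abs_poissonDeriv_le hm hb hε i hs x⟩ fun k => ?_
  rw [laguerreCoeff_poissonDeriv hf hM hε _ k _ (by positivity),
    laguerreCoeff_poissonDeriv hm hb hε _ k _ hs, laguerreCoeff_poissonDeriv hf hM hε _ k _ ht,
    add_mul, neg_add (s * _), Real.exp_add, pow_add]
  ring

end

/-! ### Integrals and inequalities in one variable -/

theorem nextInt_pos (b : ℝ) : 0 < nextInt b := Nat.succ_pos _

theorem lt_nextInt (b : ℝ) : b < nextInt b := by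
  unfold nextInt; push_cast; exact Nat.lt_floor_add_one b

theorem nextInt_mono {a b : ℝ} (h : a ≤ b) : nextInt a ≤ nextInt b := by
  unfold nextInt; have := Nat.floor_mono h; omega

theorem integrableOn_rpow_Ioc {a : ℝ} (ha : -1 < a) (s : ℝ) :
    IntegrableOn (fun u : ℝ => u ^ a) (Ioc 0 s) := by
  rcases le_or_gt s 0 with h | h
  · simp [Ioc_eq_empty_of_le h]
  · exact (intervalIntegrable_iff_integrableOn_Ioc_of_le h.le).1
      (intervalIntegral.intervalIntegrable_rpow' ha)

/-- A function on the half-line is integrable when it is `O(u ^ a)` near zero, `a > -1`, and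
`O(u ^ b)` at infinity, `b < -1`. -/
theorem integrableOn_Ioi_of_two_bounds {φ : ℝ → ℝ} (hφ : Measurable φ) {a b C : ℝ} (ha : -1 < a)
    (hb : b < -1) (h0 : ∀ u, 0 < u → u ≤ 1 → |φ u| ≤ C * u ^ a)
    (h1 : ∀ u, 1 < u → |φ u| ≤ C * u ^ b) : IntegrableOn φ (Ioi 0) := by
  rw [← Ioc_union_Ioi_eq_Ioi zero_le_one]
  refine IntegrableOn.union ?_ ?_
  · refine Integrable.mono' ((integrableOn_rpow_Ioc ha 1).const_mul C) hφ.aestronglyMeasurable ?_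
    filter_upwards [ae_restrict_mem measurableSet_Ioc] with u hu
    exact h0 u hu.1 hu.2
  · refine Integrable.mono' ((integrableOn_Ioi_rpow_of_lt hb one_pos).const_mul C)
      hφ.aestronglyMeasurable ?_
    filter_upwards [ae_restrict_mem measurableSet_Ioi] with u hu
    exact h1 u hu

theorem abs_exp_neg_sub_one_le {u : ℝ} (hu : 0 ≤ u) :
    |Real.exp (-u) - 1| ≤ 1 ∧ |Real.exp (-u) - 1| ≤ u := by
  have h1 : Real.exp (-u) ≤ 1 := Real.exp_le_one_iff.2 (by linarith)
  have h2 := Real.add_one_le_exp (-u)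
  have h3 := Real.exp_pos (-u)
  rw [abs_of_nonpos (by linarith)]
  constructor <;> linarith

theorem integrableOn_fracConst {lam : ℝ} (hlam : 0 < lam) :
    IntegrableOn (fun u : ℝ => u ^ (-lam - 1) * (Real.exp (-u) - 1) ^ nextInt lam) (Ioi 0) := by
  refine integrableOn_Ioi_of_two_bounds (C := 1) (a := (nextInt lam : ℝ) - lam - 1)
    (b := -lam - 1) (by fun_prop) (by linarith [lt_nextInt lam]) (by linarith) ?_ ?_
  · intro u hu _
    rw [abs_mul, abs_pow, abs_of_pos (Real.rpow_pos_of_pos hu _), one_mul,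
      show (nextInt lam : ℝ) - lam - 1 = (-lam - 1) + nextInt lam by ring, Real.rpow_add hu,
      Real.rpow_natCast]
    have := (abs_exp_neg_sub_one_le hu.le).2
    gcongr
  · intro u hu
    have hu0 : 0 < u := by linarith
    rw [abs_mul, abs_pow, abs_of_pos (Real.rpow_pos_of_pos hu0 _), one_mul]
    exact mul_le_of_le_one_right (Real.rpow_pos_of_pos hu0 _).le
      (pow_le_one₀ (abs_nonneg _) (abs_exp_neg_sub_one_le hu0.le).1)

theorem fracConst_ne_zero {lam : ℝ} (hlam : 0 < lam) : fracConst lam ≠ 0 := by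
  have hint := (integrableOn_fracConst hlam).const_mul ((-1) ^ nextInt lam)
  have hpos : ∀ u ∈ Ioi (0 : ℝ), 0 < (-1) ^ nextInt lam *
      (u ^ (-lam - 1) * (Real.exp (-u) - 1) ^ nextInt lam) := by
    intro u (hu : 0 < u)
    have h1 : Real.exp (-u) < 1 := by rw [Real.exp_lt_one_iff]; linarith
    have h2 : (-1) ^ nextInt lam * (u ^ (-lam - 1) * (Real.exp (-u) - 1) ^ nextInt lam)
        = u ^ (-lam - 1) * (1 - Real.exp (-u)) ^ nextInt lam := by
      rw [mul_left_comm, ← mul_pow]; ring_nf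
    rw [h2]
    exact mul_pos (Real.rpow_pos_of_pos hu _) (pow_pos (by linarith) _)
  have h : 0 < ∫ u in Ioi (0 : ℝ), (-1) ^ nextInt lam *
      (u ^ (-lam - 1) * (Real.exp (-u) - 1) ^ nextInt lam) := by
    rw [setIntegral_pos_iff_support_of_nonneg_ae]
    · refine lt_of_lt_of_le ?_ (measure_mono (s := Ioi (0 : ℝ)) fun u hu => ⟨?_, hu⟩)
      · simp
      · exact (hpos u hu).ne'
    · filter_upwards [ae_restrict_mem measurableSet_Ioi] with u hu
      exact (hpos u hu).le
    · exact hint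
  rw [integral_const_mul] at h
  intro h0
  rw [fracConst] at h0
  rw [h0, mul_zero] at h
  exact lt_irrefl _ h

/-- The scaling identity behind the integral formula for `ρ ^ λ`. -/
theorem integral_rpow_mul_exp_sub_one_pow {lam ρ : ℝ} (hlam : 0 < lam) (hρ : 0 ≤ ρ) :
    ∫ s in Ioi (0 : ℝ), s ^ (-lam - 1) * (Real.exp (-(s * ρ)) - 1) ^ nextInt lam
      = fracConst lam * ρ ^ lam := by
  rcases hρ.eq_or_lt with rfl | hρ
  · simp [Real.zero_rpow hlam.ne', (nextInt_pos lam).ne']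
  · have h := integral_comp_mul_left_Ioi'
      (fun u : ℝ => u ^ (-lam - 1) * (Real.exp (-u) - 1) ^ nextInt lam) 0 hρ
    rw [mul_zero] at h
    rw [fracConst, ← h, smul_eq_mul, mul_right_comm, ← integral_const_mul]
    refine setIntegral_congr_fun measurableSet_Ioi fun s (hs : 0 < s) => ?_
    have e1 : ρ * ρ ^ lam * (ρ * s) ^ (-lam - 1) = s ^ (-lam - 1) := by
      rw [Real.mul_rpow hρ.le hs.le, ← Real.rpow_one_add' hρ.le (by positivity), ← mul_assoc,
        ← Real.rpow_add hρ, show 1 + lam + (-lam - 1) = 0 by ring, Real.rpow_zero, one_mul]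
    rw [← mul_assoc, e1, mul_comm ρ s]

theorem integrableOn_rpow_mul_add_rpow_neg {a γ t : ℝ} (ha : 0 < a) (hγ : a < γ) (ht : 0 < t) :
    IntegrableOn (fun s : ℝ => s ^ (a - 1) * (t + s) ^ (-γ)) (Ioi 0) := by
  refine integrableOn_Ioi_of_two_bounds (C := max (t ^ (-γ)) 1) (a := a - 1) (b := a - 1 - γ)
    (by fun_prop) (by linarith) (by linarith) ?_ ?_
  · intro u hu _
    rw [abs_of_nonneg (by positivity), mul_comm]
    refine mul_le_mul_of_nonneg_right ?_ (Real.rpow_pos_of_pos hu _).le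
    exact (Real.rpow_le_rpow_of_nonpos ht (by linarith) (by linarith)).trans (le_max_left _ _)
  · intro u hu
    have hu0 : 0 < u := by linarith
    rw [abs_of_nonneg (by positivity), sub_eq_add_neg (a - 1) γ, Real.rpow_add hu0, ← mul_assoc,
      mul_comm _ (u ^ (a - 1)), mul_assoc]
    refine mul_le_mul_of_nonneg_left ?_ (Real.rpow_pos_of_pos hu0 _).le
    have h1 : (t + u) ^ (-γ) ≤ u ^ (-γ) :=
      Real.rpow_le_rpow_of_nonpos hu0 (by linarith) (by linarith)
    exact h1.trans (le_mul_of_one_le_left (by positivity) (le_max_right _ _))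

theorem integral_rpow_mul_add_rpow_neg (a γ : ℝ) {t : ℝ} (ht : 0 < t) :
    ∫ s in Ioi (0 : ℝ), s ^ (a - 1) * (t + s) ^ (-γ)
      = t ^ (a - γ) * ∫ s in Ioi (0 : ℝ), s ^ (a - 1) * (1 + s) ^ (-γ) := by
  have h := integral_comp_mul_left_Ioi' (fun s : ℝ => s ^ (a - 1) * (t + s) ^ (-γ)) 0 ht
  rw [mul_zero] at h
  rw [← h, smul_eq_mul, ← integral_const_mul, ← integral_const_mul]
  refine setIntegral_congr_fun measurableSet_Ioi fun s (hs : 0 < s) => ?_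
  rw [show t + t * s = t * (1 + s) by ring, Real.mul_rpow ht.le hs.le,
    Real.mul_rpow ht.le (by positivity), sub_eq_add_neg a γ, Real.rpow_add ht,
    Real.rpow_sub_one ht.ne' a]
  field_simp

/-- The Gamma integral that expresses `ρ ^ λ` through the `k`-th power of `ρ`, `k > λ`. -/
theorem integral_rpow_mul_neg_pow_mul_exp {a ρ t : ℝ} {k m : ℕ} (ha : 0 < a) (hak : a < k)
    (hk : 0 < k) (hρ : 0 ≤ ρ) :
    ∫ s in Ioi (0 : ℝ), s ^ (a - 1) * ((-ρ) ^ (m + k) * Real.exp (-((t + s) * ρ)))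
      = (-1) ^ k * Real.Gamma a * ((-ρ) ^ m * Real.exp (-(t * ρ)) * ρ ^ ((k : ℝ) - a)) := by
  rcases hρ.eq_or_lt with rfl | hρ
  · rw [Real.zero_rpow (by linarith)]
    simp [hk.ne']
  · have h := Real.integral_rpow_mul_exp_neg_mul_Ioi ha hρ
    have h2 : ∀ s ∈ Ioi (0 : ℝ), s ^ (a - 1) * ((-ρ) ^ (m + k) * Real.exp (-((t + s) * ρ)))
        = ((-ρ) ^ (m + k) * Real.exp (-(t * ρ))) * (s ^ (a - 1) * Real.exp (-(ρ * s))) := by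
      intro s _
      rw [show -((t + s) * ρ) = -(t * ρ) + -(ρ * s) by ring, Real.exp_add]; ring
    rw [setIntegral_congr_fun measurableSet_Ioi h2, integral_const_mul, h, pow_add, neg_pow ρ k,
      Real.rpow_sub hρ, Real.rpow_natCast, Real.div_rpow zero_le_one hρ.le, Real.one_rpow]
    field_simp

theorem integral_Ioc_neg_mul_exp (ρ : ℝ) {s : ℝ} (hs : 0 ≤ s) :
    ∫ v in Ioc 0 s, -ρ * Real.exp (-(v * ρ)) = Real.exp (-(s * ρ)) - 1 := by
  rw [← intervalIntegral.integral_of_le hs]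
  have h : ∀ v ∈ uIcc 0 s, HasDerivAt (fun v : ℝ => Real.exp (-(v * ρ)))
      (-ρ * Real.exp (-(v * ρ))) v := by
    intro v _
    have h1 : HasDerivAt (fun s : ℝ => -(s * ρ)) (-ρ) v := by
      simpa using ((hasDerivAt_id v).mul_const ρ).fun_neg
    refine h1.exp.congr_deriv (by ring)
  rw [intervalIntegral.integral_eq_sub_of_hasDerivAt h
    (Continuous.intervalIntegrable (by fun_prop) _ _)]
  simp

/-- Integrating a bound `B σ ^ (-θ - 1)` for the derivative down from `1` gives the bound
`(b + B / θ) t ^ (-θ)` for the function. -/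
theorem abs_le_rpow_of_abs_deriv_le {v v' : ℝ → ℝ} {B b θ : ℝ} (hθ : 0 < θ)
    (hv : ∀ t, 0 < t → HasDerivAt v (v' t) t) (hB : ∀ t, 0 < t → t ≤ 1 → |v' t| ≤ B * t ^ (-θ - 1))
    (hb : |v 1| ≤ b) {t : ℝ} (ht : 0 < t) (ht1 : t ≤ 1) : |v t| ≤ (b + B / θ) * t ^ (-θ) := by
  have hB0 : 0 ≤ B := by have := hB 1 one_pos le_rfl; simp at this; exact (abs_nonneg _).trans this
  have hb0 : 0 ≤ b := (abs_nonneg _).trans hb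
  have key : ∀ w w' : ℝ → ℝ, (∀ t, 0 < t → HasDerivAt w (w' t) t) →
      (∀ t, 0 < t → t ≤ 1 → |w' t| ≤ B * t ^ (-θ - 1)) → |w 1| ≤ b →
      w t ≤ (b + B / θ) * t ^ (-θ) := by
    intro w w' hw hw' hw1
    have hd : ∀ s, 0 < s → HasDerivAt (fun s => B / θ * s ^ (-θ) - w s)
        (-(B * s ^ (-θ - 1)) - w' s) s := by
      intro s hs
      have h1 := ((Real.hasDerivAt_rpow_const (p := -θ) (Or.inl hs.ne')).const_mul (B / θ)).sub
        (hw s hs)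
      refine h1.congr_deriv ?_
      field_simp
    have hanti : AntitoneOn (fun s => B / θ * s ^ (-θ) - w s) (Icc t 1) := by
      refine antitoneOn_of_deriv_nonpos (convex_Icc t 1) ?_ ?_ ?_
      · exact fun s hs => (hd s (ht.trans_le hs.1)).continuousAt.continuousWithinAt
      · intro s hs
        rw [interior_Icc] at hs
        exact (hd s (ht.trans hs.1)).differentiableAt.differentiableWithinAt
      · intro s hs
        rw [interior_Icc] at hs
        rw [(hd s (ht.trans hs.1)).deriv]
        have := neg_abs_le (w' s)
        have := hw' s (ht.trans hs.1) hs.2.le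
        linarith
    have h := hanti (left_mem_Icc.2 ht1) (right_mem_Icc.2 ht1) ht1
    simp only [Real.one_rpow, mul_one] at h
    have h1 : (1 : ℝ) ≤ t ^ (-θ) := Real.one_le_rpow_of_pos_of_le_one_of_nonpos ht ht1 (by linarith)
    have h2 := le_abs_self (w 1)
    have h3 : b * 1 ≤ b * t ^ (-θ) := mul_le_mul_of_nonneg_left h1 hb0
    have h4 : 0 ≤ B / θ := by positivity
    linarith
  rw [abs_le]
  refine ⟨?_, key v v' hv hB hb⟩
  have := key (fun s => -v s) (fun s => -v' s) (fun s hs => (hv s hs).fun_neg)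
    (fun s h1 h2 => by rw [abs_neg]; exact hB s h1 h2) (by rw [abs_neg]; exact hb)
  linarith

/-- A bound `B σ ^ (-θ)` for the derivative is inherited by the function, on `(0, 1]`. -/
theorem abs_le_rpow_of_abs_deriv_le' {v v' : ℝ → ℝ} {B b θ : ℝ} (hθ : 0 ≤ θ)
    (hv : ∀ t, 0 < t → HasDerivAt v (v' t) t) (hB : ∀ t, 0 < t → t ≤ 1 → |v' t| ≤ B * t ^ (-θ))
    (hb : |v 1| ≤ b) {t : ℝ} (ht : 0 < t) (ht1 : t ≤ 1) : |v t| ≤ (b + B) * t ^ (-θ) := by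
  have hB0 : 0 ≤ B := by have := hB 1 one_pos le_rfl; simp at this; exact (abs_nonneg _).trans this
  have hb0 : 0 ≤ b := (abs_nonneg _).trans hb
  have h1 : (1 : ℝ) ≤ t ^ (-θ) := Real.one_le_rpow_of_pos_of_le_one_of_nonpos ht ht1 (by linarith)
  have h := (convex_Icc t 1).norm_image_sub_le_of_norm_hasDerivWithin_le (f := v) (f' := v')
    (C := B * t ^ (-θ)) (x := 1) (y := t)
    (fun s hs => (hv s (ht.trans_le hs.1)).hasDerivWithinAt)
    (fun s hs => (hB s (ht.trans_le hs.1) hs.2).trans (mul_le_mul_of_nonneg_left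
      (Real.rpow_le_rpow_of_nonpos ht hs.1 (by linarith)) hB0))
    (right_mem_Icc.2 ht1) (left_mem_Icc.2 ht1)
  rw [Real.norm_eq_abs, Real.norm_eq_abs] at h
  have h2 : |t - 1| ≤ 1 := by rw [abs_le]; constructor <;> linarith
  have h3 : |v t| ≤ |v 1| + |v t - v 1| := by
    have := abs_add_le (v 1) (v t - v 1); rwa [add_sub_cancel] at this
  have h4 : B * t ^ (-θ) * |t - 1| ≤ B * t ^ (-θ) * 1 :=
    mul_le_mul_of_nonneg_left h2 (by positivity)
  have h5 : b * 1 ≤ b * t ^ (-θ) := mul_le_mul_of_nonneg_left h1 hb0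
  rw [add_mul]
  linarith

/-! ### Bounds of the time derivatives -/

/-- The operator `e^{-εs} P_s - I`. -/
noncomputable def dampedDiff {d : ℕ} (α : Fin d → ℝ) (ε s : ℝ) (h : (Fin d → ℝ) → ℝ)
    (x : Fin d → ℝ) : ℝ :=
  dampedPoisson α ε s h x - h x

theorem iteratedDeriv_exp_mul (δ : ℝ) (n : ℕ) (t : ℝ) :
    iteratedDeriv n (fun s : ℝ => Real.exp (δ * s)) t = δ ^ n * Real.exp (δ * t) := by
  exact congrFun (iteratedDeriv_exp_const_mul n δ) t

section

variable {d : ℕ} {α : Fin d → ℝ} [hα : Fact (∀ i, -1 < α i)]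

/-- For a family that is continuous in time, a bound at each time almost everywhere holds almost
everywhere at all times. -/
theorem ae_forall_abs_le {φ : ℝ → (Fin d → ℝ) → ℝ} {c : ℝ → ℝ}
    (hφ : ∀ x ∈ orthant d, ∀ t, 0 < t → ContinuousAt (fun s => φ s x) t)
    (hc : ∀ t, 0 < t → ContinuousAt c t)
    (h : ∀ t, 0 < t → ∀ᵐ x ∂(laguerreMeasure α), |φ t x| ≤ c t) :
    ∀ᵐ x ∂(laguerreMeasure α), ∀ t, 0 < t → |φ t x| ≤ c t := by
  have hq : ∀ᵐ x ∂(laguerreMeasure α), ∀ q : ℚ, (0 : ℝ) < q → |φ q x| ≤ c q := by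
    rw [ae_all_iff]
    intro q
    by_cases hq : (0 : ℝ) < q
    · filter_upwards [h q hq] with x hx _ using hx
    · exact ae_of_all _ fun x hx => absurd hx hq
  filter_upwards [hq, ae_mem_orthant (α := α)] with x hx hxo t ht
  by_contra! hlt
  have hev : ∀ᶠ s in nhds t, 0 < s ∧ c s < |φ s x| :=
    (lt_mem_nhds ht).and ((hc t ht).eventually_lt (hφ x hxo t ht).abs hlt)
  obtain ⟨U, hU, hUo, htU⟩ := eventually_nhds_iff.1 hev
  obtain ⟨q, hq⟩ := Rat.denseRange_cast.exists_mem_open hUo ⟨t, htU⟩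
  exact absurd (hx q (hU q hq).1) (not_le.2 (hU q hq).2)

theorem continuousAt_poissonDeriv {f : (Fin d → ℝ) → ℝ} {M : ℝ} (hf : Measurable f)
    (hM : ∀ᵐ x ∂(laguerreMeasure α), |f x| ≤ M) (ε : ℝ) (j : ℕ) {x : Fin d → ℝ}
    (hx : x ∈ orthant d) (t : ℝ) (ht : 0 < t) :
    ContinuousAt (fun s => poissonDeriv α ε f j s x) t :=
  (hasDerivAt_poissonDeriv hf hM ε j ht hx).continuousAt

/-- Changing the damping rate preserves bounds of the `N`-th time derivative by a negative power
of `t` on `(0, 1]`: the lower derivatives that enter Leibniz' rule satisfy the same bound. -/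
theorem exists_bound_change_damping (α : Fin d → ℝ) [Fact (∀ i, -1 < α i)] {ε₁ : ℝ}
    (hε₁ : 0 ≤ ε₁) (ε₂ : ℝ) (N : ℕ) :
    ∃ K : ℝ, 0 ≤ K ∧ ∀ (f : (Fin d → ℝ) → ℝ) (M B θ : ℝ), Measurable f →
      (∀ᵐ x ∂(laguerreMeasure α), |f x| ≤ M) → 0 ≤ θ → 0 ≤ B →
      (∀ᵐ x ∂(laguerreMeasure α), ∀ t, 0 < t → t ≤ 1 →
        |poissonDeriv α ε₁ f N t x| ≤ B * t ^ (-θ)) →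
      ∀ᵐ x ∂(laguerreMeasure α), ∀ t, 0 < t → t ≤ 1 →
        |poissonDeriv α ε₂ f N t x| ≤ K * (M + B) * t ^ (-θ) := by
  set δ := ε₁ - ε₂ with hδ
  set S := ∑ j ∈ Finset.range (N + 1), cauchyConst j with hS
  have hS0 : 0 ≤ S := Finset.sum_nonneg fun j _ => (cauchyConst_pos j).le
  have hSj : ∀ j ≤ N, cauchyConst j ≤ S := fun j hj =>
    Finset.single_le_sum (f := cauchyConst) (fun j _ => (cauchyConst_pos j).le)
      (Finset.mem_range.2 (by omega))
  refine ⟨∑ i ∈ Finset.range (N + 1), (N.choose i : ℝ) * |δ| ^ i * Real.exp |δ| *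
    (1 + N * S), by positivity, fun f M B θ hf hM hθ hB hbd => ?_⟩
  have hM0 : 0 ≤ M := EssBdd.nonneg (α := α) ⟨hf.aestronglyMeasurable, hM⟩
  filter_upwards [hbd, ae_mem_orthant (α := α)] with x hx hxo
  have hlow : ∀ i ≤ N, ∀ t, 0 < t → t ≤ 1 →
      |poissonDeriv α ε₁ f (N - i) t x| ≤ (B + i * (S * M)) * t ^ (-θ) := by
    intro i
    induction i with
    | zero => intro _ t ht ht1; simpa using hx t ht ht1
    | succ i ih =>
      intro hi t ht ht1
      have hNi : N - i = (N - (i + 1)) + 1 := by omega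
      have h1 := abs_poissonDeriv_le hf hM hε₁ (N - (i + 1)) one_pos x
      rw [one_pow, div_one] at h1
      have h2 : |poissonDeriv α ε₁ f (N - (i + 1)) 1 x| ≤ S * M :=
        h1.trans (mul_le_mul_of_nonneg_right (hSj _ (by omega)) hM0)
      have := abs_le_rpow_of_abs_deriv_le' hθ
        (fun s hs => hasDerivAt_poissonDeriv hf hM ε₁ (N - (i + 1)) hs hxo)
        (by rw [← hNi]; exact ih (by omega)) h2 ht ht1
      refine this.trans_eq ?_
      push_cast; ring
  intro t ht ht1
  have hfun : (fun s => dampedPoisson α ε₂ s f x)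
      = fun s => Real.exp (δ * s) * dampedPoisson α ε₁ s f x := by
    ext s
    rw [dampedPoisson, dampedPoisson, dampedSubordination, dampedSubordination,
      ← mul_assoc (Real.exp (δ * s)), ← Real.exp_add]
    congr 2; rw [hδ]; ring
  rw [poissonDeriv_of_mem ε₂ N ht hxo, hfun, iteratedDeriv_fun_mul (by fun_prop)
    (analyticAt_dampedPoisson hf hM ε₁ ht hxo).contDiffAt, Finset.sum_mul, Finset.sum_mul]
  refine (Finset.abs_sum_le_sum_abs _ _).trans (Finset.sum_le_sum fun i hi => ?_)
  have hi' : i ≤ N := Nat.lt_succ_iff.1 (Finset.mem_range.1 hi)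
  rw [iteratedDeriv_exp_mul, ← poissonDeriv_of_mem ε₁ _ ht hxo, abs_mul, abs_mul, abs_mul, abs_pow,
    Nat.abs_cast, abs_of_pos (Real.exp_pos _)]
  have he : Real.exp (δ * t) ≤ Real.exp |δ| := by
    refine Real.exp_le_exp.2 ?_
    calc δ * t ≤ |δ| * t := mul_le_mul_of_nonneg_right (le_abs_self _) ht.le
      _ ≤ |δ| * 1 := mul_le_mul_of_nonneg_left ht1 (abs_nonneg _)
      _ = _ := mul_one _
  have h1 : |poissonDeriv α ε₁ f (N - i) t x| ≤ ((1 + N * S) * (M + B)) * t ^ (-θ) := by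
    refine (hlow i hi' t ht ht1).trans (mul_le_mul_of_nonneg_right ?_ (by positivity))
    have hiN : (i : ℝ) ≤ N := by exact_mod_cast hi'
    have h2 : (i : ℝ) * (S * M) ≤ N * (S * M) := mul_le_mul_of_nonneg_right hiN (by positivity)
    have h3 : 0 ≤ N * S * B := by positivity
    nlinarith
  calc (N.choose i : ℝ) * (|δ| ^ i * Real.exp (δ * t)) * |poissonDeriv α ε₁ f (N - i) t x|
      ≤ (N.choose i : ℝ) * (|δ| ^ i * Real.exp |δ|) * (((1 + N * S) * (M + B)) * t ^ (-θ)) := by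
        gcongr
    _ = _ := by ring

theorem laguerrePoisson_deriv_eq (f : (Fin d → ℝ) → ℝ) (n : ℕ) {t : ℝ} (ht : 0 < t)
    {x : Fin d → ℝ} (hx : x ∈ orthant d) :
    iteratedDeriv n (fun s => laguerrePoisson α s f x) t = poissonDeriv α 0 f n t x := by
  rw [poissonDeriv_of_mem 0 n ht hx]
  refine Filter.EventuallyEq.iteratedDeriv_eq n ?_
  filter_upwards [Ioi_mem_nhds ht] with s hs
  rw [dampedPoisson_eq_laguerrePoisson hs 0 hx]; simp

theorem laguerreLipBound_iff {β A : ℝ} {f : (Fin d → ℝ) → ℝ} :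
    LaguerreLipBound α β f A ↔ 0 ≤ A ∧ ∀ t, 0 < t → ∀ᵐ x ∂(laguerreMeasure α),
      |poissonDeriv α 0 f (nextInt β) t x| ≤ A * t ^ (-((nextInt β : ℝ) - β)) := by
  unfold LaguerreLipBound
  refine and_congr_right fun hA => forall₂_congr fun t ht => ?_
  have he : -(nextInt β : ℝ) + β = -((nextInt β : ℝ) - β) := by ring
  have h0 : 0 ≤ A * t ^ (-((nextInt β : ℝ) - β)) := by positivity
  rw [eLpNorm_exponent_top, he]
  constructor
  · intro h
    filter_upwards [ae_le_eLpNormEssSup (μ := laguerreMeasure α)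
      (f := fun x => iteratedDeriv (nextInt β) (fun s => laguerrePoisson α s f x) t),
      ae_mem_orthant (α := α)] with x hx hxo
    rw [← laguerrePoisson_deriv_eq f _ ht hxo]
    have h2 := hx.trans h
    rw [Real.enorm_eq_ofReal_abs] at h2
    exact (ENNReal.ofReal_le_ofReal_iff h0).1 h2
  · intro h
    refine eLpNormEssSup_le_of_ae_enorm_bound ?_
    filter_upwards [h, ae_mem_orthant (α := α)] with x hx hxo
    rw [laguerrePoisson_deriv_eq f _ ht hxo, Real.enorm_eq_ofReal_abs]
    exact ENNReal.ofReal_le_ofReal hx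

/-- For `t ≥ 1` Cauchy's estimate is stronger than the Lipschitz bound of any order `γ ≥ 0`. -/
theorem abs_poissonDeriv_le_of_one_le {f : (Fin d → ℝ) → ℝ} {M : ℝ} (hf : Measurable f)
    (hM : ∀ᵐ x ∂(laguerreMeasure α), |f x| ≤ M) {ε : ℝ} (hε : 0 ≤ ε) (j : ℕ) {γ : ℝ} (hγ : 0 ≤ γ)
    {t : ℝ} (ht : 1 ≤ t) (x : Fin d → ℝ) :
    |poissonDeriv α ε f j t x| ≤ cauchyConst j * M * t ^ (-((j : ℝ) - γ)) := by
  have hM0 : 0 ≤ M := EssBdd.nonneg (α := α) ⟨hf.aestronglyMeasurable, hM⟩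
  have ht0 : 0 < t := by linarith
  refine (abs_poissonDeriv_le hf hM hε j ht0 x).trans ?_
  rw [div_eq_mul_inv, ← Real.rpow_natCast, ← Real.rpow_neg ht0.le]
  have := cauchyConst_pos j
  refine mul_le_mul_of_nonneg_left ?_ (by positivity)
  exact Real.rpow_le_rpow_of_exponent_le ht (by linarith)

theorem continuousAt_const_mul_rpow (K p t : ℝ) (ht : 0 < t) :
    ContinuousAt (fun s : ℝ => K * s ^ p) t :=
  (Real.continuousAt_rpow_const t p (Or.inl ht.ne')).const_mul K

/-- The Lipschitz bound passes to the damped semigroup. -/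
theorem exists_bound_damped (α : Fin d → ℝ) [Fact (∀ i, -1 < α i)] {ε₁ ε₂ : ℝ} (hε₁ : 0 ≤ ε₁)
    (hε₂ : 0 ≤ ε₂) {β : ℝ} (hβ : 0 ≤ β) {n : ℕ} (hn : β ≤ n) :
    ∃ K : ℝ, 0 ≤ K ∧ ∀ (f : (Fin d → ℝ) → ℝ) (M A : ℝ), Measurable f →
      (∀ᵐ x ∂(laguerreMeasure α), |f x| ≤ M) → 0 ≤ A →
      (∀ t, 0 < t → ∀ᵐ x ∂(laguerreMeasure α),
        |poissonDeriv α ε₁ f n t x| ≤ A * t ^ (-((n : ℝ) - β))) →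
      ∀ᵐ x ∂(laguerreMeasure α), ∀ t, 0 < t →
        |poissonDeriv α ε₂ f n t x| ≤ K * (M + A) * t ^ (-((n : ℝ) - β)) := by
  obtain ⟨K, hK0, hK⟩ := exists_bound_change_damping α hε₁ ε₂ n
  have hC := cauchyConst_pos n
  refine ⟨K + cauchyConst n, by positivity, fun f M A hf hM hA h => ?_⟩
  have hM0 : 0 ≤ M := EssBdd.nonneg (α := α) ⟨hf.aestronglyMeasurable, hM⟩
  have h1 := ae_forall_abs_le (α := α)
    (fun x hx t ht => continuousAt_poissonDeriv hf hM ε₁ n hx t ht)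
    (fun t ht => continuousAt_const_mul_rpow A _ t ht) h
  have h2 := hK f M A ((n : ℝ) - β) hf hM (by linarith) hA (by
    filter_upwards [h1] with x hx t ht _ using hx t ht)
  filter_upwards [h2] with x hx t ht
  have htp : 0 < t ^ (-((n : ℝ) - β)) := Real.rpow_pos_of_pos ht _
  rcases le_total t 1 with h' | h'
  · refine (hx t ht h').trans (mul_le_mul_of_nonneg_right ?_ htp.le)
    exact mul_le_mul_of_nonneg_right (by linarith) (by linarith)
  · refine (abs_poissonDeriv_le_of_one_le hf hM hε₂ n hβ h' x).trans
      (mul_le_mul_of_nonneg_right ?_ htp.le)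
    have : 0 ≤ K * (M + A) := by positivity
    have : 0 ≤ cauchyConst n * A := by positivity
    linarith

/-- The Lipschitz bound for the derivatives of higher order, by the semigroup law. -/
theorem exists_bound_higher (α : Fin d → ℝ) [Fact (∀ i, -1 < α i)] {ε : ℝ} (hε : 0 ≤ ε)
    {β : ℝ} (hβ : 0 ≤ β) {n N : ℕ} (hn : β ≤ n) (hN : n ≤ N) :
    ∃ K : ℝ, 0 ≤ K ∧ ∀ (f : (Fin d → ℝ) → ℝ) (M A : ℝ), Measurable f →
      (∀ᵐ x ∂(laguerreMeasure α), |f x| ≤ M) → 0 ≤ A →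
      (∀ t, 0 < t → ∀ᵐ x ∂(laguerreMeasure α),
        |poissonDeriv α 0 f n t x| ≤ A * t ^ (-((n : ℝ) - β))) →
      ∀ t, 0 < t → ∀ᵐ x ∂(laguerreMeasure α),
        |poissonDeriv α ε f N t x| ≤ K * (M + A) * t ^ (-((N : ℝ) - β)) := by
  obtain ⟨K, hK0, hK⟩ := exists_bound_damped α le_rfl hε hβ hn
  have hC := cauchyConst_pos (N - n)
  refine ⟨cauchyConst (N - n) * K * (1 / 2) ^ (-((N : ℝ) - β)), by positivity,
    fun f M A hf hM hA h t ht => ?_⟩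
  have h1 := hK f M A hf hM hA h
  have ht2 : 0 < t / 2 := by linarith
  have h2 : ∀ᵐ x ∂(laguerreMeasure α), |poissonDeriv α ε f n (t / 2) x|
      ≤ K * (M + A) * (t / 2) ^ (-((n : ℝ) - β)) := by
    filter_upwards [h1] with x hx using hx _ ht2
  have hadd := poissonDeriv_add hf hM hε (N - n) n ht2 ht2
  rw [Nat.sub_add_cancel hN, add_halves] at hadd
  have hm := measurable_poissonDeriv_section hf hM ε n (t / 2)
  filter_upwards [hadd] with x hx
  rw [hx]
  refine (abs_poissonDeriv_le hm h2 hε (N - n) ht2 x).trans_eq ?_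
  have e1 : (t / 2) ^ (-((n : ℝ) - β)) / (t / 2) ^ (N - n) = (t / 2) ^ (-((N : ℝ) - β)) := by
    rw [← Real.rpow_natCast (t / 2) (N - n), ← Real.rpow_sub ht2, Nat.cast_sub hN]
    congr 1; ring
  have e2 : (t / 2) ^ (-((N : ℝ) - β)) = (1 / 2) ^ (-((N : ℝ) - β)) * t ^ (-((N : ℝ) - β)) := by
    rw [← Real.mul_rpow (by norm_num) ht.le]; congr 1; ring
  calc _ = cauchyConst (N - n) * (K * (M + A)) *
        ((t / 2) ^ (-((n : ℝ) - β)) / (t / 2) ^ (N - n)) := by ring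
    _ = _ := by rw [e1, e2]; ring

/-- A Lipschitz function of order `β` is one of any smaller order `β'`, with the derivative of any
order `k > β'` up to `n` in the definition. -/
theorem exists_bound_lower (α : Fin d → ℝ) [Fact (∀ i, -1 < α i)] {ε : ℝ} (hε : 0 ≤ ε)
    {β β' : ℝ} (hβ' : 0 ≤ β') (hββ' : β' ≤ β) {n k : ℕ} (hn : β ≤ n) (hkn : k ≤ n) (hk : β' < k) :
    ∃ K : ℝ, 0 ≤ K ∧ ∀ (f : (Fin d → ℝ) → ℝ) (M A : ℝ), Measurable f →
      (∀ᵐ x ∂(laguerreMeasure α), |f x| ≤ M) → 0 ≤ A →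
      (∀ t, 0 < t → ∀ᵐ x ∂(laguerreMeasure α),
        |poissonDeriv α 0 f n t x| ≤ A * t ^ (-((n : ℝ) - β))) →
      ∀ᵐ x ∂(laguerreMeasure α), ∀ t, 0 < t →
        |poissonDeriv α ε f k t x| ≤ K * (M + A) * t ^ (-((k : ℝ) - β')) := by
  obtain ⟨K₀, hK₀, hK⟩ := exists_bound_damped α le_rfl hε (hβ'.trans hββ') hn
  have hdown : ∀ i, i ≤ n - k → ∃ K : ℝ, 0 ≤ K ∧ ∀ (f : (Fin d → ℝ) → ℝ) (M A : ℝ), Measurable f →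
      (∀ᵐ x ∂(laguerreMeasure α), |f x| ≤ M) → 0 ≤ A →
      (∀ t, 0 < t → ∀ᵐ x ∂(laguerreMeasure α),
        |poissonDeriv α 0 f n t x| ≤ A * t ^ (-((n : ℝ) - β))) →
      ∀ᵐ x ∂(laguerreMeasure α), ∀ t, 0 < t → t ≤ 1 →
        |poissonDeriv α ε f (n - i) t x| ≤ K * (M + A) * t ^ (-(((n - i : ℕ) : ℝ) - β')) := by
    intro i
    induction i with
    | zero =>
      intro _
      refine ⟨K₀, hK₀, fun f M A hf hM hA h => ?_⟩
      have hM0 : 0 ≤ M := EssBdd.nonneg (α := α) ⟨hf.aestronglyMeasurable, hM⟩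
      filter_upwards [hK f M A hf hM hA h] with x hx t ht ht1
      refine (hx t ht).trans (mul_le_mul_of_nonneg_left ?_ (by positivity))
      exact Real.rpow_le_rpow_of_exponent_ge ht ht1 (by simp; linarith)
    | succ i ih =>
      intro hi
      obtain ⟨K, hK0, hKi⟩ := ih (by omega)
      have hni : n - i = (n - (i + 1)) + 1 := by omega
      have hθ : 0 < ((n - (i + 1) : ℕ) : ℝ) - β' := by
        have : (k : ℝ) ≤ ((n - (i + 1) : ℕ) : ℝ) := by exact_mod_cast (by omega)
        linarith
      have hC := cauchyConst_pos (n - (i + 1))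
      refine ⟨cauchyConst (n - (i + 1)) + K / (((n - (i + 1) : ℕ) : ℝ) - β'), by positivity,
        fun f M A hf hM hA h => ?_⟩
      have hM0 : 0 ≤ M := EssBdd.nonneg (α := α) ⟨hf.aestronglyMeasurable, hM⟩
      filter_upwards [hKi f M A hf hM hA h, ae_mem_orthant (α := α)] with x hx hxo t ht ht1
      have h1 := abs_poissonDeriv_le hf hM hε (n - (i + 1)) one_pos x
      rw [one_pow, div_one] at h1
      rw [hni] at hx
      have := abs_le_rpow_of_abs_deriv_le hθ (B := K * (M + A))
        (fun s hs => hasDerivAt_poissonDeriv hf hM ε (n - (i + 1)) hs hxo)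
        (fun s hs hs1 => (hx s hs hs1).trans_eq (by congr 2; push_cast; ring)) h1 ht ht1
      refine this.trans (mul_le_mul_of_nonneg_right ?_ (by positivity))
      rw [add_mul]
      refine add_le_add (mul_le_mul_of_nonneg_left (by linarith) hC.le) (le_of_eq ?_)
      ring
  obtain ⟨K, hK0, hKk⟩ := hdown (n - k) le_rfl
  have hnk : n - (n - k) = k := by omega
  rw [hnk] at hKk
  have hC := cauchyConst_pos k
  refine ⟨K + cauchyConst k, by positivity, fun f M A hf hM hA h => ?_⟩
  have hM0 : 0 ≤ M := EssBdd.nonneg (α := α) ⟨hf.aestronglyMeasurable, hM⟩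
  filter_upwards [hKk f M A hf hM hA h] with x hx t ht
  have htp : 0 < t ^ (-((k : ℝ) - β')) := Real.rpow_pos_of_pos ht _
  rcases le_total t 1 with h' | h'
  · refine (hx t ht h').trans (mul_le_mul_of_nonneg_right ?_ htp.le)
    exact mul_le_mul_of_nonneg_right (by linarith) (by linarith)
  · refine (abs_poissonDeriv_le_of_one_le hf hM hε k hβ' h' x).trans
      (mul_le_mul_of_nonneg_right ?_ htp.le)
    have : 0 ≤ K * (M + A) := by positivity
    have : 0 ≤ cauchyConst k * A := by positivity
    linarith

end

/-! ### Differences and the fractional derivative -/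

section

variable {d : ℕ} {α : Fin d → ℝ} [hα : Fact (∀ i, -1 < α i)] {f : (Fin d → ℝ) → ℝ} {M : ℝ}

theorem measurable_iterate_dampedDiff (hf : Measurable f) (ε : ℝ) (j : ℕ) :
    Measurable (Function.uncurry fun s : ℝ => (dampedDiff α ε s)^[j] f) := by
  induction j with
  | zero => exact hf.comp measurable_snd
  | succ j ih =>
    have h : (Function.uncurry fun s : ℝ => (dampedDiff α ε s)^[j + 1] f)
        = fun p : ℝ × (Fin d → ℝ) => dampedPoisson α ε p.1 ((dampedDiff α ε p.1)^[j] f) p.2 -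
          (Function.uncurry fun s : ℝ => (dampedDiff α ε s)^[j] f) p := by
      ext p
      simp only [Function.uncurry, Function.iterate_succ_apply']
      rfl
    rw [h]
    exact (measurable_dampedPoisson_param ih ε measurable_fst measurable_fst measurable_snd).sub ih

/-- `(e^{-εs} P_s - I)^j f` is bounded by `2^j M`, and its coefficients are those of `f` times
`(e^{-sρ} - 1)^j`, where `ρ = ε + √|k|`. -/
theorem iterate_dampedDiff_properties (hf : Measurable f)
    (hM : ∀ᵐ x ∂(laguerreMeasure α), |f x| ≤ M) {ε : ℝ} (hε : 0 ≤ ε) {s : ℝ} (hs : 0 < s) (j : ℕ) :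
    EssBdd α ((dampedDiff α ε s)^[j] f) (2 ^ j * M) ∧
      ∀ k, laguerreCoeff α ((dampedDiff α ε s)^[j] f) k
        = (Real.exp (-(s * (ε + Real.sqrt (∑ i, k i : ℕ)))) - 1) ^ j * laguerreCoeff α f k := by
  induction j with
  | zero => exact ⟨by simpa using ⟨hf.aestronglyMeasurable, hM⟩, fun k => by simp⟩
  | succ j ih =>
    set h := (dampedDiff α ε s)^[j] f with hh
    have hm : Measurable h :=
      (measurable_iterate_dampedDiff hf ε j).comp (measurable_const.prodMk measurable_id)
    have hP := essBdd_dampedPoisson hm ih.1.2 hε hs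
    have hiter : (dampedDiff α ε s)^[j + 1] f = fun x => dampedPoisson α ε s h x - h x := by
      rw [Function.iterate_succ_apply']; rfl
    rw [hiter]
    refine ⟨⟨hP.1.1.sub ih.1.1, ?_⟩, fun k => ?_⟩
    · filter_upwards [hP.1.2, ih.1.2] with x h1 h2
      refine (abs_sub _ _).trans ?_
      rw [pow_succ]; linarith
    · have h1 : laguerreCoeff α (fun x => dampedPoisson α ε s h x - h x) k
          = laguerreCoeff α (dampedPoisson α ε s h) k - laguerreCoeff α h k := by
        simp only [laguerreCoeff, sub_mul]
        exact integral_sub (integrable_mul_laguerreSumPi (hP.1.memLp 2) k)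
          (integrable_mul_laguerreSumPi (ih.1.memLp 2) k)
      rw [h1, hP.2 k, ih.2 k, pow_succ]; ring

/-- A bound of order `θ < 1` for the `k`-th derivative bounds the `k`-th difference: both sides of
`(Q_s - I)^k f = ∫_{[0,s]^k} ∂^k Q_{v₁+⋯+v_k} f dv` have the same Laguerre coefficients. -/
theorem abs_iterate_dampedDiff_le (hf : Measurable f)
    (hM : ∀ᵐ x ∂(laguerreMeasure α), |f x| ≤ M) {ε : ℝ} (hε : 0 ≤ ε) {k : ℕ} (hk : 0 < k)
    {B θ : ℝ} (hB : 0 ≤ B) (hθ : 0 ≤ θ) (hθ1 : θ < 1)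
    (hbd : ∀ t, 0 < t → ∀ᵐ x ∂(laguerreMeasure α), |poissonDeriv α ε f k t x| ≤ B * t ^ (-θ))
    {s : ℝ} (hs : 0 < s) :
    ∀ᵐ x ∂(laguerreMeasure α),
      |(dampedDiff α ε s)^[k] f x| ≤ B * (1 / (1 - θ / k)) ^ k * s ^ ((k : ℝ) - θ) := by
  have hk0 : (0 : ℝ) < k := by exact_mod_cast hk
  have hk1 : (1 : ℝ) ≤ k := by exact_mod_cast hk
  have hθk : θ / k < 1 := by rw [div_lt_one hk0]; linarith
  set ν : Measure (Fin k → ℝ) := Measure.pi fun _ => volume.restrict (Ioc 0 s) with hν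
  have hpos : ∀ᵐ v ∂ν, ∀ i, 0 < v i := by
    refine ae_all_iff.2 fun i => ?_
    refine (Measure.tendsto_eval_ae_ae (μ := fun _ : Fin k => volume.restrict (Ioc 0 s))
      (i := i)).eventually (p := fun u => 0 < u) ?_
    filter_upwards [ae_restrict_mem measurableSet_Ioc] with u hu using hu.1
  have hne : (Finset.univ : Finset (Fin k)).Nonempty := ⟨⟨0, hk⟩, Finset.mem_univ _⟩
  have hsum : ∀ᵐ v ∂ν, 0 < ∑ i, v i := by
    filter_upwards [hpos] with v hv
    exact Finset.sum_pos (fun i _ => hv i) hne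
  have hm := measurable_poissonDeriv hf hM ε k
  have hW : Measurable (Function.uncurry fun (v : Fin k → ℝ) (x : Fin d → ℝ) =>
      poissonDeriv α ε f k (∑ i, v i) x) := by
    have h1 : Measurable fun p : (Fin k → ℝ) × (Fin d → ℝ) => (∑ i, p.1 i, p.2) := by fun_prop
    exact hm.comp h1
  have h1s : IntegrableOn (fun u : ℝ => u ^ (-(θ / k))) (Ioc 0 s) :=
    integrableOn_rpow_Ioc (by linarith) s
  have hbint : Integrable (fun v : Fin k → ℝ => B * ∏ i, v i ^ (-(θ / k))) ν :=
    (Integrable.fintype_prod (f := fun _ u => u ^ (-(θ / k))) fun _ => h1s).const_mul B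
  have hval : ∫ v, B * ∏ i, v i ^ (-(θ / k)) ∂ν
      = B * (1 / (1 - θ / k)) ^ k * s ^ ((k : ℝ) - θ) := by
    rw [integral_const_mul, hν,
      integral_fintype_prod_eq_prod (fun (_ : Fin k) (u : ℝ) => u ^ (-(θ / k)))]
    have h2 : ∫ u in Ioc 0 s, u ^ (-(θ / k)) = 1 / (1 - θ / k) * s ^ (1 - θ / k) := by
      rw [← intervalIntegral.integral_of_le hs.le, integral_rpow (Or.inl (by linarith)),
        Real.zero_rpow (by linarith), show -(θ / (k : ℝ)) + 1 = 1 - θ / k by ring]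
      ring
    simp only [h2, Finset.prod_const, Finset.card_univ, Fintype.card_fin]
    rw [mul_pow, ← Real.rpow_natCast (s ^ _), ← Real.rpow_mul hs.le, mul_assoc]
    congr 4
    field_simp
  have hmix := mixture_properties (α := α) hW hbint (by
    filter_upwards [hpos, hsum] with v hv hvs
    filter_upwards [hbd _ hvs] with x hx
    refine hx.trans (mul_le_mul_of_nonneg_left ?_ hB)
    -- `v₁ + ⋯ + v_k ≥ v_i` for each `i` separates the variables
    have e1 : (∑ i, v i) ^ (-θ) = ∏ _i : Fin k, (∑ i, v i) ^ (-(θ / k)) := by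
      rw [Finset.prod_const, Finset.card_univ, Fintype.card_fin, ← Real.rpow_natCast,
        ← Real.rpow_mul hvs.le]
      congr 1; field_simp
    rw [e1]
    refine Finset.prod_le_prod (fun i _ => by positivity) fun i _ => ?_
    refine Real.rpow_le_rpow_of_nonpos (hv i) ?_ (by rw [neg_nonpos]; positivity)
    exact Finset.single_le_sum (f := v) (fun j _ => (hv j).le) (Finset.mem_univ i))
  have hprop := iterate_dampedDiff_properties hf hM hε hs k
  have hEq := ae_eq_of_laguerreCoeff_eq hprop.1 hmix.2.1 fun l => by
    rw [hprop.2 l, hmix.2.2 l]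
    set ρ := ε + Real.sqrt (∑ i, l i : ℕ)
    have hae : (fun v : Fin k → ℝ => laguerreCoeff α (poissonDeriv α ε f k (∑ i, v i)) l)
        =ᵐ[ν] fun v => (∏ i, (-ρ * Real.exp (-(v i * ρ)))) * laguerreCoeff α f l := by
      filter_upwards [hsum] with v hv
      rw [laguerreCoeff_poissonDeriv hf hM hε k l _ hv, Finset.prod_mul_distrib,
        Finset.prod_const, Finset.card_univ, Fintype.card_fin, ← Real.exp_sum,
        Finset.sum_neg_distrib, Finset.sum_mul]
    rw [integral_congr_ae hae, integral_mul_const, hν,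
      integral_fintype_prod_eq_prod (fun (_ : Fin k) (u : ℝ) => -ρ * Real.exp (-(u * ρ)))]
    simp only [integral_Ioc_neg_mul_exp ρ hs.le, Finset.prod_const, Finset.card_univ,
      Fintype.card_fin]
  rw [← hval]
  filter_upwards [hEq, hmix.2.1.2] with x h1 h2
  rw [h1]; exact h2

/-- The fractional derivative `(εI + √L)^λ` of a Lipschitz function: existence, formula, and the
Lipschitz bound, with constants that do not depend on the function. The function `g` is the integral
of the differences; its time derivatives are
`∂^m Q_t g = (-1)^k / Γ(k - λ) ∫ s^{k-λ-1} ∂^{m+k} Q_{t+s} f ds`, with `Q_t = e^{-εt} P_t`. -/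
theorem exists_fracDeriv (α : Fin d → ℝ) [Fact (∀ i, -1 < α i)] {ε : ℝ} (hε : 0 ≤ ε)
    {lam β : ℝ} (hlam : 0 < lam) (hβ : lam < β) :
    ∃ C : ℝ, 0 ≤ C ∧ ∀ (f : (Fin d → ℝ) → ℝ) (M A : ℝ), Measurable f →
      (∀ᵐ x ∂(laguerreMeasure α), |f x| ≤ M) → LaguerreLipBound α β f A →
      ∃ g : (Fin d → ℝ) → ℝ, EssBdd α g (C * (M + A)) ∧
        (∀ k, laguerreCoeff α g k
          = (ε + Real.sqrt (∑ i, k i : ℕ)) ^ lam * laguerreCoeff α f k) ∧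
        (∀ᵐ x ∂(laguerreMeasure α), IntegrableOn
            (fun s : ℝ => s ^ (-lam - 1) * (dampedDiff α ε s)^[nextInt lam] f x) (Ioi 0) ∧
          g x = 1 / fracConst lam *
            ∫ s in Ioi (0 : ℝ), s ^ (-lam - 1) * (dampedDiff α ε s)^[nextInt lam] f x) ∧
        LaguerreLipBound α (β - lam) g (C * (M + A)) := by
  set k := nextInt lam with hk
  set n := nextInt β with hn
  set m := nextInt (β - lam) with hm
  have hlk : lam < k := lt_nextInt lam
  have hk0 : 0 < k := nextInt_pos lam
  have hk1 : (k : ℝ) - 1 ≤ lam := by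
    rw [hk, nextInt]; push_cast; simp; exact Nat.floor_le hlam.le
  have hβn : β < n := lt_nextInt β
  have hγm : β - lam < m := lt_nextInt _
  have hkn : k ≤ n := nextInt_mono hβ.le
  have hnmk : n ≤ m + k := by
    have h1 : (n : ℝ) - 1 ≤ β := by
      rw [hn, nextInt]; push_cast; simp; exact Nat.floor_le (by linarith)
    have h2 : (n : ℝ) < (m + k : ℕ) + 1 := by push_cast; linarith
    exact_mod_cast Nat.lt_succ_iff.1 (by exact_mod_cast h2)
  -- a smaller order `β' < k`, for which the `k`-th derivative suffices
  obtain ⟨β', hβ'1, hβ'2⟩ : ∃ β', lam < β' ∧ β' < min β k :=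
    exists_between (lt_min hβ hlk)
  have hβ'β := hβ'2.trans_le (min_le_left _ _)
  have hβ'k := hβ'2.trans_le (min_le_right _ _)
  obtain ⟨K₁, hK₁, hlow⟩ := exists_bound_lower α hε (by linarith : 0 ≤ β') hβ'β.le hβn.le hkn hβ'k
  obtain ⟨K₂, hK₂, hhigh⟩ := exists_bound_higher α hε (by linarith : 0 ≤ β) hβn.le hnmk
  obtain ⟨K₃, hK₃, hdamp⟩ := exists_bound_damped α hε le_rfl (by linarith : 0 ≤ β - lam) hγm.le
  set θ := (k : ℝ) - β' with hθ
  have hθ0 : 0 < θ := by linarith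
  have hθ1 : θ < 1 := by linarith
  have hθk : θ / k < 1 := by
    rw [div_lt_one (by linarith)]; linarith
  set c := fracConst lam with hc
  have hc0 : c ≠ 0 := fracConst_ne_zero hlam
  -- the constant in the bound of the difference near zero; `b₀` dominates the integrand
  set E := K₁ * (1 / (1 - θ / k)) ^ k with hE
  have hE0 : 0 ≤ E := by
    have : 0 < 1 - θ / k := by linarith
    positivity
  set b₀ : ℝ → ℝ := fun s => min (E * s ^ (β' - lam - 1)) (2 ^ k * s ^ (-lam - 1)) with hb₀
  have hb₀0 : ∀ s, 0 < s → 0 ≤ b₀ s := fun s hs => le_min (by positivity) (by positivity)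
  have hb₀int : IntegrableOn b₀ (Ioi 0) := by
    refine integrableOn_Ioi_of_two_bounds (C := max E (2 ^ k)) (a := β' - lam - 1) (b := -lam - 1)
      (by fun_prop) (by linarith) (by linarith) ?_ ?_
    · intro u hu _
      rw [abs_of_nonneg (hb₀0 u hu)]
      exact (min_le_left _ _).trans
        (mul_le_mul_of_nonneg_right (le_max_left _ _) (by positivity))
    · intro u hu
      have hu0 : 0 < u := by linarith
      rw [abs_of_nonneg (hb₀0 u hu0)]
      exact (min_le_right _ _).trans
        (mul_le_mul_of_nonneg_right (le_max_right _ _) (by positivity))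
  set J := ∫ s in Ioi (0 : ℝ), b₀ s with hJ
  have hJ0 : 0 ≤ J := setIntegral_nonneg measurableSet_Ioi fun s hs => hb₀0 s hs
  set a := (k : ℝ) - lam with ha
  have ha0 : 0 < a := by linarith
  set γ := ((m + k : ℕ) : ℝ) - β with hγ
  have haγ : a < γ := by rw [hγ, ha]; push_cast; linarith
  set G := ∫ s in Ioi (0 : ℝ), s ^ (a - 1) * (1 + s) ^ (-γ) with hG
  have hG0 : 0 ≤ G := setIntegral_nonneg measurableSet_Ioi fun s (hs : 0 < s) => by positivity
  have hΓ : 0 < Real.Gamma a := Real.Gamma_pos_of_pos ha0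
  set C₁ := J / |c| with hC₁
  set C₂ := G * K₂ / Real.Gamma a with hC₂
  have hC₁0 : 0 ≤ C₁ := by positivity
  have hC₂0 : 0 ≤ C₂ := by positivity
  refine ⟨C₁ + K₃ * (C₁ + C₂), by positivity, fun f M A hf hM hA => ?_⟩
  rw [laguerreLipBound_iff] at hA
  obtain ⟨hA0, hA⟩ := hA
  have hM0 : 0 ≤ M := EssBdd.nonneg (α := α) ⟨hf.aestronglyMeasurable, hM⟩
  have hL := hlow f M A hf hM hA0 hA
  have hH := hhigh f M A hf hM hA0 hA
  -- the differences
  have hsmall : ∀ s, 0 < s → ∀ᵐ x ∂(laguerreMeasure α),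
      |s ^ (-lam - 1) * (dampedDiff α ε s)^[k] f x| ≤ b₀ s * (M + A) := by
    intro s hs
    have h1 := abs_iterate_dampedDiff_le hf hM hε hk0 (B := K₁ * (M + A)) (by positivity) hθ0.le hθ1
      (fun t ht => by filter_upwards [hL] with x hx using hx t ht) hs
    filter_upwards [h1, (iterate_dampedDiff_properties hf hM hε hs k).1.2] with x hx1 hx2
    have hsp : 0 < s ^ (-lam - 1) := Real.rpow_pos_of_pos hs _
    rw [abs_mul, abs_of_pos hsp, hb₀, min_mul_of_nonneg _ _ (by positivity)]
    refine le_min ?_ ?_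
    · have e1 : s ^ (β' - lam - 1) = s ^ (-lam - 1) * s ^ ((k : ℝ) - θ) := by
        rw [← Real.rpow_add hs]; congr 1; rw [hθ]; ring
      calc s ^ (-lam - 1) * |(dampedDiff α ε s)^[k] f x|
          ≤ s ^ (-lam - 1) * (K₁ * (M + A) * (1 / (1 - θ / k)) ^ k * s ^ ((k : ℝ) - θ)) := by
            gcongr
        _ = _ := by rw [e1, hE]; ring
    · calc s ^ (-lam - 1) * |(dampedDiff α ε s)^[k] f x| ≤ s ^ (-lam - 1) * (2 ^ k * (M + A)) := by
            refine mul_le_mul_of_nonneg_left (hx2.trans ?_) hsp.le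
            exact mul_le_mul_of_nonneg_left (by linarith) (by positivity)
        _ = _ := by ring
  have hWm : Measurable (Function.uncurry fun (s : ℝ) (x : Fin d → ℝ) =>
      s ^ (-lam - 1) * (dampedDiff α ε s)^[k] f x) :=
    Measurable.mul (by fun_prop : Measurable fun p : ℝ × (Fin d → ℝ) => p.1 ^ (-lam - 1))
      (measurable_iterate_dampedDiff hf ε k)
  have hmix := mixture_properties (α := α) (ν := volume.restrict (Ioi (0 : ℝ))) hWm
    (hb₀int.mul_const (M + A)) (by
      filter_upwards [ae_restrict_mem measurableSet_Ioi] with s hs using hsmall s hs)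
  set I : (Fin d → ℝ) → ℝ := fun x => ∫ s in Ioi (0 : ℝ),
    s ^ (-lam - 1) * (dampedDiff α ε s)^[k] f x with hI
  have hIm : Measurable I :=
    ((hWm.comp measurable_swap).stronglyMeasurable.integral_prod_right'
      (ν := volume.restrict (Ioi (0 : ℝ)))).measurable
  set g : (Fin d → ℝ) → ℝ := fun x => 1 / c * I x with hg
  have hgm : Measurable g := hIm.const_mul _
  have hgM : ∀ᵐ x ∂(laguerreMeasure α), |g x| ≤ C₁ * (M + A) := by
    filter_upwards [hmix.2.1.2] with x hx
    rw [integral_mul_const] at hx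
    rw [hg, abs_mul, abs_div, abs_one, hC₁, ← hJ] at *
    calc 1 / |c| * |I x| ≤ 1 / |c| * (J * (M + A)) := by gcongr
      _ = _ := by ring
  have hgc : ∀ l, laguerreCoeff α g l
      = (ε + Real.sqrt (∑ i, l i : ℕ)) ^ lam * laguerreCoeff α f l := by
    intro l
    have h1 : laguerreCoeff α g l = 1 / c * laguerreCoeff α I l := by
      simp only [laguerreCoeff, hg, mul_assoc]
      exact integral_const_mul _ _
    rw [h1, hmix.2.2 l]
    set ρ := ε + Real.sqrt (∑ i, l i : ℕ)
    have hρ : 0 ≤ ρ := by positivity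
    have h2 : ∀ s ∈ Ioi (0 : ℝ), laguerreCoeff α (fun x =>
        s ^ (-lam - 1) * (dampedDiff α ε s)^[k] f x) l
        = s ^ (-lam - 1) * (Real.exp (-(s * ρ)) - 1) ^ k * laguerreCoeff α f l := by
      intro s hs
      have h3 := (iterate_dampedDiff_properties hf hM hε hs k).2 l
      rw [mul_assoc, ← h3]
      simp only [laguerreCoeff, mul_assoc]
      exact integral_const_mul _ _
    rw [setIntegral_congr_fun measurableSet_Ioi h2, integral_mul_const,
      integral_rpow_mul_exp_sub_one_pow hlam hρ, ← hc]
    field_simp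
  -- the Lipschitz bound for the damped semigroup
  have hlip : ∀ t, 0 < t → ∀ᵐ x ∂(laguerreMeasure α),
      |poissonDeriv α ε g m t x| ≤ C₂ * (M + A) * t ^ (-((m : ℝ) - (β - lam))) := by
    intro t ht
    have hVm : Measurable (Function.uncurry fun (s : ℝ) (x : Fin d → ℝ) =>
        (-1) ^ k / Real.Gamma a * (s ^ (a - 1) * poissonDeriv α ε f (m + k) (t + s) x)) := by
      have h1 : Measurable fun p : ℝ × (Fin d → ℝ) => (t + p.1, p.2) := by fun_prop
      have h2 := (measurable_poissonDeriv hf hM ε (m + k)).comp h1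
      exact (Measurable.mul (by fun_prop : Measurable fun p : ℝ × (Fin d → ℝ) => p.1 ^ (a - 1))
        h2).const_mul _
    have hmixV := mixture_properties (α := α) (ν := volume.restrict (Ioi (0 : ℝ))) hVm
      (b := fun s => K₂ * (M + A) / Real.Gamma a * (s ^ (a - 1) * (t + s) ^ (-γ)))
      ((integrableOn_rpow_mul_add_rpow_neg ha0 haγ ht).const_mul _) (by
        filter_upwards [ae_restrict_mem measurableSet_Ioi] with s (hs : 0 < s)
        filter_upwards [hH (t + s) (by linarith)] with x hx
        rw [abs_mul, abs_div, abs_pow, abs_neg, abs_one, one_pow, abs_of_pos hΓ, abs_mul,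
          abs_of_pos (Real.rpow_pos_of_pos hs _)]
        calc 1 / Real.Gamma a * (s ^ (a - 1) * |poissonDeriv α ε f (m + k) (t + s) x|)
            ≤ 1 / Real.Gamma a * (s ^ (a - 1) * (K₂ * (M + A) * (t + s) ^ (-γ))) := by
              gcongr
          _ = _ := by ring)
    have hEq := ae_eq_of_laguerreCoeff_eq (α := α)
      (f := poissonDeriv α ε g m t)
      ⟨(measurable_poissonDeriv_section hgm hgM ε m t).aestronglyMeasurable,
        ae_of_all _ fun x => abs_poissonDeriv_le hgm hgM hε m ht x⟩ hmixV.2.1 fun l => by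
      rw [hmixV.2.2 l, laguerreCoeff_poissonDeriv hgm hgM hε m l t ht, hgc l]
      set ρ := ε + Real.sqrt (∑ i, l i : ℕ) with hρdef
      have hρ : 0 ≤ ρ := by positivity
      have h2 : ∀ s ∈ Ioi (0 : ℝ), laguerreCoeff α (fun x => (-1) ^ k / Real.Gamma a *
          (s ^ (a - 1) * poissonDeriv α ε f (m + k) (t + s) x)) l
          = (-1) ^ k / Real.Gamma a * laguerreCoeff α f l *
            (s ^ (a - 1) * ((-ρ) ^ (m + k) * Real.exp (-((t + s) * ρ)))) := by
        intro s (hs : 0 < s)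
        have h3 := laguerreCoeff_poissonDeriv hf hM hε (m + k) l (t + s) (by linarith)
        have h4 : laguerreCoeff α (fun x => (-1) ^ k / Real.Gamma a *
          (s ^ (a - 1) * poissonDeriv α ε f (m + k) (t + s) x)) l
          = (-1) ^ k / Real.Gamma a * (s ^ (a - 1) *
            laguerreCoeff α (poissonDeriv α ε f (m + k) (t + s)) l) := by
          simp only [laguerreCoeff, mul_assoc]
          rw [integral_const_mul, integral_const_mul]
        rw [h4, h3]; ring
      rw [setIntegral_congr_fun measurableSet_Ioi h2, integral_const_mul,
        integral_rpow_mul_neg_pow_mul_exp ha0 (by linarith) hk0 hρ,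
        show (k : ℝ) - a = lam by rw [ha]; ring]
      have h5 : ((-1 : ℝ) ^ k) * (-1) ^ k = 1 := by rw [← mul_pow]; simp
      calc _ = ((-1) ^ k * (-1) ^ k) *
            ((-ρ) ^ m * Real.exp (-(t * ρ)) * ρ ^ lam * laguerreCoeff α f l) := by rw [h5]; ring
        _ = _ := by field_simp
    filter_upwards [hEq, hmixV.2.1.2] with x h1 h2
    rw [h1]
    refine h2.trans_eq ?_
    rw [integral_const_mul, integral_rpow_mul_add_rpow_neg a γ ht, ← hG, hC₂]
    have e1 : a - γ = -((m : ℝ) - (β - lam)) := by rw [ha, hγ]; push_cast; ring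
    rw [e1]; ring
  have hfin := hdamp g (C₁ * (M + A)) (C₂ * (M + A)) hgm hgM (by positivity) hlip
  refine ⟨g, ⟨hgm.aestronglyMeasurable, ?_⟩, hgc, ?_, ?_⟩
  · filter_upwards [hgM] with x hx
    refine hx.trans (mul_le_mul_of_nonneg_right ?_ (by linarith))
    have : 0 ≤ K₃ * (C₁ + C₂) := by positivity
    linarith
  · filter_upwards [hmix.1] with x hx
    exact ⟨hx, rfl⟩
  · rw [laguerreLipBound_iff]
    refine ⟨by positivity, fun t ht => ?_⟩
    filter_upwards [hfin] with x hx
    refine (hx t ht).trans (mul_le_mul_of_nonneg_right ?_ (Real.rpow_pos_of_pos ht _).le)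
    have : 0 ≤ C₁ * (M + A) := by positivity
    linarith

end

/-! ### Boundedness between Lipschitz spaces -/

section

variable {d : ℕ} {α : Fin d → ℝ} [hα : Fact (∀ i, -1 < α i)]

theorem LaguerreLipBound.congr {β A : ℝ} {f g : (Fin d → ℝ) → ℝ} (hf : LaguerreLipBound α β f A)
    (h : f =ᵐ[laguerreMeasure α] g) : LaguerreLipBound α β g A := by
  rw [laguerreLipBound_iff] at hf ⊢
  simpa only [poissonDeriv_congr h] using hf

omit hα in
theorem ae_abs_le_toReal_eLpNorm {f : (Fin d → ℝ) → ℝ} (hf : MemLp f ⊤ (laguerreMeasure α)) :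
    ∀ᵐ x ∂(laguerreMeasure α), |f x| ≤ (eLpNorm f ⊤ (laguerreMeasure α)).toReal := by
  filter_upwards [ae_le_eLpNormEssSup (μ := laguerreMeasure α) (f := f)] with x hx
  rw [← eLpNorm_exponent_top, Real.enorm_eq_ofReal_abs] at hx
  exact (ENNReal.ofReal_le_iff_le_toReal hf.2.ne).1 hx

theorem EssBdd.toReal_eLpNorm_le {f : (Fin d → ℝ) → ℝ} {M : ℝ} (hf : EssBdd α f M) :
    (eLpNorm f ⊤ (laguerreMeasure α)).toReal ≤ M := by
  refine ENNReal.toReal_le_of_le_ofReal hf.nonneg ?_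
  rw [eLpNorm_exponent_top]
  refine eLpNormEssSup_le_of_ae_enorm_bound ?_
  filter_upwards [hf.2] with x hx
  rw [Real.enorm_eq_ofReal_abs]
  exact ENNReal.ofReal_le_ofReal hx

/-- The coefficients with respect to the Rodrigues form of the polynomials. -/
theorem integral_mul_laguerrePoly (f : (Fin d → ℝ) → ℝ) (k : Fin d → ℕ) :
    ∫ x, f x * laguerrePoly α k x ∂(laguerreMeasure α) = laguerreCoeff α f k := by
  refine integral_congr_ae ?_
  filter_upwards [ae_mem_orthant (α := α)] with x hx
  rw [laguerrePoly_eq_laguerreSumPi k hx]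

/-- The iterates of a difference operator that agrees with `dampedDiff` on the orthant, at a point
where two almost everywhere equal functions agree. -/
theorem iterate_eq_iterate_dampedDiff {ε s : ℝ} {Δ : ((Fin d → ℝ) → ℝ) → (Fin d → ℝ) → ℝ}
    (hΔ : ∀ h, ∀ x ∈ orthant d, Δ h x = dampedDiff α ε s h x) {f g : (Fin d → ℝ) → ℝ}
    (hfg : f =ᵐ[laguerreMeasure α] g) (j : ℕ) {x : Fin d → ℝ} (hx : x ∈ orthant d)
    (hfx : f x = g x) : Δ^[j] f x = (dampedDiff α ε s)^[j] g x := by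
  induction j generalizing x with
  | zero => exact hfx
  | succ j ih =>
    have hae : Δ^[j] f =ᵐ[laguerreMeasure α] (dampedDiff α ε s)^[j] g := by
      filter_upwards [hfg, ae_mem_orthant (α := α)] with y hy hyo using ih hyo hy
    rw [Function.iterate_succ_apply', Function.iterate_succ_apply', hΔ _ x hx, dampedDiff,
      dampedDiff, dampedPoisson_congr hae, ih hx hfx]

/-- Boundedness between Lipschitz spaces and the integral formula for the multiplier
`(ε + √n)^λ`, for any difference operator that agrees with `e^{-εs} P_s - I` on the orthant. -/
theorem exists_multiplier_bound (α : Fin d → ℝ) [Fact (∀ i, -1 < α i)] {ε : ℝ} (hε : 0 ≤ ε)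
    {lam β : ℝ} (hlam : 0 < lam) (hβ : lam < β) {m : ℕ → ℝ}
    (hm : ∀ n : ℕ, m n = (ε + Real.sqrt n) ^ lam)
    {Δ : ℝ → ((Fin d → ℝ) → ℝ) → (Fin d → ℝ) → ℝ}
    (hΔ : ∀ s, 0 < s → ∀ h, ∀ x ∈ orthant d, Δ s h x = dampedDiff α ε s h x) :
    ∃ C : ℝ, ∀ f : (Fin d → ℝ) → ℝ, MemLaguerreLip α β f →
      (∃ g, IsLaguerreMultiplier α m f g) ∧
      ∀ g, IsLaguerreMultiplier α m f g →
        MemLaguerreLip α (β - lam) g ∧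
        laguerreLipNorm α (β - lam) g ≤ C * laguerreLipNorm α β f ∧
        ∀ᵐ x ∂(laguerreMeasure α),
          IntegrableOn (fun s : ℝ => s ^ (-lam - 1) * (Δ s)^[nextInt lam] f x) (Ioi 0) ∧
          g x = 1 / fracConst lam *
            ∫ s in Ioi (0 : ℝ), s ^ (-lam - 1) * (Δ s)^[nextInt lam] f x := by
  obtain ⟨C, hC0, hC⟩ := exists_fracDeriv α hε hlam hβ
  refine ⟨2 * C, fun f hf => ?_⟩
  obtain ⟨hfm, A₀, hA₀⟩ := hf
  obtain ⟨f', hf', hff'⟩ := hfm.1.aemeasurable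
  set M := (eLpNorm f ⊤ (laguerreMeasure α)).toReal with hM
  have hfM := ae_abs_le_toReal_eLpNorm hfm
  have hf'M : ∀ᵐ x ∂(laguerreMeasure α), |f' x| ≤ M := by
    filter_upwards [hfM, hff'] with x h1 h2
    rwa [← h2]
  have hf2 : MemLp f 2 (laguerreMeasure α) := EssBdd.memLp ⟨hfm.1, hfM⟩ 2
  have hcoeff : ∀ g k, laguerreCoeff α g k
        = (ε + Real.sqrt (∑ i, k i : ℕ)) ^ lam * laguerreCoeff α f' k ↔
      ∫ x, g x * laguerrePoly α k x ∂(laguerreMeasure α)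
        = m (∑ i, k i) * ∫ x, f x * laguerrePoly α k x ∂(laguerreMeasure α) := by
    intro g k
    rw [hm, integral_mul_laguerrePoly, integral_mul_laguerrePoly, laguerreCoeff_congr hff']
  refine ⟨?_, fun g hg => ?_⟩
  · obtain ⟨g, hg, hgc, -⟩ := hC f' M A₀ hf' hf'M (hA₀.congr hff')
    exact ⟨g, hf2, hg.memLp 2, fun k => (hcoeff g k).1 (hgc k)⟩
  · -- the multiplier is determined by its Laguerre coefficients
    have hkey : ∀ A, LaguerreLipBound α β f A → EssBdd α g (C * (M + A)) ∧
        LaguerreLipBound α (β - lam) g (C * (M + A)) ∧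
        ∀ᵐ x ∂(laguerreMeasure α), IntegrableOn
            (fun s : ℝ => s ^ (-lam - 1) * (dampedDiff α ε s)^[nextInt lam] f' x) (Ioi 0) ∧
          g x = 1 / fracConst lam *
            ∫ s in Ioi (0 : ℝ), s ^ (-lam - 1) * (dampedDiff α ε s)^[nextInt lam] f' x := by
      intro A hA
      obtain ⟨g', hg', hgc', hform, hlip⟩ := hC f' M A hf' hf'M (hA.congr hff')
      have hgg' : g' =ᵐ[laguerreMeasure α] g :=
        ae_eq_of_laguerre_coeff_eq (hg'.memLp 2) hg.2.1 fun k =>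
          (hgc' k).trans ((hcoeff g k).2 (hg.2.2 k)).symm
      refine ⟨hg'.congr hgg', hlip.congr hgg', ?_⟩
      filter_upwards [hform, hgg'] with x hx hx'
      exact ⟨hx.1, hx' ▸ hx.2⟩
    obtain ⟨hgb, hglip, hform⟩ := hkey A₀ hA₀
    refine ⟨⟨hgb.memLp ⊤, _, hglip⟩, ?_, ?_⟩
    · -- the infimum of the admissible constants is approached, not assumed to be attained
      have hne : {A : ℝ | LaguerreLipBound α β f A}.Nonempty := ⟨A₀, hA₀⟩
      refine le_of_forall_pos_le_add fun δ hδ => ?_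
      obtain ⟨A, hA, hAlt⟩ := Real.lt_sInf_add_pos hne (ε := δ / (2 * C + 1)) (by positivity)
      obtain ⟨h1, h2, -⟩ := hkey A hA
      have h3 := h1.toReal_eLpNorm_le
      have h4 : sInf {A : ℝ | LaguerreLipBound α (β - lam) g A} ≤ C * (M + A) :=
        csInf_le ⟨0, fun B hB => hB.1⟩ h2
      have h5 : 2 * C * (δ / (2 * C + 1)) ≤ δ := by
        rw [mul_div_assoc', div_le_iff₀ (by positivity)]
        nlinarith
      have h6 := mul_le_mul_of_nonneg_left hAlt.le (by positivity : 0 ≤ 2 * C)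
      unfold laguerreLipNorm
      rw [← hM]
      linarith
    · filter_upwards [hform, hff', ae_mem_orthant (α := α)] with x hx hfx hxo
      have hcong : EqOn (fun s : ℝ => s ^ (-lam - 1) * (Δ s)^[nextInt lam] f x)
          (fun s : ℝ => s ^ (-lam - 1) * (dampedDiff α ε s)^[nextInt lam] f' x) (Ioi 0) :=
        fun s hs => congrArg (s ^ (-lam - 1) * ·)
          (iterate_eq_iterate_dampedDiff (hΔ s hs) hff' _ hxo hfx)
      rw [setIntegral_congr_fun measurableSet_Ioi hcong]
      exact ⟨hx.1.congr_fun hcong.symm measurableSet_Ioi, hx.2⟩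

end

theorem theorem4p4 (d : ℕ) (α : Fin d → ℝ) (hα : ∀ i, -(1 / 2 : ℝ) < α i)
    (lam β : ℝ) (hlam : 1 ≤ lam) (hβ : lam < β) :
    (∃ C : ℝ, ∀ f : (Fin d → ℝ) → ℝ, MemLaguerreLip α β f →
      (∃ g, IsLaguerreFracDeriv α lam f g) ∧
      ∀ g, IsLaguerreFracDeriv α lam f g →
        MemLaguerreLip α (β - lam) g ∧
        laguerreLipNorm α (β - lam) g ≤ C * laguerreLipNorm α β f ∧
        ∀ᵐ x ∂(laguerreMeasure α),
          IntegrableOn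
            (fun s : ℝ => s ^ (-lam - 1) * (poissonDiff α s)^[nextInt lam] f x) (Ioi 0) ∧
          g x = 1 / fracConst lam *
            ∫ s in Ioi (0 : ℝ), s ^ (-lam - 1) * (poissonDiff α s)^[nextInt lam] f x) ∧
    (∃ C : ℝ, ∀ f : (Fin d → ℝ) → ℝ, MemLaguerreLip α β f →
      (∃ g, IsBesselLaguerreFracDeriv α lam f g) ∧
      ∀ g, IsBesselLaguerreFracDeriv α lam f g →
        MemLaguerreLip α (β - lam) g ∧
        laguerreLipNorm α (β - lam) g ≤ C * laguerreLipNorm α β f ∧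
        ∀ᵐ x ∂(laguerreMeasure α),
          IntegrableOn
            (fun s : ℝ => s ^ (-lam - 1) * (besselPoissonDiff α s)^[nextInt lam] f x) (Ioi 0) ∧
          g x = 1 / fracConst lam *
            ∫ s in Ioi (0 : ℝ), s ^ (-lam - 1) * (besselPoissonDiff α s)^[nextInt lam] f x) := by
  have : Fact (∀ i, -1 < α i) := ⟨fun i => by linarith [hα i]⟩
  refine ⟨exists_multiplier_bound α le_rfl (by linarith) hβ (fun n => ?_)
      fun s hs h x hx => ?_,
    exists_multiplier_bound α zero_le_one (by linarith) hβ (fun n => rfl) fun s hs h x hx => ?_⟩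
  · rw [zero_add, Real.sqrt_eq_rpow, ← Real.rpow_mul n.cast_nonneg]
    congr 1; ring
  · rw [dampedDiff, dampedPoisson_eq_laguerrePoisson hs 0 hx, zero_mul, neg_zero, Real.exp_zero,
      one_mul, poissonDiff]
  · rw [dampedDiff, dampedPoisson_eq_laguerrePoisson hs 1 hx, one_mul, besselPoissonDiff]
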